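/- **Theorem (Obliviousness of $\lambda_{\mathtt{OADT}\Psi}$).** Let $\Sigma$ be a well-typed global context, and let $e_1,e_2$ be expressions with $e_1\approx e_2$ (indistinguishable), $\Sigma;\cdot\vdash e_1:\tau_1$ and $\Sigma;\cdot\vdash e_2:\tau_2$ (both well-typed in the empty local context, possibly at different types). Then for every $n\ge 0$: 1. there is $e_1'$ with $\Sigma\vdash e_1\longrightarrow^n e_1'$ if and only if there is $e_2'$ with $\Sigma\vdash e_2\longrightarrow^n e_2'$; 2. whenever $\Sigma\vdash e_1\longrightarrow^n e_1'$ and $\Sigma\vdash e_2\longrightarrow^n e_2'$, then $e_1'\approx e_2'$. Here $\longrightarrow^n$ means reduction in exactly $n$ small steps, and the calculus is as follows (expressions up to $\alpha$-equivalence; $\mathrm{ite}(b,a,c)$ is $a$ if $b$ is true and $c$ otherwise; a hat marks oblivious things). *Syntax.* Types and expressions form one class: $e,\tau ::= \mathtt{unit}\mid\mathtt{bool}\mid\widehat{\mathtt{bool}}\mid\tau*\tau\mid\tau\,\hat+\,\tau\mid\Pi x{:}\tau,\tau\mid\Psi\hat T\mid x\mid T\mid()\mid b\mid\lambda x{:}\tau.e\mid\mathtt{let}\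 x=e\ \mathtt{in}\ e\mid e\,e\mid C\,e\mid\hat T\,e\mid\mathtt{if}\ e\ \mathtt{then}\ e\ \mathtt{else}\ e\mid\mathtt{mux}\ e\,e\,e\mid(e,e)\mid\langle e,e\rangle\mid\pi_b\,e\mid\widehat{\mathtt{inj}}_b\langle\tau\rangle\,e\mid\widehat{\mathtt{match}}\ e\ \mathtt{with}\ x\Rightarrow e\mid x\Rightarrow e\mid\mathtt{match}\ e\ \mathtt{with}\ \overline{C\,x\Rightarrow e}\mid\mathtt{s}\,e\mid[b]\mid[\mathtt{inj}_b\langle\hat w\rangle\,\hat v]$, where $b$ is a Boolean, $\langle e,e\rangle$ is a $\Psi$-pair, $\mathtt s$ is the Boolean section, and the constructor names of a $\mathtt{match}$ are distinct. Oblivious type values are $\hat w::=\mathtt{unit}\mid\widehat{\mathtt{bool}}\mid\hat w*\hat w\mid\hat w\,\hat+\,\hat w$; oblivious values are $\hat v::=()\mid[b]\mid(\hat v,\hat v)\mid[\mathtt{inj}_b\langle\hat w\rangle\,\hat v]$; values are $v::=\hat v\mid b\mid(v,v)\mid\langle v,v\rangle\mid\lambda x{:}\tau.e\mid C\,v$.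 The partial map $\Sigma$ sends names to (possibly recursive) definitions $\mathtt{data}\ T=\overline{C\,\tau}$ (distinct constructor names), $\mathtt{fn}\ x{:}\tau=e$, or $\mathtt{obliv}\ \hat T(x{:}\tau)=\tau'$. The judgment $\hat v\Leftarrow\hat w$ is generated by: $()\Leftarrow\mathtt{unit}$; $[b]\Leftarrow\widehat{\mathtt{bool}}$; $(\hat v_1,\hat v_2)\Leftarrow\hat w_1*\hat w_2$ if $\hat v_i\Leftarrow\hat w_i$ for $i=1,2$; $[\mathtt{inj}_b\langle\hat w_1\hat+\hat w_2\rangle\,\hat v]\Leftarrow\hat w_1\hat+\hat w_2$ if $\hat v\Leftarrow\mathrm{ite}(b,\hat w_1,\hat w_2)$. *Indistinguishability.* $\approx$ is the least relation that is closed under all term formers (with the same names, labels and literals on both sides) and satisfies $[b]\approx[b']$ and $[\mathtt{inj}_b\langle\hat w\rangle\,\hat v]\approx[\mathtt{inj}_{b'}\langle\hat w\rangle\,\hat v']$ for all $b,b',\hat w,\hat v,\hat v'$: the two sides differ only in the contents of boxed values. *Reduction.* Steps may be taken inside the evaluation contexts $[]*\tau$, $\hat w*[]$, $[]\hat+\tau$,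 $\hat w\hat+[]$, $\mathtt{let}\ x=[]\ \mathtt{in}\ e$, $e\,[]$, $[]\,v$, $C\,[]$, $\hat T\,[]$, $\mathtt{if}\ []\ \mathtt{then}\ e\ \mathtt{else}\ e$, $\mathtt{mux}\ []\,e\,e$, $\mathtt{mux}\ v\,[]\,e$, $\mathtt{mux}\ v\,v\,[]$, $([],e)$, $(v,[])$, $\langle[],e\rangle$, $\langle v,[]\rangle$, $\pi_b[]$, $\widehat{\mathtt{inj}}_b\langle[]\rangle e$, $\widehat{\mathtt{inj}}_b\langle\hat w\rangle[]$, $\widehat{\mathtt{match}}\ []\ \mathtt{with}\ x\Rightarrow e\mid x\Rightarrow e$, $\mathtt{match}\ []\ \mathtt{with}\ \overline{C\,x\Rightarrow e}$, $\mathtt s\,[]$, and the basic steps are: - $x\to e$ if $\mathtt{fn}\ x{:}\tau=e\in\Sigma$; $\hat T\,v\to[v/x]\tau'$ if $\mathtt{obliv}\ \hat T(x{:}\tau)=\tau'\in\Sigma$; - $(\lambda x{:}\tau.e)\,v\to[v/x]e$; $\mathtt{let}\ x=v\ \mathtt{in}\ e\to[v/x]e$; - $\mathtt{if}\ b\ \mathtt{then}\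 e_1\ \mathtt{else}\ e_2\to\mathrm{ite}(b,e_1,e_2)$; $\mathtt{mux}\ [b]\,v_1\,v_2\to\mathrm{ite}(b,v_1,v_2)$; - $\mathtt{match}\ C_i\,v\ \mathtt{with}\ \overline{C\,x\Rightarrow e}\to[v/x]e_i$; $\pi_b(v_1,v_2)\to\mathrm{ite}(b,v_1,v_2)$; $\pi_b\langle v_1,v_2\rangle\to\mathrm{ite}(b,v_1,v_2)$; - $\mathtt s\,b\to[b]$; $\widehat{\mathtt{inj}}_b\langle\hat w\rangle\,\hat v\to[\mathtt{inj}_b\langle\hat w\rangle\,\hat v]$; - $\widehat{\mathtt{match}}\ [\mathtt{inj}_b\langle\hat w_1\hat+\hat w_2\rangle\,\hat v]\ \mathtt{with}\ x\Rightarrow e_1\mid x\Rightarrow e_2\;\to\;\mathtt{mux}\ [b]\ \mathrm{ite}(b,[\hat v/x]e_1,[\hat v_1/x]e_1)\ \mathrm{ite}(b,[\hat v_2/x]e_2,[\hat v/x]e_2)$ for any $\hat v_1\Leftarrow\hat w_1$, $\hat v_2\Leftarrow\hat w_2$ (a nondeterministic choice). *Type equivalence.* $\tau\equiv\tau'$ is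 the equivalence relation generated by parallel reduction under $\Sigma$, in which any set of redexes of the above forms, anywhere in the expression, may be contracted simultaneously, where arguments, definienda, components and branches that are written $v,v_1,v_2$ above may be arbitrary expressions. *Kinds* $\kappa$ are $\mathsf A,\mathsf P,\mathsf O,\mathsf M$ (any, public, oblivious, mixed), ordered by $\mathsf A\sqsubseteq\mathsf P\sqsubseteq\mathsf M$ and $\mathsf A\sqsubseteq\mathsf O\sqsubseteq\mathsf M$. "Well-kinded" means having some kind. Kinding $\Gamma\vdash\tau::\kappa$ is upward closed in $\kappa$ and given by: $\mathtt{unit}::\mathsf A$; $\mathtt{bool}::\mathsf P$; $\widehat{\mathtt{bool}}::\mathsf O$; $T::\mathsf P$ for a data type $T$ of $\Sigma$; $\Psi\hat T::\mathsf M$ for an oblivious type $\hat T$ of $\Sigma$; $\hat T\,e::\mathsf O$ if $\mathtt{obliv}\ \hat T(x{:}\tau)=\tau'\in\Sigma$ and $e:\tau$; $\Pi x{:}\tau_1,\tau_2::\mathsf M$ if $\tau_1$, and $\tau_2$ under $x{:}\tau_1$, are well-kinded; $\tau_1*\tau_2::\kappa$ if both $\tau_i::\kappa$; $\tau_1\hat+\tau_2::\mathsf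 O$ if both $\tau_i::\mathsf O$; and $\mathtt{let}\ x=e\ \mathtt{in}\ \tau'$, $\mathtt{if}\ e_0\ \mathtt{then}\ \tau_1\ \mathtt{else}\ \tau_2$, $\mathtt{match}\ e_0\ \mathtt{with}\ \overline{C\,x\Rightarrow\tau'}$ have kind $\mathsf O$ if $e:\tau$ for some $\tau$ (respectively $e_0:\mathtt{bool}$; $e_0:T$ with $\mathtt{data}\ T=\overline{C\,\tau}\in\Sigma$) and all $\tau',\tau_1,\tau_2,\tau_i'$ have kind $\mathsf O$ in the context extended by the bound variable $x{:}\tau$ (respectively not extended; extended by $x{:}\tau_i$). *Typing* $\Gamma\vdash e:\tau$ is given by: - if $e:\tau$, $\tau\equiv\tau'$ and $\tau'$ is well-kinded, then $e:\tau'$; $():\mathtt{unit}$; $b:\mathtt{bool}$; local variables have the type given by $\Gamma$, global functions the one given by $\Sigma$; - $\lambda x{:}\tau_1.e:\Pi x{:}\tau_1,\tau_2$ if $\tau_1$ is well-kinded and $e:\tau_2$ under $x{:}\tau_1$; $e_2\,e_1:[e_1/x]\tau_2$ if $e_2:\Pi x{:}\tau_1,\tau_2$ and $e_1:\tau_1$;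 $\mathtt{let}\ x=e_1\ \mathtt{in}\ e_2:[e_1/x]\tau_2$ if $e_1:\tau_1$ and $e_2:\tau_2$ under $x{:}\tau_1$; - $(e_1,e_2):\tau_1*\tau_2$ if $e_i:\tau_i$; $\pi_b\,e:\mathrm{ite}(b,\tau_1,\tau_2)$ if $e:\tau_1*\tau_2$; - $\mathtt{if}\ e_0\ \mathtt{then}\ e_1\ \mathtt{else}\ e_2:[e_0/y]\tau$ if $e_0:\mathtt{bool}$, $e_1:[\mathtt{true}/y]\tau$, $e_2:[\mathtt{false}/y]\tau$ and $[e_0/y]\tau$ is well-kinded; - for $\mathtt{data}\ T=\overline{C\,\tau}\in\Sigma$: $C_i\,e:T$ if $e:\tau_i$; $\mathtt{match}\ e_0\ \mathtt{with}\ \overline{C\,x\Rightarrow e}:[e_0/y]\tau'$ if $e_0:T$, $e_i:[C_i\,x/y]\tau'$ under $x{:}\tau_i$ for all $i$, and $[e_0/y]\tau'$ is well-kinded; - for $\mathtt{obliv}\ \hat T(x{:}\tau)=\tau'\in\Sigma$: $\langle e_1,e_2\rangle:\Psi\hat T$ if $e_1:\tau$ and $e_2:\hat T\,e_1$; if $e:\Psi\hat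 T$ then $\pi_1e:\tau$ and $\pi_2e:\hat T(\pi_1e)$ (where $\pi_1=\pi_{\mathtt{true}}$, $\pi_2=\pi_{\mathtt{false}}$); - $\mathtt{mux}\ e_0\,e_1\,e_2:\tau$ if $e_0:\widehat{\mathtt{bool}}$, $\tau::\mathsf O$ and $e_1,e_2:\tau$; $\mathtt s\,e:\widehat{\mathtt{bool}}$ if $e:\mathtt{bool}$; $[b]:\widehat{\mathtt{bool}}$; - $\widehat{\mathtt{inj}}_b\langle\tau_1\hat+\tau_2\rangle\,e:\tau_1\hat+\tau_2$ if $e:\mathrm{ite}(b,\tau_1,\tau_2)$ and $\tau_1\hat+\tau_2::\mathsf O$; $\widehat{\mathtt{match}}\ e_0\ \mathtt{with}\ x\Rightarrow e_1\mid x\Rightarrow e_2:\tau$ if $e_0:\tau_1\hat+\tau_2$, $\tau::\mathsf O$, and $e_i:\tau$ under $x{:}\tau_i$; $[\mathtt{inj}_b\langle\hat w\rangle\,\hat v]:\hat w$ if $[\mathtt{inj}_b\langle\hat w\rangle\,\hat v]\Leftarrow\hat w$. *Well-typed global context.* Every definition of $\Sigma$ satisfies, under $\Sigma$ itself: for $\mathtt{fn}\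 x{:}\tau=e$, $\cdot\vdash\tau$ is well-kinded and $\cdot\vdash e:\tau$; for $\mathtt{data}\ T=\overline{C\,\tau}$, $\cdot\vdash\tau_i::\mathsf P$ for all $i$; for $\mathtt{obliv}\ \hat T(x{:}\tau)=\tau'$, $\cdot\vdash\tau::\mathsf P$ and $x{:}\tau\vdash\tau'::\mathsf O$. -/

import Mathlib

/-! # The core calculus of oblivious algebraic data types with Psi-types

Types and expressions share one syntactic class.  Local variables are de Bruijn indices
(so alpha-equivalent expressions are equal); a binder binds index `0` of its body.  Global
definitions are referred to by name. -/

namespace OADT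

/-- Names of global definitions (functions, algebraic data types, oblivious types). -/
abbrev Name := ℕ

/-- Names of data constructors. -/
abbrev CName := ℕ

/-- Oblivious type values `ω ::= unit | ~bool | ω * ω | ω ~+ ω`. -/
inductive OTy : Type
  | unit : OTy
  | obool : OTy
  | prod (w₁ w₂ : OTy) : OTy
  | osum (w₁ w₂ : OTy) : OTy

/-- Oblivious values `u ::= () | [b] | (u, u) | [inj_b<ω> u]`. -/
inductive OVal : Type
  | unit : OVal
  | boxLit (b : Bool) : OVal
  | pair (u₁ u₂ : OVal) : OVal
  | boxInj (b : Bool) (w : OTy) (u : OVal) : OVal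

/-- Expressions and types.  The Boolean index of `proj`, `oinj` and `boxInj` is `true` for the
first component (left injection) and `false` for the second component (right injection). -/
inductive Exp : Type
  -- types: `unit`, `bool`, `~bool`, `τ * τ`, `τ ~+ τ`, `Π x : τ, τ`, `Ψ T`, and an ADT name `T`
  | unitT : Exp
  | boolT : Exp
  | oboolT : Exp
  | prod (t₁ t₂ : Exp) : Exp
  | osum (t₁ t₂ : Exp) : Exp
  | pi (t₁ t₂ : Exp) : Exp
  | psi (T : Name) : Exp
  | adt (T : Name) : Exp
  -- local variable, name of a global function, `()`, and Boolean literal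
  | var (k : ℕ) : Exp
  | gfun (x : Name) : Exp
  | unit : Exp
  | lit (b : Bool) : Exp
  -- `λ x : τ. e`, `let x = e in e`, application, `C e`, and oblivious type application `T e`
  | lam (t e : Exp) : Exp
  | letE (e₁ e₂ : Exp) : Exp
  | app (e₁ e₂ : Exp) : Exp
  | ctor (C : CName) (e : Exp) : Exp
  | oapp (T : Name) (e : Exp) : Exp
  -- public and oblivious conditional
  | ite (e₀ e₁ e₂ : Exp) : Exp
  | mux (e₀ e₁ e₂ : Exp) : Exp
  -- pair, Psi-pair, and projection (for both kinds of pairs)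
  | pair (e₁ e₂ : Exp) : Exp
  | psiPair (e₁ e₂ : Exp) : Exp
  | proj (b : Bool) (e : Exp) : Exp
  -- oblivious injection `~inj_b<τ> e` and its elimination `~match e with x => e | x => e`
  | oinj (b : Bool) (t e : Exp) : Exp
  | omatch (e₀ e₁ e₂ : Exp) : Exp
  -- `match e with C₁ x => e₁ | ... | Cₙ x => eₙ` with pairwise distinct constructor names
  | cases (n : ℕ) (C : Fin n ↪ CName) (e₀ : Exp) (es : Fin n → Exp) : Exp
  -- Boolean section `~bool#s e`
  | sec (e : Exp) : Exp
  -- run-time boxed values `[b]` and `[inj_b<ω> u]`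
  | boxLit (b : Bool) : Exp
  | boxInj (b : Bool) (w : OTy) (u : OVal) : Exp

/-- An oblivious type value as an expression. -/
def OTy.toExp : OTy → Exp
  | .unit => .unitT
  | .obool => .oboolT
  | .prod w₁ w₂ => .prod w₁.toExp w₂.toExp
  | .osum w₁ w₂ => .osum w₁.toExp w₂.toExp

/-- An oblivious value as an expression. -/
def OVal.toExp : OVal → Exp
  | .unit => .unit
  | .boxLit b => .boxLit b
  | .pair u₁ u₂ => .pair u₁.toExp u₂.toExp
  | .boxInj b w u => .boxInj b w u

/-! ## Substitution -/

/-- Extend a renaming under one binder. -/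
def upRen (r : ℕ → ℕ) : ℕ → ℕ
  | 0 => 0
  | k + 1 => r k + 1

/-- Renaming of local variables. -/
def Exp.rename : (ℕ → ℕ) → Exp → Exp
  | _, .unitT => .unitT
  | _, .boolT => .boolT
  | _, .oboolT => .oboolT
  | r, .prod t₁ t₂ => .prod (t₁.rename r) (t₂.rename r)
  | r, .osum t₁ t₂ => .osum (t₁.rename r) (t₂.rename r)
  | r, .pi t₁ t₂ => .pi (t₁.rename r) (t₂.rename (upRen r))
  | _, .psi T => .psi T
  | _, .adt T => .adt T
  | r, .var k => .var (r k)
  | _, .gfun x => .gfun x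
  | _, .unit => .unit
  | _, .lit b => .lit b
  | r, .lam t e => .lam (t.rename r) (e.rename (upRen r))
  | r, .letE e₁ e₂ => .letE (e₁.rename r) (e₂.rename (upRen r))
  | r, .app e₁ e₂ => .app (e₁.rename r) (e₂.rename r)
  | r, .ctor C e => .ctor C (e.rename r)
  | r, .oapp T e => .oapp T (e.rename r)
  | r, .ite e₀ e₁ e₂ => .ite (e₀.rename r) (e₁.rename r) (e₂.rename r)
  | r, .mux e₀ e₁ e₂ => .mux (e₀.rename r) (e₁.rename r) (e₂.rename r)
  | r, .pair e₁ e₂ => .pair (e₁.rename r) (e₂.rename r)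
  | r, .psiPair e₁ e₂ => .psiPair (e₁.rename r) (e₂.rename r)
  | r, .proj b e => .proj b (e.rename r)
  | r, .oinj b t e => .oinj b (t.rename r) (e.rename r)
  | r, .omatch e₀ e₁ e₂ =>
      .omatch (e₀.rename r) (e₁.rename (upRen r)) (e₂.rename (upRen r))
  | r, .cases n C e₀ es => .cases n C (e₀.rename r) (fun i => (es i).rename (upRen r))
  | r, .sec e => .sec (e.rename r)
  | _, .boxLit b => .boxLit b
  | _, .boxInj b w u => .boxInj b w u

/-- Weakening by one fresh innermost variable. -/
def Exp.shift (e : Exp) : Exp := e.rename (· + 1)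

/-- Extend a simultaneous substitution by a value for index `0`. -/
def scons (a : Exp) (s : ℕ → Exp) : ℕ → Exp
  | 0 => a
  | k + 1 => s k

/-- Extend a simultaneous substitution under one binder. -/
def up (s : ℕ → Exp) : ℕ → Exp := scons (.var 0) (fun k => (s k).shift)

/-- Simultaneous capture-avoiding substitution. -/
def Exp.subst : (ℕ → Exp) → Exp → Exp
  | _, .unitT => .unitT
  | _, .boolT => .boolT
  | _, .oboolT => .oboolT
  | s, .prod t₁ t₂ => .prod (t₁.subst s) (t₂.subst s)
  | s, .osum t₁ t₂ => .osum (t₁.subst s) (t₂.subst s)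
  | s, .pi t₁ t₂ => .pi (t₁.subst s) (t₂.subst (up s))
  | _, .psi T => .psi T
  | _, .adt T => .adt T
  | s, .var k => s k
  | _, .gfun x => .gfun x
  | _, .unit => .unit
  | _, .lit b => .lit b
  | s, .lam t e => .lam (t.subst s) (e.subst (up s))
  | s, .letE e₁ e₂ => .letE (e₁.subst s) (e₂.subst (up s))
  | s, .app e₁ e₂ => .app (e₁.subst s) (e₂.subst s)
  | s, .ctor C e => .ctor C (e.subst s)
  | s, .oapp T e => .oapp T (e.subst s)
  | s, .ite e₀ e₁ e₂ => .ite (e₀.subst s) (e₁.subst s) (e₂.subst s)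
  | s, .mux e₀ e₁ e₂ => .mux (e₀.subst s) (e₁.subst s) (e₂.subst s)
  | s, .pair e₁ e₂ => .pair (e₁.subst s) (e₂.subst s)
  | s, .psiPair e₁ e₂ => .psiPair (e₁.subst s) (e₂.subst s)
  | s, .proj b e => .proj b (e.subst s)
  | s, .oinj b t e => .oinj b (t.subst s) (e.subst s)
  | s, .omatch e₀ e₁ e₂ => .omatch (e₀.subst s) (e₁.subst (up s)) (e₂.subst (up s))
  | s, .cases n C e₀ es => .cases n C (e₀.subst s) (fun i => (es i).subst (up s))
  | s, .sec e => .sec (e.subst s)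
  | _, .boxLit b => .boxLit b
  | _, .boxInj b w u => .boxInj b w u

/-- `e.inst a` is `[a/x]e`, where `x` is the variable with index `0` of `e`. -/
def Exp.inst (e a : Exp) : Exp := e.subst (scons a .var)

/-- `t.instCtor C` is `[C x/y]t`: the variable `y` (index `0` of `t`) is replaced by `C x`, where
`x` is a new variable, which takes over index `0`. -/
def Exp.instCtor (t : Exp) (C : CName) : Exp :=
  t.subst (scons (.ctor C (.var 0)) (fun k => .var (k + 1)))

/-! ## Global definitions -/

/-- Global definitions. -/
inductive GDef : Type
  /-- `data T = C₁ τ₁ | ... | Cₙ τₙ`, with pairwise distinct constructor names -/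
  | data (n : ℕ) (C : Fin n ↪ CName) (ts : Fin n → Exp) : GDef
  /-- `fn x : τ = e` -/
  | fn (t e : Exp) : GDef
  /-- `obliv T (x : τ) = τ'`, where `x` is index `0` of `τ'` -/
  | obliv (t t' : Exp) : GDef

/-- A global context: a partial map from names to global definitions. -/
abbrev GCtx := Name → Option GDef

/-! ## Operational semantics -/

/-- Values. -/
inductive Value : Exp → Prop
  | unit : Value .unit
  | boxLit (b : Bool) : Value (.boxLit b)
  | boxInj (b : Bool) (w : OTy) (u : OVal) : Value (.boxInj b w u)
  | lit (b : Bool) : Value (.lit b)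
  | pair {v₁ v₂ : Exp} : Value v₁ → Value v₂ → Value (.pair v₁ v₂)
  | psiPair {v₁ v₂ : Exp} : Value v₁ → Value v₂ → Value (.psiPair v₁ v₂)
  | lam (t e : Exp) : Value (.lam t e)
  | ctor (C : CName) {v : Exp} : Value v → Value (.ctor C v)

/-- Oblivious value synthesis `u ⇐ ω`. -/
inductive OValTy : OVal → OTy → Prop
  | unit : OValTy .unit .unit
  | obool (b : Bool) : OValTy (.boxLit b) .obool
  | prod {u₁ u₂ : OVal} {w₁ w₂ : OTy} :
      OValTy u₁ w₁ → OValTy u₂ w₂ → OValTy (.pair u₁ u₂) (.prod w₁ w₂)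
  | osum {b : Bool} {u : OVal} {w₁ w₂ : OTy} :
      OValTy u (cond b w₁ w₂) → OValTy (.boxInj b (.osum w₁ w₂) u) (.osum w₁ w₂)

/-- Small-step reduction under a global context.  The rules whose names start with `c` are the
congruence rules, one for each form of evaluation context. -/
inductive Step (S : GCtx) : Exp → Exp → Prop
  -- evaluation contexts
  | cProd₁ {t₁ t₁' t₂ : Exp} : Step S t₁ t₁' → Step S (.prod t₁ t₂) (.prod t₁' t₂)
  | cProd₂ {w : OTy} {t₂ t₂' : Exp} :
      Step S t₂ t₂' → Step S (.prod w.toExp t₂) (.prod w.toExp t₂')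
  | cOSum₁ {t₁ t₁' t₂ : Exp} : Step S t₁ t₁' → Step S (.osum t₁ t₂) (.osum t₁' t₂)
  | cOSum₂ {w : OTy} {t₂ t₂' : Exp} :
      Step S t₂ t₂' → Step S (.osum w.toExp t₂) (.osum w.toExp t₂')
  | cLet {e₁ e₁' e₂ : Exp} : Step S e₁ e₁' → Step S (.letE e₁ e₂) (.letE e₁' e₂)
  | cApp₂ {e₁ e₂ e₂' : Exp} : Step S e₂ e₂' → Step S (.app e₁ e₂) (.app e₁ e₂')
  | cApp₁ {e₁ e₁' v : Exp} : Value v → Step S e₁ e₁' → Step S (.app e₁ v) (.app e₁' v)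
  | cCtor {C : CName} {e e' : Exp} : Step S e e' → Step S (.ctor C e) (.ctor C e')
  | cOApp {T : Name} {e e' : Exp} : Step S e e' → Step S (.oapp T e) (.oapp T e')
  | cIte {e₀ e₀' e₁ e₂ : Exp} : Step S e₀ e₀' → Step S (.ite e₀ e₁ e₂) (.ite e₀' e₁ e₂)
  | cMux₀ {e₀ e₀' e₁ e₂ : Exp} : Step S e₀ e₀' → Step S (.mux e₀ e₁ e₂) (.mux e₀' e₁ e₂)
  | cMux₁ {v₀ e₁ e₁' e₂ : Exp} :
      Value v₀ → Step S e₁ e₁' → Step S (.mux v₀ e₁ e₂) (.mux v₀ e₁' e₂)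
  | cMux₂ {v₀ v₁ e₂ e₂' : Exp} :
      Value v₀ → Value v₁ → Step S e₂ e₂' → Step S (.mux v₀ v₁ e₂) (.mux v₀ v₁ e₂')
  | cPair₁ {e₁ e₁' e₂ : Exp} : Step S e₁ e₁' → Step S (.pair e₁ e₂) (.pair e₁' e₂)
  | cPair₂ {v₁ e₂ e₂' : Exp} :
      Value v₁ → Step S e₂ e₂' → Step S (.pair v₁ e₂) (.pair v₁ e₂')
  | cPsiPair₁ {e₁ e₁' e₂ : Exp} : Step S e₁ e₁' → Step S (.psiPair e₁ e₂) (.psiPair e₁' e₂)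
  | cPsiPair₂ {v₁ e₂ e₂' : Exp} :
      Value v₁ → Step S e₂ e₂' → Step S (.psiPair v₁ e₂) (.psiPair v₁ e₂')
  | cProj {b : Bool} {e e' : Exp} : Step S e e' → Step S (.proj b e) (.proj b e')
  | cOInj₁ {b : Bool} {t t' e : Exp} : Step S t t' → Step S (.oinj b t e) (.oinj b t' e)
  | cOInj₂ {b : Bool} {w : OTy} {e e' : Exp} :
      Step S e e' → Step S (.oinj b w.toExp e) (.oinj b w.toExp e')
  | cOMatch {e₀ e₀' e₁ e₂ : Exp} :
      Step S e₀ e₀' → Step S (.omatch e₀ e₁ e₂) (.omatch e₀' e₁ e₂)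
  | cCases {n : ℕ} {C : Fin n ↪ CName} {e₀ e₀' : Exp} {es : Fin n → Exp} :
      Step S e₀ e₀' → Step S (.cases n C e₀ es) (.cases n C e₀' es)
  | cSec {e e' : Exp} : Step S e e' → Step S (.sec e) (.sec e')
  -- reduction rules
  | fn {x : Name} {t e : Exp} : S x = some (.fn t e) → Step S (.gfun x) e
  | oadt {T : Name} {t t' v : Exp} :
      S T = some (.obliv t t') → Value v → Step S (.oapp T v) (t'.inst v)
  | app {t e v : Exp} : Value v → Step S (.app (.lam t e) v) (e.inst v)
  | letE {v e : Exp} : Value v → Step S (.letE v e) (e.inst v)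
  | ite {b : Bool} {e₁ e₂ : Exp} : Step S (.ite (.lit b) e₁ e₂) (cond b e₁ e₂)
  | mux {b : Bool} {v₁ v₂ : Exp} :
      Value v₁ → Value v₂ → Step S (.mux (.boxLit b) v₁ v₂) (cond b v₁ v₂)
  | cases {n : ℕ} {C : Fin n ↪ CName} {i : Fin n} {v : Exp} {es : Fin n → Exp} :
      Value v → Step S (.cases n C (.ctor (C i) v) es) ((es i).inst v)
  | proj {b : Bool} {v₁ v₂ : Exp} :
      Value v₁ → Value v₂ → Step S (.proj b (.pair v₁ v₂)) (cond b v₁ v₂)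
  | psiProj {b : Bool} {v₁ v₂ : Exp} :
      Value v₁ → Value v₂ → Step S (.proj b (.psiPair v₁ v₂)) (cond b v₁ v₂)
  | sec {b : Bool} : Step S (.sec (.lit b)) (.boxLit b)
  | oinj {b : Bool} {w : OTy} {u : OVal} : Step S (.oinj b w.toExp u.toExp) (.boxInj b w u)
  | omatch {b : Bool} {w₁ w₂ : OTy} {u u₁ u₂ : OVal} {e₁ e₂ : Exp} :
      OValTy u₁ w₁ → OValTy u₂ w₂ →
      Step S (.omatch (.boxInj b (.osum w₁ w₂) u) e₁ e₂)
        (.mux (.boxLit b)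
          (cond b (e₁.inst u.toExp) (e₁.inst u₁.toExp))
          (cond b (e₂.inst u₂.toExp) (e₂.inst u.toExp)))

/-- `StepN S n e e'`: the expression `e` reduces to `e'` in exactly `n` steps. -/
inductive StepN (S : GCtx) : ℕ → Exp → Exp → Prop
  | zero (e : Exp) : StepN S 0 e e
  | succ {n : ℕ} {e e' e'' : Exp} : Step S e e' → StepN S n e' e'' → StepN S (n + 1) e e''

/-! ## Type equivalence -/

/-- Parallel reduction: any number of existing redexes (in any position, also under binders, and
without a restriction to values) are contracted simultaneously. -/
inductive Pared (S : GCtx) : Exp → Exp → Prop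
  | refl (e : Exp) : Pared S e e
  -- contraction
  | fn {x : Name} {t e : Exp} : S x = some (.fn t e) → Pared S (.gfun x) e
  | oadt {T : Name} {t t' e e' : Exp} :
      S T = some (.obliv t t') → Pared S e e' → Pared S (.oapp T e) (t'.inst e')
  | beta {t e₁ e₁' e₂ e₂' : Exp} :
      Pared S e₁ e₁' → Pared S e₂ e₂' → Pared S (.app (.lam t e₁) e₂) (e₁'.inst e₂')
  | letBeta {e₁ e₁' e₂ e₂' : Exp} :
      Pared S e₁ e₁' → Pared S e₂ e₂' → Pared S (.letE e₁ e₂) (e₂'.inst e₁')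
  | iteLit {b : Bool} {e₁ e₁' e₂ e₂' : Exp} :
      Pared S e₁ e₁' → Pared S e₂ e₂' → Pared S (.ite (.lit b) e₁ e₂) (cond b e₁' e₂')
  | muxBox {b : Bool} {e₁ e₁' e₂ e₂' : Exp} :
      Pared S e₁ e₁' → Pared S e₂ e₂' → Pared S (.mux (.boxLit b) e₁ e₂) (cond b e₁' e₂')
  | casesCtor {n : ℕ} {C : Fin n ↪ CName} {i : Fin n} {e e' : Exp} {es es' : Fin n → Exp} :
      Pared S e e' → (∀ j, Pared S (es j) (es' j)) →
      Pared S (.cases n C (.ctor (C i) e) es) ((es' i).inst e')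
  | projPair {b : Bool} {e₁ e₁' e₂ e₂' : Exp} :
      Pared S e₁ e₁' → Pared S e₂ e₂' → Pared S (.proj b (.pair e₁ e₂)) (cond b e₁' e₂')
  | projPsiPair {b : Bool} {e₁ e₁' e₂ e₂' : Exp} :
      Pared S e₁ e₁' → Pared S e₂ e₂' → Pared S (.proj b (.psiPair e₁ e₂)) (cond b e₁' e₂')
  | secLit {b : Bool} : Pared S (.sec (.lit b)) (.boxLit b)
  | oinjBox {b : Bool} {w : OTy} {u : OVal} :
      Pared S (.oinj b w.toExp u.toExp) (.boxInj b w u)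
  | omatchBox {b : Bool} {w₁ w₂ : OTy} {u u₁ u₂ : OVal} {e₁ e₁' e₂ e₂' : Exp} :
      OValTy u₁ w₁ → OValTy u₂ w₂ → Pared S e₁ e₁' → Pared S e₂ e₂' →
      Pared S (.omatch (.boxInj b (.osum w₁ w₂) u) e₁ e₂)
        (.mux (.boxLit b)
          (cond b (e₁'.inst u.toExp) (e₁'.inst u₁.toExp))
          (cond b (e₂'.inst u₂.toExp) (e₂'.inst u.toExp)))
  -- congruence
  | prod {t₁ t₁' t₂ t₂' : Exp} :
      Pared S t₁ t₁' → Pared S t₂ t₂' → Pared S (.prod t₁ t₂) (.prod t₁' t₂')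
  | osum {t₁ t₁' t₂ t₂' : Exp} :
      Pared S t₁ t₁' → Pared S t₂ t₂' → Pared S (.osum t₁ t₂) (.osum t₁' t₂')
  | pi {t₁ t₁' t₂ t₂' : Exp} :
      Pared S t₁ t₁' → Pared S t₂ t₂' → Pared S (.pi t₁ t₂) (.pi t₁' t₂')
  | lam {t t' e e' : Exp} : Pared S t t' → Pared S e e' → Pared S (.lam t e) (.lam t' e')
  | letE {e₁ e₁' e₂ e₂' : Exp} :
      Pared S e₁ e₁' → Pared S e₂ e₂' → Pared S (.letE e₁ e₂) (.letE e₁' e₂')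
  | app {e₁ e₁' e₂ e₂' : Exp} :
      Pared S e₁ e₁' → Pared S e₂ e₂' → Pared S (.app e₁ e₂) (.app e₁' e₂')
  | ctor {C : CName} {e e' : Exp} : Pared S e e' → Pared S (.ctor C e) (.ctor C e')
  | oapp {T : Name} {e e' : Exp} : Pared S e e' → Pared S (.oapp T e) (.oapp T e')
  | ite {e₀ e₀' e₁ e₁' e₂ e₂' : Exp} :
      Pared S e₀ e₀' → Pared S e₁ e₁' → Pared S e₂ e₂' →
      Pared S (.ite e₀ e₁ e₂) (.ite e₀' e₁' e₂')
  | mux {e₀ e₀' e₁ e₁' e₂ e₂' : Exp} :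
      Pared S e₀ e₀' → Pared S e₁ e₁' → Pared S e₂ e₂' →
      Pared S (.mux e₀ e₁ e₂) (.mux e₀' e₁' e₂')
  | pair {e₁ e₁' e₂ e₂' : Exp} :
      Pared S e₁ e₁' → Pared S e₂ e₂' → Pared S (.pair e₁ e₂) (.pair e₁' e₂')
  | psiPair {e₁ e₁' e₂ e₂' : Exp} :
      Pared S e₁ e₁' → Pared S e₂ e₂' → Pared S (.psiPair e₁ e₂) (.psiPair e₁' e₂')
  | proj {b : Bool} {e e' : Exp} : Pared S e e' → Pared S (.proj b e) (.proj b e')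
  | oinj {b : Bool} {t t' e e' : Exp} :
      Pared S t t' → Pared S e e' → Pared S (.oinj b t e) (.oinj b t' e')
  | omatch {e₀ e₀' e₁ e₁' e₂ e₂' : Exp} :
      Pared S e₀ e₀' → Pared S e₁ e₁' → Pared S e₂ e₂' →
      Pared S (.omatch e₀ e₁ e₂) (.omatch e₀' e₁' e₂')
  | cases {n : ℕ} {C : Fin n ↪ CName} {e₀ e₀' : Exp} {es es' : Fin n → Exp} :
      Pared S e₀ e₀' → (∀ j, Pared S (es j) (es' j)) →
      Pared S (.cases n C e₀ es) (.cases n C e₀' es')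
  | sec {e e' : Exp} : Pared S e e' → Pared S (.sec e) (.sec e')

/-- Type equivalence: the equivalence relation generated by parallel reduction. -/
def TyEquiv (S : GCtx) : Exp → Exp → Prop := Relation.EqvGen (Pared S)

/-! ## Kinding and typing -/

/-- Kinds: any, public, oblivious, mixed. -/
inductive Kind : Type
  | any : Kind
  | pub : Kind
  | obl : Kind
  | mix : Kind

/-- The order on kinds: `any` is the least, `mix` the greatest, `pub` and `obl` are incomparable. -/
inductive Kind.Le : Kind → Kind → Prop
  | refl (k : Kind) : Kind.Le k k
  | any_le (k : Kind) : Kind.Le .any k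
  | le_mix (k : Kind) : Kind.Le k .mix

/-- What a judgment assigns to an expression: a type (typing) or a kind (kinding). -/
inductive Cls : Type
  | ty (t : Exp) : Cls
  | kd (k : Kind) : Cls

/-- Typing contexts; the innermost variable comes first.  The entry for a variable lives in the
rest of the context to its right. -/
abbrev Ctx := List Exp

/-- The mutually dependent typing and kinding judgments, presented as one inductive family:
`Judg S G e (.ty t)` is the typing judgment `S; G ⊢ e : t`, and `Judg S G t (.kd k)` is the
kinding judgment `S; G ⊢ t :: k`. -/
inductive Judg (S : GCtx) : Ctx → Exp → Cls → Prop
  -- kinding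
  | kSub {G : Ctx} {t : Exp} {k k' : Kind} :
      Judg S G t (.kd k) → k.Le k' → Judg S G t (.kd k')
  | kUnit {G : Ctx} : Judg S G .unitT (.kd .any)
  | kBool {G : Ctx} : Judg S G .boolT (.kd .pub)
  | kOBool {G : Ctx} : Judg S G .oboolT (.kd .obl)
  | kADT {G : Ctx} {T : Name} {n : ℕ} {C : Fin n ↪ CName} {ts : Fin n → Exp} :
      S T = some (.data n C ts) → Judg S G (.adt T) (.kd .pub)
  | kOADT {G : Ctx} {T : Name} {t t' e : Exp} :
      S T = some (.obliv t t') → Judg S G e (.ty t) → Judg S G (.oapp T e) (.kd .obl)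
  | kPi {G : Ctx} {t₁ t₂ : Exp} {k₁ k₂ : Kind} :
      Judg S G t₁ (.kd k₁) → Judg S (t₁ :: G) t₂ (.kd k₂) → Judg S G (.pi t₁ t₂) (.kd .mix)
  | kProd {G : Ctx} {t₁ t₂ : Exp} {k : Kind} :
      Judg S G t₁ (.kd k) → Judg S G t₂ (.kd k) → Judg S G (.prod t₁ t₂) (.kd k)
  | kOSum {G : Ctx} {t₁ t₂ : Exp} :
      Judg S G t₁ (.kd .obl) → Judg S G t₂ (.kd .obl) → Judg S G (.osum t₁ t₂) (.kd .obl)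
  | kPsi {G : Ctx} {T : Name} {t t' : Exp} :
      S T = some (.obliv t t') → Judg S G (.psi T) (.kd .mix)
  | kLet {G : Ctx} {e t t' : Exp} :
      Judg S G e (.ty t) → Judg S (t :: G) t' (.kd .obl) → Judg S G (.letE e t') (.kd .obl)
  | kIf {G : Ctx} {e₀ t₁ t₂ : Exp} :
      Judg S G e₀ (.ty .boolT) → Judg S G t₁ (.kd .obl) → Judg S G t₂ (.kd .obl) →
      Judg S G (.ite e₀ t₁ t₂) (.kd .obl)
  | kMatch {G : Ctx} {T : Name} {n : ℕ} {C : Fin n ↪ CName} {ts ts' : Fin n → Exp} {e₀ : Exp} :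
      S T = some (.data n C ts) → Judg S G e₀ (.ty (.adt T)) →
      (∀ i, Judg S (ts i :: G) (ts' i) (.kd .obl)) →
      Judg S G (.cases n C e₀ ts') (.kd .obl)
  -- typing
  | tConv {G : Ctx} {e t t' : Exp} {k : Kind} :
      Judg S G e (.ty t) → TyEquiv S t t' → Judg S G t' (.kd k) → Judg S G e (.ty t')
  | tUnit {G : Ctx} : Judg S G .unit (.ty .unitT)
  | tLit {G : Ctx} {b : Bool} : Judg S G (.lit b) (.ty .boolT)
  | tVar {G : Ctx} {i : ℕ} {t : Exp} :
      G[i]? = some t → Judg S G (.var i) (.ty (t.rename (· + (i + 1))))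
  | tFun {G : Ctx} {x : Name} {t e : Exp} :
      S x = some (.fn t e) → Judg S G (.gfun x) (.ty t)
  | tAbs {G : Ctx} {t₁ t₂ e : Exp} {k : Kind} :
      Judg S (t₁ :: G) e (.ty t₂) → Judg S G t₁ (.kd k) → Judg S G (.lam t₁ e) (.ty (.pi t₁ t₂))
  | tApp {G : Ctx} {t₁ t₂ e₁ e₂ : Exp} :
      Judg S G e₂ (.ty (.pi t₁ t₂)) → Judg S G e₁ (.ty t₁) →
      Judg S G (.app e₂ e₁) (.ty (t₂.inst e₁))
  | tLet {G : Ctx} {t₁ t₂ e₁ e₂ : Exp} :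
      Judg S G e₁ (.ty t₁) → Judg S (t₁ :: G) e₂ (.ty t₂) →
      Judg S G (.letE e₁ e₂) (.ty (t₂.inst e₁))
  | tPair {G : Ctx} {t₁ t₂ e₁ e₂ : Exp} :
      Judg S G e₁ (.ty t₁) → Judg S G e₂ (.ty t₂) →
      Judg S G (.pair e₁ e₂) (.ty (.prod t₁ t₂))
  | tProj {G : Ctx} {b : Bool} {t₁ t₂ e : Exp} :
      Judg S G e (.ty (.prod t₁ t₂)) → Judg S G (.proj b e) (.ty (cond b t₁ t₂))
  -- in `tIf` and `tMatch` the result type is required to be well-kinded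
  | tIf {G : Ctx} {e₀ e₁ e₂ t : Exp} {k : Kind} :
      Judg S G e₀ (.ty .boolT) → Judg S G e₁ (.ty (t.inst (.lit true))) →
      Judg S G e₂ (.ty (t.inst (.lit false))) → Judg S G (t.inst e₀) (.kd k) →
      Judg S G (.ite e₀ e₁ e₂) (.ty (t.inst e₀))
  | tCtor {G : Ctx} {T : Name} {n : ℕ} {C : Fin n ↪ CName} {ts : Fin n → Exp} {i : Fin n}
      {e : Exp} :
      S T = some (.data n C ts) → Judg S G e (.ty (ts i)) →
      Judg S G (.ctor (C i) e) (.ty (.adt T))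
  | tMatch {G : Ctx} {T : Name} {n : ℕ} {C : Fin n ↪ CName} {ts : Fin n → Exp}
      {e₀ t' : Exp} {es : Fin n → Exp} {k : Kind} :
      S T = some (.data n C ts) → Judg S G e₀ (.ty (.adt T)) →
      (∀ i, Judg S (ts i :: G) (es i) (.ty (t'.instCtor (C i)))) →
      Judg S G (t'.inst e₀) (.kd k) →
      Judg S G (.cases n C e₀ es) (.ty (t'.inst e₀))
  | tPsiPair {G : Ctx} {T : Name} {t t' e₁ e₂ : Exp} :
      S T = some (.obliv t t') → Judg S G e₁ (.ty t) → Judg S G e₂ (.ty (.oapp T e₁)) →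
      Judg S G (.psiPair e₁ e₂) (.ty (.psi T))
  | tPsiProj₁ {G : Ctx} {T : Name} {t t' e : Exp} :
      S T = some (.obliv t t') → Judg S G e (.ty (.psi T)) → Judg S G (.proj true e) (.ty t)
  | tPsiProj₂ {G : Ctx} {T : Name} {t t' e : Exp} :
      S T = some (.obliv t t') → Judg S G e (.ty (.psi T)) →
      Judg S G (.proj false e) (.ty (.oapp T (.proj true e)))
  | tMux {G : Ctx} {t e₀ e₁ e₂ : Exp} :
      Judg S G e₀ (.ty .oboolT) → Judg S G t (.kd .obl) →
      Judg S G e₁ (.ty t) → Judg S G e₂ (.ty t) → Judg S G (.mux e₀ e₁ e₂) (.ty t)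
  | tOInj {G : Ctx} {b : Bool} {t₁ t₂ e : Exp} :
      Judg S G e (.ty (cond b t₁ t₂)) → Judg S G (.osum t₁ t₂) (.kd .obl) →
      Judg S G (.oinj b (.osum t₁ t₂) e) (.ty (.osum t₁ t₂))
  | tOMatch {G : Ctx} {t₁ t₂ t e₀ e₁ e₂ : Exp} :
      Judg S G e₀ (.ty (.osum t₁ t₂)) → Judg S G t (.kd .obl) →
      Judg S (t₁ :: G) e₁ (.ty t.shift) → Judg S (t₂ :: G) e₂ (.ty t.shift) →
      Judg S G (.omatch e₀ e₁ e₂) (.ty t)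
  | tSec {G : Ctx} {e : Exp} : Judg S G e (.ty .boolT) → Judg S G (.sec e) (.ty .oboolT)
  | tBoxLit {G : Ctx} {b : Bool} : Judg S G (.boxLit b) (.ty .oboolT)
  | tBoxInj {G : Ctx} {b : Bool} {w : OTy} {u : OVal} :
      OValTy (.boxInj b w u) w → Judg S G (.boxInj b w u) (.ty w.toExp)

/-- The typing judgment `S; G ⊢ e : t`. -/
abbrev HasType (S : GCtx) (G : Ctx) (e t : Exp) : Prop := Judg S G e (.ty t)

/-- The kinding judgment `S; G ⊢ t :: k`. -/
abbrev HasKind (S : GCtx) (G : Ctx) (t : Exp) (k : Kind) : Prop := Judg S G t (.kd k)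

/-- Well-typedness of a global definition. -/
inductive GDef.Ok (S : GCtx) : GDef → Prop
  | fn {t e : Exp} {k : Kind} : HasKind S [] t k → HasType S [] e t → GDef.Ok S (.fn t e)
  | data {n : ℕ} {C : Fin n ↪ CName} {ts : Fin n → Exp} :
      (∀ i, HasKind S [] (ts i) .pub) → GDef.Ok S (.data n C ts)
  | obliv {t t' : Exp} :
      HasKind S [] t .pub → HasKind S [t] t' .obl → GDef.Ok S (.obliv t t')

/-- A global context is well-typed if all its definitions are (under that same context, so that
recursive definitions are allowed). -/
def GCtx.Ok (S : GCtx) : Prop := ∀ (x : Name) (D : GDef), S x = some D → D.Ok S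

/-! ## Indistinguishability -/

/-- Two expressions are indistinguishable if they agree except for the contents of boxed values:
the bit of `[b]`, and the tag and payload (not the public type annotation) of `[inj_b<ω> u]`. -/
inductive Indist : Exp → Exp → Prop
  | boxLit (b b' : Bool) : Indist (.boxLit b) (.boxLit b')
  | boxInj (b b' : Bool) (w : OTy) (u u' : OVal) : Indist (.boxInj b w u) (.boxInj b' w u')
  | unitT : Indist .unitT .unitT
  | boolT : Indist .boolT .boolT
  | oboolT : Indist .oboolT .oboolT
  | prod {t₁ t₁' t₂ t₂' : Exp} :
      Indist t₁ t₁' → Indist t₂ t₂' → Indist (.prod t₁ t₂) (.prod t₁' t₂')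
  | osum {t₁ t₁' t₂ t₂' : Exp} :
      Indist t₁ t₁' → Indist t₂ t₂' → Indist (.osum t₁ t₂) (.osum t₁' t₂')
  | pi {t₁ t₁' t₂ t₂' : Exp} :
      Indist t₁ t₁' → Indist t₂ t₂' → Indist (.pi t₁ t₂) (.pi t₁' t₂')
  | psi (T : Name) : Indist (.psi T) (.psi T)
  | adt (T : Name) : Indist (.adt T) (.adt T)
  | var (k : ℕ) : Indist (.var k) (.var k)
  | gfun (x : Name) : Indist (.gfun x) (.gfun x)
  | unit : Indist .unit .unit
  | lit (b : Bool) : Indist (.lit b) (.lit b)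
  | lam {t t' e e' : Exp} : Indist t t' → Indist e e' → Indist (.lam t e) (.lam t' e')
  | letE {e₁ e₁' e₂ e₂' : Exp} :
      Indist e₁ e₁' → Indist e₂ e₂' → Indist (.letE e₁ e₂) (.letE e₁' e₂')
  | app {e₁ e₁' e₂ e₂' : Exp} :
      Indist e₁ e₁' → Indist e₂ e₂' → Indist (.app e₁ e₂) (.app e₁' e₂')
  | ctor (C : CName) {e e' : Exp} : Indist e e' → Indist (.ctor C e) (.ctor C e')
  | oapp (T : Name) {e e' : Exp} : Indist e e' → Indist (.oapp T e) (.oapp T e')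
  | ite {e₀ e₀' e₁ e₁' e₂ e₂' : Exp} :
      Indist e₀ e₀' → Indist e₁ e₁' → Indist e₂ e₂' → Indist (.ite e₀ e₁ e₂) (.ite e₀' e₁' e₂')
  | mux {e₀ e₀' e₁ e₁' e₂ e₂' : Exp} :
      Indist e₀ e₀' → Indist e₁ e₁' → Indist e₂ e₂' → Indist (.mux e₀ e₁ e₂) (.mux e₀' e₁' e₂')
  | pair {e₁ e₁' e₂ e₂' : Exp} :
      Indist e₁ e₁' → Indist e₂ e₂' → Indist (.pair e₁ e₂) (.pair e₁' e₂')
  | psiPair {e₁ e₁' e₂ e₂' : Exp} :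
      Indist e₁ e₁' → Indist e₂ e₂' → Indist (.psiPair e₁ e₂) (.psiPair e₁' e₂')
  | proj (b : Bool) {e e' : Exp} : Indist e e' → Indist (.proj b e) (.proj b e')
  | oinj (b : Bool) {t t' e e' : Exp} :
      Indist t t' → Indist e e' → Indist (.oinj b t e) (.oinj b t' e')
  | omatch {e₀ e₀' e₁ e₁' e₂ e₂' : Exp} :
      Indist e₀ e₀' → Indist e₁ e₁' → Indist e₂ e₂' →
      Indist (.omatch e₀ e₁ e₂) (.omatch e₀' e₁' e₂')
  | cases (n : ℕ) (C : Fin n ↪ CName) {e₀ e₀' : Exp} {es es' : Fin n → Exp} :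
      Indist e₀ e₀' → (∀ i, Indist (es i) (es' i)) →
      Indist (.cases n C e₀ es) (.cases n C e₀' es')
  | sec {e e' : Exp} : Indist e e' → Indist (.sec e) (.sec e')

end OADT

/-! Indistinguishable expressions have the same shape outside their boxes, and whether a step is
possible is decided by that shape. So either both sides can step or neither can
(`Step.exists_of_indist`, which needs no typing). What needs typing is that the results are again
indistinguishable (`Step.indist`).

Only two redexes read the contents of a box. A `mux` on `[b]` may select different arms on the two
sides. Its arms, however, share a type of oblivious kind, and any two values of such a type are
indistinguishable (`Value.indist_of_hasKind`). An oblivious match substitutes into each branch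
either the genuine payload or a guessed inhabitant. Both have the type of the same summand, so they
are indistinguishable by `OValTy.indist`, and the tag is hidden again in the box that guards the
resulting `mux`. The statement for `n` steps is an induction that uses preservation on both sides.

Most of the work is the metatheory of dependent types with conversion. Parallel reduction has the
diamond property (`Pared.diamond`). Hence equivalent types have a common reduct (`TyEquiv.join`),
type formers are injective, and distinct normal types are inequivalent. Confluence survives the
guessed inhabitants: two contractions of the same match differ only in the arm that its `mux`
discards.

Preservation is proved directly for parallel reduction (`Judg.pared`), and for typing and kinding
together. It therefore covers small steps and also transports kinds along reduction of types. In
particular, an oblivious type cannot be equivalent to `bool`, a data type, a function type or a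
Psi-type: it would reduce to such a type, which would then have oblivious kind, and kinding
inversion excludes this. -/

namespace OADT

/-! ## Substitution algebra -/

@[simp] theorem upRen_succ (r : ℕ → ℕ) (k : ℕ) : upRen r (k + 1) = r k + 1 := rfl
@[simp] theorem scons_succ (a : Exp) (s : ℕ → Exp) (k : ℕ) : scons a s (k + 1) = s k := rfl
@[simp] theorem up_succ (s : ℕ → Exp) (k : ℕ) : up s (k + 1) = (s k).shift := rfl

theorem upRen_comp (r s : ℕ → ℕ) : upRen s ∘ upRen r = upRen (s ∘ r) := by
  funext k; cases k <;> rfl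

/-- The four composition laws are proved in order of dependence. Lifting a composite under a binder
requires commuting with `shift`, which is itself a renaming, so the laws involving renamings come
before `Exp.subst_subst`. -/
theorem Exp.rename_rename (e : Exp) (r s : ℕ → ℕ) :
    (e.rename r).rename s = e.rename (s ∘ r) := by
  induction e generalizing r s <;> simp [Exp.rename, upRen_comp, *]

theorem up_comp_upRen (r : ℕ → ℕ) (s : ℕ → Exp) : up s ∘ upRen r = up (s ∘ r) := by
  funext k; cases k <;> rfl

theorem Exp.rename_subst (e : Exp) (r : ℕ → ℕ) (s : ℕ → Exp) :
    (e.rename r).subst s = e.subst (s ∘ r) := by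
  induction e generalizing r s <;> simp [Exp.rename, Exp.subst, up_comp_upRen, *]

theorem Exp.shift_rename (e : Exp) (r : ℕ → ℕ) :
    e.shift.rename (upRen r) = (e.rename r).shift := by
  simp only [Exp.shift, Exp.rename_rename]; rfl

theorem up_rename (s : ℕ → Exp) (r : ℕ → ℕ) :
    (fun k => (up s k).rename (upRen r)) = up (fun k => (s k).rename r) := by
  funext k
  cases k with
  | zero => rfl
  | succ k => simp [Exp.shift_rename]

theorem Exp.subst_rename (e : Exp) (s : ℕ → Exp) (r : ℕ → ℕ) :
    (e.subst s).rename r = e.subst (fun k => (s k).rename r) := by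
  induction e generalizing r s <;> simp [Exp.rename, Exp.subst, up_rename, *]

theorem Exp.shift_subst (e : Exp) (s : ℕ → Exp) :
    e.shift.subst (up s) = (e.subst s).shift := by
  simp only [Exp.shift, Exp.rename_subst, Exp.subst_rename]; rfl

theorem up_subst (s t : ℕ → Exp) :
    (fun k => (up s k).subst (up t)) = up (fun k => (s k).subst t) := by
  funext k
  cases k with
  | zero => rfl
  | succ k => simp [Exp.shift_subst]

theorem Exp.subst_subst (e : Exp) (s t : ℕ → Exp) :
    (e.subst s).subst t = e.subst (fun k => (s k).subst t) := by
  induction e generalizing s t <;> simp [Exp.subst, up_subst, *]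

theorem up_var_comp (r : ℕ → ℕ) : up (Exp.var ∘ r) = Exp.var ∘ upRen r := by
  funext k; cases k <;> rfl

theorem Exp.rename_eq_subst (e : Exp) (r : ℕ → ℕ) : e.rename r = e.subst (Exp.var ∘ r) := by
  induction e generalizing r <;> simp [Exp.rename, Exp.subst, up_var_comp, *]

theorem up_var : up Exp.var = Exp.var := by
  funext k; cases k <;> rfl

@[simp] theorem Exp.subst_var (e : Exp) : e.subst Exp.var = e := by
  induction e <;> simp [Exp.subst, up_var, *]

theorem Exp.shift_inst (e a : Exp) : e.shift.inst a = e := by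
  simp only [Exp.shift, Exp.inst, Exp.rename_subst]
  exact e.subst_var

theorem Exp.inst_subst (e a : Exp) (s : ℕ → Exp) :
    (e.inst a).subst s = (e.subst (up s)).inst (a.subst s) := by
  simp only [Exp.inst, Exp.subst_subst]
  congr 1
  funext k
  cases k with
  | zero => rfl
  | succ k => exact (Exp.shift_inst (s k) (a.subst s)).symm

theorem Exp.inst_rename (e a : Exp) (r : ℕ → ℕ) :
    (e.inst a).rename r = (e.rename (upRen r)).inst (a.rename r) := by
  simp only [Exp.rename_eq_subst, Exp.inst_subst, up_var_comp]

/-- After `instCtor`, index `0` is bound again, now to the constructor argument. This is why the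
substitution is lifted on both sides. -/
theorem Exp.instCtor_subst (e : Exp) (C : CName) (s : ℕ → Exp) :
    (e.instCtor C).subst (up s) = (e.subst (up s)).instCtor C := by
  simp only [Exp.instCtor, Exp.subst_subst]
  congr 1
  funext k
  cases k with
  | zero => rfl
  | succ k =>
    simp only [scons_succ, Exp.subst, up_succ, Exp.shift, Exp.rename_subst]
    rw [Exp.rename_eq_subst]
    rfl

theorem Exp.instCtor_rename (e : Exp) (C : CName) (r : ℕ → ℕ) :
    (e.instCtor C).rename (upRen r) = (e.rename (upRen r)).instCtor C := by
  simp only [Exp.rename_eq_subst, ← up_var_comp, Exp.instCtor_subst]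

/-- This matches the type of a `cases` branch, once its payload is known, with the type that
`tMatch` gives to the whole expression. -/
theorem Exp.instCtor_inst (e : Exp) (C : CName) (a : Exp) :
    (e.instCtor C).inst a = e.inst (.ctor C a) := by
  simp only [Exp.instCtor, Exp.inst, Exp.subst_subst]
  congr 1
  funext k
  cases k <;> rfl

@[simp] theorem OTy.toExp_subst (w : OTy) (s : ℕ → Exp) : w.toExp.subst s = w.toExp := by
  induction w <;> simp [OTy.toExp, Exp.subst, *]

@[simp] theorem OVal.toExp_subst (u : OVal) (s : ℕ → Exp) : u.toExp.subst s = u.toExp := by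
  induction u <;> simp [OVal.toExp, Exp.subst, *]

@[simp] theorem OTy.toExp_rename (w : OTy) (r : ℕ → ℕ) : w.toExp.rename r = w.toExp := by
  simp [Exp.rename_eq_subst]

theorem OTy.toExp_injective {w w' : OTy} (h : w.toExp = w'.toExp) : w = w' := by
  induction w generalizing w' with
  | unit => cases w' <;> simp_all [OTy.toExp]
  | obool => cases w' <;> simp_all [OTy.toExp]
  | prod a b iha ihb =>
    cases w' <;> simp [OTy.toExp] at h
    rw [iha h.1, ihb h.2]
  | osum a b iha ihb =>
    cases w' <;> simp [OTy.toExp] at h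
    rw [iha h.1, ihb h.2]

theorem OVal.toExp_injective {u u' : OVal} (h : u.toExp = u'.toExp) : u = u' := by
  induction u generalizing u' with
  | unit => cases u' <;> simp_all [OVal.toExp]
  | boxLit => cases u' <;> simp_all [OVal.toExp]
  | pair a b iha ihb =>
    cases u' <;> simp [OVal.toExp] at h
    rw [iha h.1, ihb h.2]
  | boxInj => cases u' <;> simp_all [OVal.toExp]

theorem cond_subst (b : Bool) (x y : Exp) (s : ℕ → Exp) :
    (cond b x y).subst s = cond b (x.subst s) (y.subst s) := by
  cases b <;> rfl

theorem cond_rename (b : Bool) (x y : Exp) (r : ℕ → ℕ) :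
    (cond b x y).rename r = cond b (x.rename r) (y.rename r) := by
  cases b <;> rfl

/-- Every oblivious type value is inhabited. -/
theorem OTy.exists_val (w : OTy) : ∃ u, OValTy u w := by
  induction w with
  | unit => exact ⟨_, .unit⟩
  | obool => exact ⟨_, .obool true⟩
  | prod _ _ h₁ h₂ =>
    obtain ⟨u₁, h₁⟩ := h₁
    obtain ⟨u₂, h₂⟩ := h₂
    exact ⟨_, .prod h₁ h₂⟩
  | osum _ _ h₁ _ =>
    obtain ⟨u₁, h₁⟩ := h₁
    exact ⟨_, .osum (b := true) h₁⟩

/-! ## Indistinguishability -/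

theorem Indist.refl (e : Exp) : Indist e e := by
  induction e <;> constructor <;> assumption

theorem Indist.symm {e e' : Exp} (h : Indist e e') : Indist e' e := by
  induction h <;> constructor <;> assumption

theorem Indist.trans {e₁ e₂ e₃ : Exp} (h : Indist e₁ e₂) (h' : Indist e₂ e₃) :
    Indist e₁ e₃ := by
  induction h generalizing e₃ with
  | cases n C _ _ ih₀ ih =>
    cases h' with
    | cases _ _ h₀ h => exact .cases n C (ih₀ h₀) fun i => ih i (h i)
  | _ => cases h'; constructor <;> solve_by_elim

theorem Indist.rename {e e' : Exp} (h : Indist e e') (r : ℕ → ℕ) :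
    Indist (e.rename r) (e'.rename r) := by
  induction h generalizing r
  all_goals simp only [Exp.rename]; constructor
  all_goals solve_by_elim

theorem Indist.up {s s' : ℕ → Exp} (h : ∀ k, Indist (s k) (s' k)) (k : ℕ) :
    Indist (up s k) (up s' k) := by
  cases k with
  | zero => exact .refl _
  | succ k => exact (h k).rename _

theorem Indist.subst {e e' : Exp} (h : Indist e e') {s s' : ℕ → Exp}
    (hs : ∀ k, Indist (s k) (s' k)) : Indist (e.subst s) (e'.subst s') := by
  induction h generalizing s s' with
  | var k => exact hs k
  | _ => simp only [Exp.subst]; constructor <;> solve_by_elim [Indist.up]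

theorem Indist.inst {e e' a a' : Exp} (h : Indist e e') (ha : Indist a a') :
    Indist (e.inst a) (e'.inst a') :=
  h.subst fun k => by
    cases k with
    | zero => exact ha
    | succ k => exact .refl _

/-- The type fixes the skeleton of units and pairs and the public annotation of every injection.
Whatever else may differ lies inside a box. This makes the guesses in an oblivious match harmless.
-/
theorem OValTy.indist {u u' : OVal} {w : OTy} (h : OValTy u w) (h' : OValTy u' w) :
    Indist u.toExp u'.toExp := by
  induction h generalizing u' with
  | unit => cases h'; exact .refl _
  | obool b => cases h'; exact .boxLit _ _
  | prod _ _ ih₁ ih₂ =>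
    cases h' with
    | prod h₁ h₂ => exact .pair (ih₁ h₁) (ih₂ h₂)
  | osum _ _ => cases h'; exact .boxInj _ _ _ _ _

/-! ## Parallel reduction -/

/-- All definitions of a global context are closed. -/
structure GCtx.Closed (S : GCtx) : Prop where
  fn {x : Name} {t e : Exp} : S x = some (.fn t e) →
    ∀ s : ℕ → Exp, t.subst s = t ∧ e.subst s = e
  data {T : Name} {n : ℕ} {C : Fin n ↪ CName} {ts : Fin n → Exp} :
    S T = some (.data n C ts) → ∀ (i : Fin n) (s : ℕ → Exp), (ts i).subst s = ts i
  obliv {T : Name} {t t' : Exp} : S T = some (.obliv t t') →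
    ∀ s : ℕ → Exp, t.subst s = t ∧ t'.subst (up s) = t'

/-- Parallel reduction is closed under simultaneous substitution of an arbitrary family `s`
on both sides. -/
theorem Pared.subst_left {S : GCtx} (hS : S.Closed) {e e' : Exp} (h : Pared S e e')
    (s : ℕ → Exp) : Pared S (e.subst s) (e'.subst s) := by
  induction h generalizing s with
  | refl e => exact .refl _
  | fn h => rw [(hS.fn h s).2]; exact .fn h
  | oadt h _ ih =>
    rw [Exp.inst_subst, (hS.obliv h s).2]
    exact .oadt h (ih s)
  | beta _ _ ih₁ ih₂ => rw [Exp.inst_subst]; exact .beta (ih₁ _) (ih₂ _)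
  | letBeta _ _ ih₁ ih₂ => rw [Exp.inst_subst]; exact .letBeta (ih₁ _) (ih₂ _)
  | iteLit _ _ ih₁ ih₂ => rw [cond_subst]; exact .iteLit (ih₁ _) (ih₂ _)
  | muxBox _ _ ih₁ ih₂ => rw [cond_subst]; exact .muxBox (ih₁ _) (ih₂ _)
  | casesCtor _ _ ih₁ ih₂ =>
    rw [Exp.inst_subst]
    -- The family of branches is given explicitly, so that its `i`-th member unifies with the
    -- substituted branch in the goal.
    exact .casesCtor (es' := fun j => Exp.subst _ _) (ih₁ _) fun j => ih₂ j _
  | projPair _ _ ih₁ ih₂ => rw [cond_subst]; exact .projPair (ih₁ _) (ih₂ _)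
  | projPsiPair _ _ ih₁ ih₂ => rw [cond_subst]; exact .projPsiPair (ih₁ _) (ih₂ _)
  | secLit => exact .secLit
  | oinjBox => simp only [Exp.subst, OTy.toExp_subst, OVal.toExp_subst]; exact .oinjBox
  | omatchBox h₁ h₂ _ _ ih₁ ih₂ =>
    simp only [Exp.subst, cond_subst, Exp.inst_subst, OVal.toExp_subst]
    exact .omatchBox h₁ h₂ (ih₁ _) (ih₂ _)
  | _ => simp only [Exp.subst]; constructor <;> solve_by_elim

theorem Pared.rename {S : GCtx} (hS : S.Closed) {e e' : Exp} (h : Pared S e e')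
    (r : ℕ → ℕ) : Pared S (e.rename r) (e'.rename r) := by
  simp only [Exp.rename_eq_subst]
  exact h.subst_left hS _

theorem Pared.up {S : GCtx} (hS : S.Closed) {s s' : ℕ → Exp}
    (h : ∀ k, Pared S (s k) (s' k)) (k : ℕ) : Pared S (up s k) (up s' k) := by
  cases k with
  | zero => exact .refl _
  | succ k => exact (h k).rename hS _

/-- This is the `refl` case of `Pared.subst`: the expression stays fixed, but the expressions put
for its variables still reduce. -/
theorem Pared.subst_right {S : GCtx} (hS : S.Closed) (e : Exp) {s s' : ℕ → Exp}
    (h : ∀ k, Pared S (s k) (s' k)) : Pared S (e.subst s) (e.subst s') := by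
  induction e generalizing s s' with
  | var k => exact h k
  | unitT | boolT | oboolT | psi | adt | gfun | unit | lit | boxLit | boxInj => exact .refl _
  | _ => simp only [Exp.subst]; constructor <;> solve_by_elim [Pared.up hS]

theorem Pared.subst {S : GCtx} (hS : S.Closed) {e e' : Exp} (h : Pared S e e')
    {s s' : ℕ → Exp} (hs : ∀ k, Pared S (s k) (s' k)) :
    Pared S (e.subst s) (e'.subst s') := by
  induction h generalizing s s' with
  | refl e => exact Pared.subst_right hS e hs
  | fn h => rw [(hS.fn h s').2]; exact .fn h
  | oadt h _ ih =>
    rw [Exp.inst_subst, (hS.obliv h s').2]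
    exact .oadt h (ih hs)
  | beta _ _ ih₁ ih₂ => rw [Exp.inst_subst]; exact .beta (ih₁ (Pared.up hS hs)) (ih₂ hs)
  | letBeta _ _ ih₁ ih₂ => rw [Exp.inst_subst]; exact .letBeta (ih₁ hs) (ih₂ (Pared.up hS hs))
  | iteLit _ _ ih₁ ih₂ => rw [cond_subst]; exact .iteLit (ih₁ hs) (ih₂ hs)
  | muxBox _ _ ih₁ ih₂ => rw [cond_subst]; exact .muxBox (ih₁ hs) (ih₂ hs)
  | casesCtor _ _ ih₁ ih₂ =>
    rw [Exp.inst_subst]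
    exact .casesCtor (es' := fun j => Exp.subst _ _) (ih₁ hs) fun j => ih₂ j (Pared.up hS hs)
  | projPair _ _ ih₁ ih₂ => rw [cond_subst]; exact .projPair (ih₁ hs) (ih₂ hs)
  | projPsiPair _ _ ih₁ ih₂ => rw [cond_subst]; exact .projPsiPair (ih₁ hs) (ih₂ hs)
  | secLit => exact .secLit
  | oinjBox => simp only [Exp.subst, OTy.toExp_subst, OVal.toExp_subst]; exact .oinjBox
  | omatchBox h₁ h₂ _ _ ih₁ ih₂ =>
    simp only [Exp.subst, cond_subst, Exp.inst_subst, OVal.toExp_subst]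
    exact .omatchBox h₁ h₂ (ih₁ (Pared.up hS hs)) (ih₂ (Pared.up hS hs))
  | _ => simp only [Exp.subst]; constructor <;> solve_by_elim [Pared.up hS]

theorem Pared.inst {S : GCtx} (hS : S.Closed) {e e' a a' : Exp} (h : Pared S e e')
    (ha : Pared S a a') : Pared S (e.inst a) (e'.inst a') :=
  h.subst hS fun k => by
    cases k with
    | zero => exact ha
    | succ k => exact .refl _

theorem Pared.select {S : GCtx} {x x' y y' : Exp} (b : Bool) (hx : Pared S x x')
    (hy : Pared S y y') : Pared S (cond b x y) (cond b x' y') := by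
  cases b <;> assumption

/-! ### Inversion -/

theorem Pared.toExp_oty {S : GCtx} {w : OTy} {e : Exp} (h : Pared S w.toExp e) :
    e = w.toExp := by
  induction w generalizing e with
  | unit => cases h; rfl
  | obool => cases h; rfl
  | prod a b iha ihb =>
    cases h with
    | refl => rfl
    | prod h₁ h₂ => rw [iha h₁, ihb h₂]; rfl
  | osum a b iha ihb =>
    cases h with
    | refl => rfl
    | osum h₁ h₂ => rw [iha h₁, ihb h₂]; rfl

theorem Pared.toExp_oval {S : GCtx} {u : OVal} {e : Exp} (h : Pared S u.toExp e) :
    e = u.toExp := by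
  induction u generalizing e with
  | unit => cases h; rfl
  | boxLit => cases h; rfl
  | pair a b iha ihb =>
    cases h with
    | refl => rfl
    | pair h₁ h₂ => rw [iha h₁, ihb h₂]; rfl
  | boxInj => cases h; rfl

/-- The inversion lemmas absorb `refl` into the congruence rule, so the diamond proofs only have to
compare congruences with contractions. -/
theorem Pared.lam_inv {S : GCtx} {t e x : Exp} (h : Pared S (.lam t e) x) :
    ∃ t' e', x = .lam t' e' ∧ Pared S t t' ∧ Pared S e e' := by
  cases h with
  | refl => exact ⟨_, _, rfl, .refl _, .refl _⟩
  | lam h₁ h₂ => exact ⟨_, _, rfl, h₁, h₂⟩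

theorem Pared.pi_inv {S : GCtx} {t e x : Exp} (h : Pared S (.pi t e) x) :
    ∃ t' e', x = .pi t' e' ∧ Pared S t t' ∧ Pared S e e' := by
  cases h with
  | refl => exact ⟨_, _, rfl, .refl _, .refl _⟩
  | pi h₁ h₂ => exact ⟨_, _, rfl, h₁, h₂⟩

theorem Pared.prod_inv {S : GCtx} {t e x : Exp} (h : Pared S (.prod t e) x) :
    ∃ t' e', x = .prod t' e' ∧ Pared S t t' ∧ Pared S e e' := by
  cases h with
  | refl => exact ⟨_, _, rfl, .refl _, .refl _⟩
  | prod h₁ h₂ => exact ⟨_, _, rfl, h₁, h₂⟩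

theorem Pared.osum_inv {S : GCtx} {t e x : Exp} (h : Pared S (.osum t e) x) :
    ∃ t' e', x = .osum t' e' ∧ Pared S t t' ∧ Pared S e e' := by
  cases h with
  | refl => exact ⟨_, _, rfl, .refl _, .refl _⟩
  | osum h₁ h₂ => exact ⟨_, _, rfl, h₁, h₂⟩

theorem Pared.pair_inv {S : GCtx} {t e x : Exp} (h : Pared S (.pair t e) x) :
    ∃ t' e', x = .pair t' e' ∧ Pared S t t' ∧ Pared S e e' := by
  cases h with
  | refl => exact ⟨_, _, rfl, .refl _, .refl _⟩
  | pair h₁ h₂ => exact ⟨_, _, rfl, h₁, h₂⟩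

theorem Pared.psiPair_inv {S : GCtx} {t e x : Exp} (h : Pared S (.psiPair t e) x) :
    ∃ t' e', x = .psiPair t' e' ∧ Pared S t t' ∧ Pared S e e' := by
  cases h with
  | refl => exact ⟨_, _, rfl, .refl _, .refl _⟩
  | psiPair h₁ h₂ => exact ⟨_, _, rfl, h₁, h₂⟩

theorem Pared.ctor_inv {S : GCtx} {C : CName} {e x : Exp} (h : Pared S (.ctor C e) x) :
    ∃ e', x = .ctor C e' ∧ Pared S e e' := by
  cases h with
  | refl => exact ⟨_, rfl, .refl _⟩
  | ctor h => exact ⟨_, rfl, h⟩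

theorem Pared.oapp_inv {S : GCtx} {T : Name} {e x : Exp} (h : Pared S (.oapp T e) x) :
    (∃ e', x = .oapp T e' ∧ Pared S e e') ∨
    (∃ t t' e', x = t'.inst e' ∧ S T = some (.obliv t t') ∧ Pared S e e') := by
  cases h with
  | refl => exact .inl ⟨_, rfl, .refl _⟩
  | oapp h => exact .inl ⟨_, rfl, h⟩
  | oadt h₁ h₂ => exact .inr ⟨_, _, _, rfl, h₁, h₂⟩

theorem Pared.app_inv {S : GCtx} {e₁ e₂ x : Exp} (h : Pared S (.app e₁ e₂) x) :
    (∃ e₁' e₂', x = .app e₁' e₂' ∧ Pared S e₁ e₁' ∧ Pared S e₂ e₂') ∨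
    (∃ t a a' e₂', e₁ = .lam t a ∧ x = a'.inst e₂' ∧ Pared S a a' ∧ Pared S e₂ e₂') := by
  cases h with
  | refl => exact .inl ⟨_, _, rfl, .refl _, .refl _⟩
  | app h₁ h₂ => exact .inl ⟨_, _, rfl, h₁, h₂⟩
  | beta h₁ h₂ => exact .inr ⟨_, _, _, _, rfl, rfl, h₁, h₂⟩

theorem Pared.letE_inv {S : GCtx} {e₁ e₂ x : Exp} (h : Pared S (.letE e₁ e₂) x) :
    ∃ e₁' e₂', (x = .letE e₁' e₂' ∨ x = e₂'.inst e₁') ∧ Pared S e₁ e₁' ∧ Pared S e₂ e₂' := by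
  cases h with
  | refl => exact ⟨_, _, .inl rfl, .refl _, .refl _⟩
  | letE h₁ h₂ => exact ⟨_, _, .inl rfl, h₁, h₂⟩
  | letBeta h₁ h₂ => exact ⟨_, _, .inr rfl, h₁, h₂⟩

theorem Pared.ite_inv {S : GCtx} {e₀ e₁ e₂ x : Exp} (h : Pared S (.ite e₀ e₁ e₂) x) :
    ∃ e₀' e₁' e₂', (x = .ite e₀' e₁' e₂' ∨ ∃ b, e₀ = .lit b ∧ x = cond b e₁' e₂') ∧
      Pared S e₀ e₀' ∧ Pared S e₁ e₁' ∧ Pared S e₂ e₂' := by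
  cases h with
  | refl => exact ⟨_, _, _, .inl rfl, .refl _, .refl _, .refl _⟩
  | ite h₀ h₁ h₂ => exact ⟨_, _, _, .inl rfl, h₀, h₁, h₂⟩
  | iteLit h₁ h₂ => exact ⟨_, _, _, .inr ⟨_, rfl, rfl⟩, .refl _, h₁, h₂⟩

theorem Pared.mux_inv {S : GCtx} {e₀ e₁ e₂ x : Exp} (h : Pared S (.mux e₀ e₁ e₂) x) :
    ∃ e₀' e₁' e₂', (x = .mux e₀' e₁' e₂' ∨ ∃ b, e₀ = .boxLit b ∧ x = cond b e₁' e₂') ∧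
      Pared S e₀ e₀' ∧ Pared S e₁ e₁' ∧ Pared S e₂ e₂' := by
  cases h with
  | refl => exact ⟨_, _, _, .inl rfl, .refl _, .refl _, .refl _⟩
  | mux h₀ h₁ h₂ => exact ⟨_, _, _, .inl rfl, h₀, h₁, h₂⟩
  | muxBox h₁ h₂ => exact ⟨_, _, _, .inr ⟨_, rfl, rfl⟩, .refl _, h₁, h₂⟩

theorem Pared.proj_inv {S : GCtx} {b : Bool} {e x : Exp} (h : Pared S (.proj b e) x) :
    (∃ e', x = .proj b e' ∧ Pared S e e') ∨
    ∃ e₁ e₂ e₁' e₂', (e = .pair e₁ e₂ ∨ e = .psiPair e₁ e₂) ∧ x = cond b e₁' e₂' ∧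
      Pared S e₁ e₁' ∧ Pared S e₂ e₂' := by
  cases h with
  | refl => exact .inl ⟨_, rfl, .refl _⟩
  | proj h => exact .inl ⟨_, rfl, h⟩
  | projPair h₁ h₂ => exact .inr ⟨_, _, _, _, .inl rfl, rfl, h₁, h₂⟩
  | projPsiPair h₁ h₂ => exact .inr ⟨_, _, _, _, .inr rfl, rfl, h₁, h₂⟩

theorem Pared.oinj_inv {S : GCtx} {b : Bool} {t e x : Exp} (h : Pared S (.oinj b t e) x) :
    (∃ t' e', x = .oinj b t' e' ∧ Pared S t t' ∧ Pared S e e') ∨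
    ∃ w u, t = OTy.toExp w ∧ e = OVal.toExp u ∧ x = .boxInj b w u := by
  -- The index of `oinjBox` contains `w.toExp` and `u.toExp`, which are not constructor patterns.
  -- Dependent elimination needs a variable in their place.
  generalize hy : Exp.oinj b t e = y at h
  cases h with
  | refl => exact .inl ⟨_, _, hy.symm, .refl _, .refl _⟩
  | oinj h₁ h₂ => cases hy; exact .inl ⟨_, _, rfl, h₁, h₂⟩
  | oinjBox => cases hy; exact .inr ⟨_, _, rfl, rfl, rfl⟩
  | _ => cases hy

theorem Pared.omatch_inv {S : GCtx} {e₀ e₁ e₂ x : Exp} (h : Pared S (.omatch e₀ e₁ e₂) x) :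
    ∃ e₀' e₁' e₂', (x = .omatch e₀' e₁' e₂' ∨ ∃ b w₁ w₂ u u₁ u₂,
        e₀ = .boxInj b (.osum w₁ w₂) u ∧ OValTy u₁ w₁ ∧ OValTy u₂ w₂ ∧
        x = .mux (.boxLit b) (cond b (e₁'.inst u.toExp) (e₁'.inst u₁.toExp))
          (cond b (e₂'.inst u₂.toExp) (e₂'.inst u.toExp))) ∧
      Pared S e₀ e₀' ∧ Pared S e₁ e₁' ∧ Pared S e₂ e₂' := by
  cases h with
  | refl => exact ⟨_, _, _, .inl rfl, .refl _, .refl _, .refl _⟩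
  | omatch h₀ h₁ h₂ => exact ⟨_, _, _, .inl rfl, h₀, h₁, h₂⟩
  | omatchBox hu₁ hu₂ h₁ h₂ =>
    exact ⟨_, _, _, .inr ⟨_, _, _, _, _, _, rfl, hu₁, hu₂, rfl⟩, .refl _, h₁, h₂⟩

theorem Pared.cases_inv {S : GCtx} {n : ℕ} {C : Fin n ↪ CName} {e₀ x : Exp} {es : Fin n → Exp}
    (h : Pared S (.cases n C e₀ es) x) :
    ∃ es' : Fin n → Exp, ((∃ e₀', x = .cases n C e₀' es' ∧ Pared S e₀ e₀') ∨
        ∃ i e e', e₀ = .ctor (C i) e ∧ Pared S e e' ∧ x = (es' i).inst e') ∧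
      ∀ j, Pared S (es j) (es' j) := by
  cases h with
  | refl => exact ⟨_, .inl ⟨_, rfl, .refl _⟩, fun _ => .refl _⟩
  | cases h₀ h => exact ⟨_, .inl ⟨_, rfl, h₀⟩, h⟩
  | casesCtor h₀ h => exact ⟨_, .inr ⟨_, _, _, rfl, h₀, rfl⟩, h⟩

theorem Pared.sec_inv {S : GCtx} {e x : Exp} (h : Pared S (.sec e) x) :
    (∃ e', x = .sec e' ∧ Pared S e e') ∨ ∃ b, e = .lit b ∧ x = .boxLit b := by
  cases h with
  | refl => exact .inl ⟨_, rfl, .refl _⟩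
  | sec h => exact .inl ⟨_, rfl, h⟩
  | secLit => exact .inr ⟨_, rfl, rfl⟩

/-! ### The diamond property

Two different inhabitants may be chosen when an oblivious match is contracted; the results are
then joined by contracting the resulting `mux` on a boxed literal. -/

/-- Two expressions have a common reduct. -/
def Joins (S : GCtx) (a b : Exp) : Prop := ∃ c, Pared S a c ∧ Pared S b c

theorem Joins.symm {S : GCtx} {a b : Exp} (h : Joins S a b) : Joins S b a := by
  obtain ⟨c, h₁, h₂⟩ := h
  exact ⟨c, h₂, h₁⟩

theorem Joins.lam_inv {S : GCtx} {t t' e e' : Exp} (h : Joins S (.lam t e) (.lam t' e')) :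
    Joins S t t' ∧ Joins S e e' := by
  obtain ⟨c, h₁, h₂⟩ := h
  obtain ⟨_, _, rfl, h₁, h₁'⟩ := h₁.lam_inv
  obtain ⟨_, _, e, h₂, h₂'⟩ := h₂.lam_inv
  cases e
  exact ⟨⟨_, h₁, h₂⟩, ⟨_, h₁', h₂'⟩⟩

theorem Joins.pair_inv {S : GCtx} {t t' e e' : Exp} (h : Joins S (.pair t e) (.pair t' e')) :
    Joins S t t' ∧ Joins S e e' := by
  obtain ⟨c, h₁, h₂⟩ := h
  obtain ⟨_, _, rfl, h₁, h₁'⟩ := h₁.pair_inv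
  obtain ⟨_, _, e, h₂, h₂'⟩ := h₂.pair_inv
  cases e
  exact ⟨⟨_, h₁, h₂⟩, ⟨_, h₁', h₂'⟩⟩

theorem Joins.psiPair_inv {S : GCtx} {t t' e e' : Exp}
    (h : Joins S (.psiPair t e) (.psiPair t' e')) : Joins S t t' ∧ Joins S e e' := by
  obtain ⟨c, h₁, h₂⟩ := h
  obtain ⟨_, _, rfl, h₁, h₁'⟩ := h₁.psiPair_inv
  obtain ⟨_, _, e, h₂, h₂'⟩ := h₂.psiPair_inv
  cases e
  exact ⟨⟨_, h₁, h₂⟩, ⟨_, h₁', h₂'⟩⟩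

theorem Joins.ctor_inv {S : GCtx} {C : CName} {e e' : Exp}
    (h : Joins S (.ctor C e) (.ctor C e')) : Joins S e e' := by
  obtain ⟨c, h₁, h₂⟩ := h
  obtain ⟨_, rfl, k₁⟩ := h₁.ctor_inv
  obtain ⟨_, e', k₂⟩ := h₂.ctor_inv
  cases e'
  exact ⟨_, k₁, k₂⟩

theorem Joins.inst {S : GCtx} (hS : S.Closed) {a b c d : Exp} (h : Joins S a b)
    (h' : Joins S c d) : Joins S (a.inst c) (b.inst d) := by
  obtain ⟨_, h₁, h₂⟩ := h
  obtain ⟨_, h₁', h₂'⟩ := h'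
  exact ⟨_, h₁.inst hS h₁', h₂.inst hS h₂'⟩

theorem Joins.select {S : GCtx} {a b c d : Exp} (x : Bool) (h : Joins S a b)
    (h' : Joins S c d) : Joins S (cond x a c) (cond x b d) := by
  cases x <;> assumption

/-- Every two parallel reducts of `e` join. -/
def Diamond (S : GCtx) (e : Exp) : Prop :=
  ∀ ⦃a b : Exp⦄, Pared S e a → Pared S e b → Joins S a b

/-- Structural induction supplies the diamond for the function, whereas a beta step reduces its
body. The diamond passes to the body because reducts of an abstraction are abstractions. The
analogues for `ctor`, `pair` and `psiPair` serve the other eliminators. -/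
theorem Diamond.lam_inv {S : GCtx} {t e : Exp} (h : Diamond S (.lam t e)) : Diamond S e :=
  fun _ _ h₁ h₂ => (Joins.lam_inv (h (.lam (.refl _) h₁) (.lam (.refl _) h₂))).2

theorem Diamond.ctor_inv {S : GCtx} {C : CName} {e : Exp} (h : Diamond S (.ctor C e)) :
    Diamond S e :=
  fun _ _ h₁ h₂ => Joins.ctor_inv (h (.ctor h₁) (.ctor h₂))

theorem Diamond.pair_inv {S : GCtx} {e₁ e₂ : Exp} (h : Diamond S (.pair e₁ e₂)) :
    Diamond S e₁ ∧ Diamond S e₂ :=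
  ⟨fun _ _ h₁ h₂ => (Joins.pair_inv (h (.pair h₁ (.refl _)) (.pair h₂ (.refl _)))).1,
    fun _ _ h₁ h₂ => (Joins.pair_inv (h (.pair (.refl _) h₁) (.pair (.refl _) h₂))).2⟩

theorem Diamond.psiPair_inv {S : GCtx} {e₁ e₂ : Exp} (h : Diamond S (.psiPair e₁ e₂)) :
    Diamond S e₁ ∧ Diamond S e₂ :=
  ⟨fun _ _ h₁ h₂ =>
      (Joins.psiPair_inv (h (.psiPair h₁ (.refl _)) (.psiPair h₂ (.refl _)))).1,
    fun _ _ h₁ h₂ =>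
      (Joins.psiPair_inv (h (.psiPair (.refl _) h₁) (.psiPair (.refl _) h₂))).2⟩

theorem Diamond.gfun {S : GCtx} {x : Name} : Diamond S (.gfun x) := by
  intro a b ha hb
  cases ha with
  | refl => exact ⟨_, hb, .refl _⟩
  | fn h =>
    cases hb with
    | refl => exact ⟨_, .refl _, .fn h⟩
    | fn h' =>
      cases h.symm.trans h'
      exact ⟨_, .refl _, .refl _⟩

theorem Diamond.oapp {S : GCtx} (hS : S.Closed) {T : Name} {e : Exp} (ih : Diamond S e) :
    Diamond S (.oapp T e) := by
  intro a b ha hb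
  obtain ⟨_, rfl, h⟩ | ⟨_, _, _, rfl, hT, h⟩ := ha.oapp_inv <;>
  obtain ⟨_, rfl, h'⟩ | ⟨_, _, _, rfl, hT', h'⟩ := hb.oapp_inv <;>
  obtain ⟨_, hj, hj'⟩ := ih h h'
  · exact ⟨_, .oapp hj, .oapp hj'⟩
  · exact ⟨_, .oadt hT' hj, .inst hS (.refl _) hj'⟩
  · exact ⟨_, .inst hS (.refl _) hj, .oadt hT hj'⟩
  · cases hT.symm.trans hT'
    exact ⟨_, .inst hS (.refl _) hj, .inst hS (.refl _) hj'⟩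

theorem Diamond.app {S : GCtx} (hS : S.Closed) {e₁ e₂ : Exp} (ih₁ : Diamond S e₁)
    (ih₂ : Diamond S e₂) : Diamond S (.app e₁ e₂) := by
  -- The critical pair of congruence against beta: the congruence side still carries an abstraction,
  -- so it can catch up by contracting.
  have mixed : ∀ {t x x' y z z' : Exp}, Diamond S (.lam t x) → Pared S (.lam t x) y →
      Pared S x x' → Joins S z z' → Joins S (.app y z) (x'.inst z') := by
    intro t x x' y z z' ih h h' ⟨_, hj, hj'⟩
    obtain ⟨_, _, rfl, _, h⟩ := h.lam_inv
    obtain ⟨_, hi, hi'⟩ := ih.lam_inv h h'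
    exact ⟨_, .beta hi hj, .inst hS hi' hj'⟩
  intro a b ha hb
  obtain ⟨_, _, rfl, h₁, h₂⟩ | ⟨_, _, _, _, rfl, rfl, h₁, h₂⟩ := ha.app_inv <;>
  obtain ⟨_, _, rfl, h₁', h₂'⟩ | ⟨_, _, _, _, e, rfl, h₁', h₂'⟩ := hb.app_inv <;>
  have hj := ih₂ h₂ h₂'
  · obtain ⟨_, hi, hi'⟩ := ih₁ h₁ h₁'
    obtain ⟨_, hj, hj'⟩ := hj
    exact ⟨_, .app hi hj, .app hi' hj'⟩
  · subst e
    exact mixed ih₁ h₁ h₁' hj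
  · exact (mixed ih₁ h₁' h₁ hj.symm).symm
  · cases e
    exact .inst hS (ih₁.lam_inv h₁ h₁') hj

theorem Diamond.letE {S : GCtx} (hS : S.Closed) {e₁ e₂ : Exp} (ih₁ : Diamond S e₁)
    (ih₂ : Diamond S e₂) : Diamond S (.letE e₁ e₂) := by
  intro a b ha hb
  obtain ⟨_, _, ha, h₁, h₂⟩ := ha.letE_inv
  obtain ⟨_, _, hb, h₁', h₂'⟩ := hb.letE_inv
  obtain ⟨x, hi, hi'⟩ := ih₁ h₁ h₁'
  obtain ⟨y, hj, hj'⟩ := ih₂ h₂ h₂'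
  -- One common reduct serves all four combinations: a side that has not contracted yet does so now.
  refine ⟨y.inst x, ?_, ?_⟩
  · obtain rfl | rfl := ha
    · exact .letBeta hi hj
    · exact .inst hS hj hi
  · obtain rfl | rfl := hb
    · exact .letBeta hi' hj'
    · exact .inst hS hj' hi'

theorem Diamond.ite {S : GCtx} {e₀ e₁ e₂ : Exp} (ih₀ : Diamond S e₀) (ih₁ : Diamond S e₁)
    (ih₂ : Diamond S e₂) : Diamond S (.ite e₀ e₁ e₂) := by
  intro a b ha hb
  obtain ⟨_, _, _, ha, h₀, h₁, h₂⟩ := ha.ite_inv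
  obtain ⟨_, _, _, hb, h₀', h₁', h₂'⟩ := hb.ite_inv
  obtain ⟨_, hi, hi'⟩ := ih₀ h₀ h₀'
  obtain ⟨_, hj, hj'⟩ := ih₁ h₁ h₁'
  obtain ⟨_, hk, hk'⟩ := ih₂ h₂ h₂'
  obtain rfl | ⟨x, rfl, rfl⟩ := ha <;> obtain rfl | ⟨y, e, rfl⟩ := hb
  · exact ⟨_, .ite hi hj hk, .ite hi' hj' hk'⟩
  · subst e
    cases h₀
    exact ⟨_, .iteLit hj hk, .select _ hj' hk'⟩
  · cases h₀'
    exact ⟨_, .select _ hj hk, .iteLit hj' hk'⟩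
  · cases e
    exact ⟨_, .select _ hj hk, .select _ hj' hk'⟩

theorem Diamond.mux {S : GCtx} {e₀ e₁ e₂ : Exp} (ih₀ : Diamond S e₀) (ih₁ : Diamond S e₁)
    (ih₂ : Diamond S e₂) : Diamond S (.mux e₀ e₁ e₂) := by
  intro a b ha hb
  obtain ⟨_, _, _, ha, h₀, h₁, h₂⟩ := ha.mux_inv
  obtain ⟨_, _, _, hb, h₀', h₁', h₂'⟩ := hb.mux_inv
  obtain ⟨_, hi, hi'⟩ := ih₀ h₀ h₀'
  obtain ⟨_, hj, hj'⟩ := ih₁ h₁ h₁'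
  obtain ⟨_, hk, hk'⟩ := ih₂ h₂ h₂'
  obtain rfl | ⟨x, rfl, rfl⟩ := ha <;> obtain rfl | ⟨y, e, rfl⟩ := hb
  · exact ⟨_, .mux hi hj hk, .mux hi' hj' hk'⟩
  · subst e
    cases h₀
    exact ⟨_, .muxBox hj hk, .select _ hj' hk'⟩
  · cases h₀'
    exact ⟨_, .select _ hj hk, .muxBox hj' hk'⟩
  · cases e
    exact ⟨_, .select _ hj hk, .select _ hj' hk'⟩

theorem Diamond.proj {S : GCtx} {b : Bool} {e : Exp} (ih : Diamond S e) :
    Diamond S (.proj b e) := by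
  have mixed : ∀ {x y x' y' z p : Exp}, (p = .pair x y ∨ p = .psiPair x y) → Diamond S p →
      Pared S p z → Pared S x x' → Pared S y y' → Joins S (.proj b z) (cond b x' y') := by
    rintro x y x' y' z p (rfl | rfl) ih h h₁ h₂
    · obtain ⟨_, _, rfl, h₁', h₂'⟩ := h.pair_inv
      obtain ⟨_, hi, hi'⟩ := ih.pair_inv.1 h₁' h₁
      obtain ⟨_, hj, hj'⟩ := ih.pair_inv.2 h₂' h₂
      exact ⟨_, .projPair hi hj, .select _ hi' hj'⟩
    · obtain ⟨_, _, rfl, h₁', h₂'⟩ := h.psiPair_inv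
      obtain ⟨_, hi, hi'⟩ := ih.psiPair_inv.1 h₁' h₁
      obtain ⟨_, hj, hj'⟩ := ih.psiPair_inv.2 h₂' h₂
      exact ⟨_, .projPsiPair hi hj, .select _ hi' hj'⟩
  intro a c ha hc
  obtain ⟨_, rfl, h⟩ | ⟨_, _, _, _, e, rfl, h₁, h₂⟩ := ha.proj_inv <;>
  obtain ⟨_, rfl, h'⟩ | ⟨_, _, _, _, e', rfl, h₁', h₂'⟩ := hc.proj_inv
  · obtain ⟨_, hi, hi'⟩ := ih h h'
    exact ⟨_, .proj hi, .proj hi'⟩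
  · exact mixed e' ih h h₁' h₂'
  · exact (mixed e ih h' h₁ h₂).symm
  · obtain rfl | rfl := e <;> obtain e' | e' := e' <;> cases e'
    · exact .select _ (ih.pair_inv.1 h₁ h₁') (ih.pair_inv.2 h₂ h₂')
    · exact .select _ (ih.psiPair_inv.1 h₁ h₁') (ih.psiPair_inv.2 h₂ h₂')

theorem Diamond.oinj {S : GCtx} {b : Bool} {t e : Exp} (ih₁ : Diamond S t)
    (ih₂ : Diamond S e) : Diamond S (.oinj b t e) := by
  intro a c ha hc
  obtain ⟨_, _, rfl, h₁, h₂⟩ | ⟨_, _, rfl, rfl, rfl⟩ := ha.oinj_inv <;>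
  obtain ⟨_, _, rfl, h₁', h₂'⟩ | ⟨_, _, e, e', rfl⟩ := hc.oinj_inv
  · obtain ⟨_, hi, hi'⟩ := ih₁ h₁ h₁'
    obtain ⟨_, hj, hj'⟩ := ih₂ h₂ h₂'
    exact ⟨_, .oinj hi hj, .oinj hi' hj'⟩
  · subst e e'
    rw [h₁.toExp_oty, h₂.toExp_oval]
    exact ⟨_, .oinjBox, .refl _⟩
  · rw [h₁'.toExp_oty, h₂'.toExp_oval]
    exact ⟨_, .refl _, .oinjBox⟩
  · rw [OTy.toExp_injective e, OVal.toExp_injective e']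
    exact ⟨_, .refl _, .refl _⟩

theorem Diamond.omatch {S : GCtx} (hS : S.Closed) {e₀ e₁ e₂ : Exp} (ih₀ : Diamond S e₀)
    (ih₁ : Diamond S e₁) (ih₂ : Diamond S e₂) : Diamond S (.omatch e₀ e₁ e₂) := by
  intro a c ha hc
  obtain ⟨_, _, _, ha, h₀, h₁, h₂⟩ := ha.omatch_inv
  obtain ⟨_, _, _, hc, h₀', h₁', h₂'⟩ := hc.omatch_inv
  obtain ⟨_, hi, hi'⟩ := ih₀ h₀ h₀'
  obtain ⟨y, hj, hj'⟩ := ih₁ h₁ h₁'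
  obtain ⟨z, hk, hk'⟩ := ih₂ h₂ h₂'
  obtain rfl | ⟨b, _, _, u, _, _, rfl, hu₁, hu₂, rfl⟩ := ha <;>
  obtain rfl | ⟨_, _, _, _, _, _, e, hu₁', hu₂', rfl⟩ := hc
  · exact ⟨_, .omatch hi hj hk, .omatch hi' hj' hk'⟩
  · subst e
    cases h₀
    -- The side that lags behind contracts with the inhabitants that the other side has guessed.
    exact ⟨_, .omatchBox hu₁' hu₂' hj hk, .mux (.refl _)
      (.select _ (.inst hS hj' (.refl _)) (.inst hS hj' (.refl _)))
      (.select _ (.inst hS hk' (.refl _)) (.inst hS hk' (.refl _)))⟩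
  · cases h₀'
    exact ⟨_, .mux (.refl _)
      (.select _ (.inst hS hj (.refl _)) (.inst hS hj (.refl _)))
      (.select _ (.inst hS hk (.refl _)) (.inst hS hk (.refl _))), .omatchBox hu₁ hu₂ hj' hk'⟩
  · cases e
    -- Both sides have contracted, perhaps with different guesses. The `mux` selects the arm that
    -- contains the genuine payload `u`, and the guesses disappear.
    cases b
    · exact ⟨z.inst u.toExp, .muxBox (b := false) (.refl _) (.inst hS hk (.refl _)),
        .muxBox (b := false) (.refl _) (.inst hS hk' (.refl _))⟩
    · exact ⟨y.inst u.toExp, .muxBox (b := true) (.inst hS hj (.refl _)) (.refl _),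
        .muxBox (b := true) (.inst hS hj' (.refl _)) (.refl _)⟩

theorem Diamond.cases {S : GCtx} (hS : S.Closed) {n : ℕ} {C : Fin n ↪ CName} {e₀ : Exp}
    {es : Fin n → Exp} (ih₀ : Diamond S e₀) (ih : ∀ i, Diamond S (es i)) :
    Diamond S (.cases n C e₀ es) := by
  intro a c ha hc
  obtain ⟨_, ha, h⟩ := ha.cases_inv
  obtain ⟨_, hc, h'⟩ := hc.cases_inv
  choose es' hj hj' using fun i => ih i (h i) (h' i)
  obtain ⟨_, rfl, h₀⟩ | ⟨i, _, _, rfl, h₀, rfl⟩ := ha <;>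
  obtain ⟨_, rfl, h₀'⟩ | ⟨i', _, _, e, h₀', rfl⟩ := hc
  · obtain ⟨_, hi, hi'⟩ := ih₀ h₀ h₀'
    exact ⟨_, .cases hi hj, .cases hi' hj'⟩
  · subst e
    obtain ⟨_, rfl, k₀⟩ := h₀.ctor_inv
    obtain ⟨_, hi, hi'⟩ := ih₀.ctor_inv k₀ h₀'
    exact ⟨_, .casesCtor hi hj, .inst hS (hj' _) hi'⟩
  · obtain ⟨_, rfl, k₀⟩ := h₀'.ctor_inv
    obtain ⟨_, hi, hi'⟩ := ih₀.ctor_inv h₀ k₀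
    exact ⟨_, .inst hS (hj _) hi, .casesCtor hi' hj'⟩
  · injection e with hC e
    obtain rfl := C.injective hC
    subst e
    obtain ⟨_, hi, hi'⟩ := ih₀.ctor_inv h₀ h₀'
    exact ⟨_, .inst hS (hj _) hi, .inst hS (hj' _) hi'⟩

theorem Diamond.sec {S : GCtx} {e : Exp} (ih : Diamond S e) : Diamond S (.sec e) := by
  intro a c ha hc
  obtain ⟨_, rfl, h⟩ | ⟨_, rfl, rfl⟩ := ha.sec_inv <;>
  obtain ⟨_, rfl, h'⟩ | ⟨_, e, rfl⟩ := hc.sec_inv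
  · obtain ⟨_, hi, hi'⟩ := ih h h'
    exact ⟨_, .sec hi, .sec hi'⟩
  · subst e
    cases h
    exact ⟨_, .secLit, .refl _⟩
  · cases h'
    exact ⟨_, .refl _, .secLit⟩
  · cases e
    exact ⟨_, .refl _, .refl _⟩

/-- Structural induction suffices: every contractum is assembled from reducts of subexpressions of
the redex, and substitution of joinable expressions keeps them joinable. -/
theorem Pared.diamond {S : GCtx} (hS : S.Closed) (e : Exp) : Diamond S e := by
  induction e with
  | unitT | boolT | oboolT | psi | adt | var | unit | lit | boxLit | boxInj =>
    intro a b ha hb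
    cases ha
    exact ⟨_, hb, .refl _⟩
  | gfun x => exact .gfun
  | prod _ _ ih₁ ih₂ =>
    intro a b ha hb
    obtain ⟨_, _, rfl, h₁, h₂⟩ := ha.prod_inv
    obtain ⟨_, _, rfl, h₁', h₂'⟩ := hb.prod_inv
    obtain ⟨_, hi, hi'⟩ := ih₁ h₁ h₁'
    obtain ⟨_, hj, hj'⟩ := ih₂ h₂ h₂'
    exact ⟨_, .prod hi hj, .prod hi' hj'⟩
  | osum _ _ ih₁ ih₂ =>
    intro a b ha hb
    obtain ⟨_, _, rfl, h₁, h₂⟩ := ha.osum_inv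
    obtain ⟨_, _, rfl, h₁', h₂'⟩ := hb.osum_inv
    obtain ⟨_, hi, hi'⟩ := ih₁ h₁ h₁'
    obtain ⟨_, hj, hj'⟩ := ih₂ h₂ h₂'
    exact ⟨_, .osum hi hj, .osum hi' hj'⟩
  | pi _ _ ih₁ ih₂ =>
    intro a b ha hb
    obtain ⟨_, _, rfl, h₁, h₂⟩ := ha.pi_inv
    obtain ⟨_, _, rfl, h₁', h₂'⟩ := hb.pi_inv
    obtain ⟨_, hi, hi'⟩ := ih₁ h₁ h₁'
    obtain ⟨_, hj, hj'⟩ := ih₂ h₂ h₂'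
    exact ⟨_, .pi hi hj, .pi hi' hj'⟩
  | lam _ _ ih₁ ih₂ =>
    intro a b ha hb
    obtain ⟨_, _, rfl, h₁, h₂⟩ := ha.lam_inv
    obtain ⟨_, _, rfl, h₁', h₂'⟩ := hb.lam_inv
    obtain ⟨_, hi, hi'⟩ := ih₁ h₁ h₁'
    obtain ⟨_, hj, hj'⟩ := ih₂ h₂ h₂'
    exact ⟨_, .lam hi hj, .lam hi' hj'⟩
  | pair _ _ ih₁ ih₂ =>
    intro a b ha hb
    obtain ⟨_, _, rfl, h₁, h₂⟩ := ha.pair_inv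
    obtain ⟨_, _, rfl, h₁', h₂'⟩ := hb.pair_inv
    obtain ⟨_, hi, hi'⟩ := ih₁ h₁ h₁'
    obtain ⟨_, hj, hj'⟩ := ih₂ h₂ h₂'
    exact ⟨_, .pair hi hj, .pair hi' hj'⟩
  | psiPair _ _ ih₁ ih₂ =>
    intro a b ha hb
    obtain ⟨_, _, rfl, h₁, h₂⟩ := ha.psiPair_inv
    obtain ⟨_, _, rfl, h₁', h₂'⟩ := hb.psiPair_inv
    obtain ⟨_, hi, hi'⟩ := ih₁ h₁ h₁'
    obtain ⟨_, hj, hj'⟩ := ih₂ h₂ h₂'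
    exact ⟨_, .psiPair hi hj, .psiPair hi' hj'⟩
  | ctor C _ ih =>
    intro a b ha hb
    obtain ⟨_, rfl, h⟩ := ha.ctor_inv
    obtain ⟨_, rfl, h'⟩ := hb.ctor_inv
    obtain ⟨_, hi, hi'⟩ := ih h h'
    exact ⟨_, .ctor hi, .ctor hi'⟩
  | letE _ _ ih₁ ih₂ => exact .letE hS ih₁ ih₂
  | app _ _ ih₁ ih₂ => exact .app hS ih₁ ih₂
  | oapp _ _ ih => exact .oapp hS ih
  | ite _ _ _ ih₀ ih₁ ih₂ => exact .ite ih₀ ih₁ ih₂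
  | mux _ _ _ ih₀ ih₁ ih₂ => exact .mux ih₀ ih₁ ih₂
  | proj _ _ ih => exact .proj ih
  | oinj _ _ _ ih₁ ih₂ => exact .oinj ih₁ ih₂
  | omatch _ _ _ ih₀ ih₁ ih₂ => exact .omatch hS ih₀ ih₁ ih₂
  | cases _ _ _ _ ih₀ ih => exact .cases hS ih₀ ih
  | sec _ ih => exact .sec ih

/-! ### Church-Rosser -/

/-- Iterated parallel reduction. -/
abbrev Pareds (S : GCtx) : Exp → Exp → Prop := Relation.ReflTransGen (Pared S)

theorem TyEquiv.refl {S : GCtx} (a : Exp) : TyEquiv S a a :=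
  Relation.EqvGen.refl a

theorem TyEquiv.symm {S : GCtx} {a b : Exp} (h : TyEquiv S a b) : TyEquiv S b a :=
  Relation.EqvGen.symm _ _ h

theorem TyEquiv.trans {S : GCtx} {a b c : Exp} (h : TyEquiv S a b) (h' : TyEquiv S b c) :
    TyEquiv S a c :=
  Relation.EqvGen.trans _ _ _ h h'

theorem Pared.tyEquiv {S : GCtx} {a b : Exp} (h : Pared S a b) : TyEquiv S a b :=
  Relation.EqvGen.rel _ _ h

theorem Pareds.tyEquiv {S : GCtx} {a b : Exp} (h : Pareds S a b) : TyEquiv S a b := by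
  induction h with
  | refl => exact .refl _
  | tail _ h ih => exact ih.trans h.tyEquiv

theorem TyEquiv.map {S : GCtx} {f : Exp → Exp} (hf : ∀ {x y}, Pared S x y → Pared S (f x) (f y))
    {a b : Exp} (h : TyEquiv S a b) : TyEquiv S (f a) (f b) := by
  induction h with
  | rel _ _ h => exact (hf h).tyEquiv
  | refl => exact .refl _
  | symm _ _ _ ih => exact ih.symm
  | trans _ _ _ _ _ ih₁ ih₂ => exact ih₁.trans ih₂

theorem TyEquiv.subst {S : GCtx} (hS : S.Closed) {a b : Exp} (h : TyEquiv S a b)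
    (s : ℕ → Exp) : TyEquiv S (a.subst s) (b.subst s) :=
  h.map fun h => h.subst_left hS s

theorem TyEquiv.rename {S : GCtx} (hS : S.Closed) {a b : Exp} (h : TyEquiv S a b)
    (r : ℕ → ℕ) : TyEquiv S (a.rename r) (b.rename r) :=
  h.map fun h => h.rename hS r

theorem TyEquiv.inst {S : GCtx} (hS : S.Closed) {a b c d : Exp} (h : TyEquiv S a b)
    (h' : TyEquiv S c d) : TyEquiv S (a.inst c) (b.inst d) :=
  (TyEquiv.map (f := fun x => x.inst c) (fun h => h.inst hS (.refl _)) h).trans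
    (TyEquiv.map (fun h => .inst hS (.refl _) h) h')

theorem TyEquiv.pi {S : GCtx} {a b c d : Exp} (h : TyEquiv S a b)
    (h' : TyEquiv S c d) : TyEquiv S (.pi a c) (.pi b d) :=
  (TyEquiv.map (f := fun x => .pi x c) (fun h => .pi h (.refl _)) h).trans
    (TyEquiv.map (fun h => .pi (.refl _) h) h')

/-- An equivalence is a zigzag of reductions. Confluence, obtained from the diamond by
`Relation.church_rosser`, fills each peak that transitivity creates. -/
theorem TyEquiv.join {S : GCtx} (hS : S.Closed) {a b : Exp} (h : TyEquiv S a b) :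
    ∃ c, Pareds S a c ∧ Pareds S b c := by
  have cr : ∀ {x y z}, Pareds S x y → Pareds S x z → ∃ c, Pareds S y c ∧ Pareds S z c := by
    refine Relation.church_rosser fun a b c hb hc => ?_
    obtain ⟨d, h₁, h₂⟩ := Pared.diamond hS a hb hc
    exact ⟨d, .single h₁, .single h₂⟩
  induction h with
  | rel _ _ h => exact ⟨_, .single h, .refl⟩
  | refl => exact ⟨_, .refl, .refl⟩
  | symm _ _ _ ih =>
    obtain ⟨c, h₁, h₂⟩ := ih
    exact ⟨c, h₂, h₁⟩
  | trans _ _ _ _ _ ih₁ ih₂ =>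
    obtain ⟨c, h₁, h₂⟩ := ih₁
    obtain ⟨d, h₃, h₄⟩ := ih₂
    obtain ⟨e, h₅, h₆⟩ := cr h₂ h₃
    exact ⟨e, h₁.trans h₅, h₄.trans h₆⟩

/-! ### Injectivity of type formers and normal types. -/

theorem Pareds.prod_inv {S : GCtx} {a b x : Exp} (h : Pareds S (.prod a b) x) :
    ∃ a' b', x = .prod a' b' ∧ Pareds S a a' ∧ Pareds S b b' := by
  induction h with
  | refl => exact ⟨_, _, rfl, .refl, .refl⟩
  | tail _ h ih =>
    obtain ⟨_, _, rfl, h₁, h₂⟩ := ih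
    obtain ⟨_, _, rfl, h₁', h₂'⟩ := h.prod_inv
    exact ⟨_, _, rfl, h₁.tail h₁', h₂.tail h₂'⟩

theorem Pareds.osum_inv {S : GCtx} {a b x : Exp} (h : Pareds S (.osum a b) x) :
    ∃ a' b', x = .osum a' b' ∧ Pareds S a a' ∧ Pareds S b b' := by
  induction h with
  | refl => exact ⟨_, _, rfl, .refl, .refl⟩
  | tail _ h ih =>
    obtain ⟨_, _, rfl, h₁, h₂⟩ := ih
    obtain ⟨_, _, rfl, h₁', h₂'⟩ := h.osum_inv
    exact ⟨_, _, rfl, h₁.tail h₁', h₂.tail h₂'⟩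

theorem Pareds.pi_inv {S : GCtx} {a b x : Exp} (h : Pareds S (.pi a b) x) :
    ∃ a' b', x = .pi a' b' ∧ Pareds S a a' ∧ Pareds S b b' := by
  induction h with
  | refl => exact ⟨_, _, rfl, .refl, .refl⟩
  | tail _ h ih =>
    obtain ⟨_, _, rfl, h₁, h₂⟩ := ih
    obtain ⟨_, _, rfl, h₁', h₂'⟩ := h.pi_inv
    exact ⟨_, _, rfl, h₁.tail h₁', h₂.tail h₂'⟩

/-- An expression all of whose parallel reducts are itself. -/
def Normal (S : GCtx) (e : Exp) : Prop := ∀ ⦃x : Exp⦄, Pared S e x → x = e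

theorem Normal.pareds {S : GCtx} {e x : Exp} (hn : Normal S e) (h : Pareds S e x) : x = e := by
  induction h with
  | refl => rfl
  | tail _ h ih => subst ih; exact hn h

theorem normal_toExp {S : GCtx} (w : OTy) : Normal S w.toExp := fun _ h => h.toExp_oty

theorem normal_boolT {S : GCtx} : Normal S .boolT := fun _ h => by cases h; rfl

theorem normal_psi {S : GCtx} (T : Name) : Normal S (.psi T) := fun _ h => by cases h; rfl

theorem normal_adt {S : GCtx} (T : Name) : Normal S (.adt T) := fun _ h => by cases h; rfl

theorem TyEquiv.pareds {S : GCtx} (hS : S.Closed) {a b : Exp} (hb : Normal S b)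
    (h : TyEquiv S a b) : Pareds S a b := by
  obtain ⟨c, h₁, h₂⟩ := h.join hS
  rwa [hb.pareds h₂] at h₁

theorem TyEquiv.eq {S : GCtx} (hS : S.Closed) {a b : Exp} (ha : Normal S a) (hb : Normal S b)
    (h : TyEquiv S a b) : a = b :=
  (ha.pareds (h.pareds hS hb)).symm

theorem TyEquiv.prod_inv {S : GCtx} (hS : S.Closed) {a b c d : Exp}
    (h : TyEquiv S (.prod a b) (.prod c d)) : TyEquiv S a c ∧ TyEquiv S b d := by
  obtain ⟨_, h₁, h₂⟩ := h.join hS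
  obtain ⟨_, _, rfl, h₁, h₁'⟩ := h₁.prod_inv
  obtain ⟨_, _, e, h₂, h₂'⟩ := h₂.prod_inv
  cases e
  exact ⟨h₁.tyEquiv.trans h₂.tyEquiv.symm, h₁'.tyEquiv.trans h₂'.tyEquiv.symm⟩

theorem TyEquiv.osum_inv {S : GCtx} (hS : S.Closed) {a b c d : Exp}
    (h : TyEquiv S (.osum a b) (.osum c d)) : TyEquiv S a c ∧ TyEquiv S b d := by
  obtain ⟨_, h₁, h₂⟩ := h.join hS
  obtain ⟨_, _, rfl, h₁, h₁'⟩ := h₁.osum_inv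
  obtain ⟨_, _, e, h₂, h₂'⟩ := h₂.osum_inv
  cases e
  exact ⟨h₁.tyEquiv.trans h₂.tyEquiv.symm, h₁'.tyEquiv.trans h₂'.tyEquiv.symm⟩

theorem TyEquiv.pi_inv {S : GCtx} (hS : S.Closed) {a b c d : Exp}
    (h : TyEquiv S (.pi a b) (.pi c d)) : TyEquiv S a c ∧ TyEquiv S b d := by
  obtain ⟨_, h₁, h₂⟩ := h.join hS
  obtain ⟨_, _, rfl, h₁, h₁'⟩ := h₁.pi_inv
  obtain ⟨_, _, e, h₂, h₂'⟩ := h₂.pi_inv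
  cases e
  exact ⟨h₁.tyEquiv.trans h₂.tyEquiv.symm, h₁'.tyEquiv.trans h₂'.tyEquiv.symm⟩

/-- `e` reduces in parallel to a product whenever it is equivalent to one. -/
theorem TyEquiv.pareds_prod {S : GCtx} (hS : S.Closed) {e a b : Exp}
    (h : TyEquiv S e (.prod a b)) :
    ∃ a' b', Pareds S e (.prod a' b') ∧ TyEquiv S a a' ∧ TyEquiv S b b' := by
  obtain ⟨_, h₁, h₂⟩ := h.join hS
  obtain ⟨_, _, rfl, h₂, h₂'⟩ := h₂.prod_inv
  exact ⟨_, _, h₁, h₂.tyEquiv, h₂'.tyEquiv⟩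

/-- `e` reduces in parallel to a dependent product whenever it is equivalent to one. -/
theorem TyEquiv.pareds_pi {S : GCtx} (hS : S.Closed) {e a b : Exp}
    (h : TyEquiv S e (.pi a b)) : ∃ a' b', Pareds S e (.pi a' b') := by
  obtain ⟨_, h₁, h₂⟩ := h.join hS
  obtain ⟨_, _, rfl, _, _⟩ := h₂.pi_inv
  exact ⟨_, _, h₁⟩

/-! ## Renaming and substitution in judgments -/

def Cls.rename (r : ℕ → ℕ) : Cls → Cls
  | .ty t => .ty (t.rename r)
  | .kd k => .kd k

def Cls.subst (s : ℕ → Exp) : Cls → Cls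
  | .ty t => .ty (t.subst s)
  | .kd k => .kd k

/-- The free variables of a subject are bound by its context. -/
theorem Judg.subst_congr {S : GCtx} {G : Ctx} {e : Exp} {c : Cls} (h : Judg S G e c)
    {s s' : ℕ → Exp} (hs : ∀ i < G.length, s i = s' i) : e.subst s = e.subst s' := by
  have hup : ∀ {G : Ctx} {s s' : ℕ → Exp} (t : Exp), (∀ i < G.length, s i = s' i) →
      ∀ i < (t :: G).length, up s i = up s' i := by
    intro G s s' t hs i hi
    cases i with
    | zero => rfl
    | succ i => simp [up_succ, hs i (by simpa using hi)]
  induction h generalizing s s' with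
  | kSub _ _ ih => exact ih hs
  | tConv _ _ _ ih _ => exact ih hs
  | kUnit | kBool | kOBool | kADT | kPsi | tUnit | tLit | tFun | tBoxLit | tBoxInj => rfl
  | kOADT _ _ ih | tProj _ ih | tCtor _ _ ih | tPsiProj₁ _ _ ih | tPsiProj₂ _ _ ih
  | tSec _ ih => simp only [Exp.subst, ih hs]
  | kPi _ _ ih₁ ih₂ | kLet _ _ ih₁ ih₂ | tLet _ _ ih₁ ih₂ | tAbs _ _ ih₂ ih₁ =>
    simp only [Exp.subst, ih₁ hs, ih₂ (hup _ hs)]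
  | kProd _ _ ih₁ ih₂ | kOSum _ _ ih₁ ih₂ | tApp _ _ ih₁ ih₂ | tPair _ _ ih₁ ih₂
  | tPsiPair _ _ _ ih₁ ih₂ => simp only [Exp.subst, ih₁ hs, ih₂ hs]
  | tOInj _ _ ih₁ ih₂ =>
    -- The annotation is itself part of the subject; its variables are controlled by the kinding
    -- premise.
    have := ih₂ hs
    simp only [Exp.subst] at this ⊢
    rw [this, ih₁ hs]
  | kIf _ _ _ ih₀ ih₁ ih₂ | tIf _ _ _ _ ih₀ ih₁ ih₂ _ | tMux _ _ _ _ ih₀ _ ih₁ ih₂ =>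
    simp only [Exp.subst, ih₀ hs, ih₁ hs, ih₂ hs]
  | tOMatch _ _ _ _ ih₀ _ ih₁ ih₂ =>
    simp only [Exp.subst, ih₀ hs, ih₁ (hup _ hs), ih₂ (hup _ hs)]
  | kMatch _ _ _ ih₀ ih | tMatch _ _ _ _ ih₀ ih _ =>
    simp only [Exp.subst, ih₀ hs, fun i => ih i (hup _ hs)]
  | tVar h =>
    obtain ⟨hi, _⟩ := List.getElem?_eq_some_iff.1 h
    exact hs _ hi

theorem Judg.subst_nil {S : GCtx} {e : Exp} {c : Cls} (h : Judg S [] e c) (s : ℕ → Exp) :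
    e.subst s = e :=
  (h.subst_congr (by simp)).trans e.subst_var

/-- Definitions are judged in the empty context, so they have no free variables. The body of an
oblivious type may use index `0` alone, which `up s` fixes. -/
theorem GCtx.Ok.closed {S : GCtx} (hS : S.Ok) : S.Closed where
  fn h s := by
    cases hS _ _ h with
    | fn h₁ h₂ => exact ⟨h₁.subst_nil s, h₂.subst_nil s⟩
  data h i s := by
    cases hS _ _ h with
    | data h => exact (h i).subst_nil s
  obliv h s := by
    cases hS _ _ h with
    | obliv h₁ h₂ =>
      refine ⟨h₁.subst_nil s, (h₂.subst_congr fun i hi => ?_).trans (Exp.subst_var _)⟩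
      obtain rfl : i = 0 := by simpa using hi
      rfl

theorem GCtx.Closed.data_rename {S : GCtx} (hS : S.Closed) {T : Name} {n : ℕ}
    {C : Fin n ↪ CName} {ts : Fin n → Exp} (h : S T = some (.data n C ts)) (i : Fin n)
    (r : ℕ → ℕ) : (ts i).rename r = ts i := by
  rw [Exp.rename_eq_subst, hS.data h]

theorem GCtx.Closed.fn_rename {S : GCtx} (hS : S.Closed) {x : Name} {t e : Exp}
    (h : S x = some (.fn t e)) (r : ℕ → ℕ) : t.rename r = t := by
  rw [Exp.rename_eq_subst, (hS.fn h _).1]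

theorem GCtx.Closed.obliv_rename {S : GCtx} (hS : S.Closed) {x : Name} {t t' : Exp}
    (h : S x = some (.obliv t t')) (r : ℕ → ℕ) : t.rename r = t := by
  rw [Exp.rename_eq_subst, (hS.obliv h _).1]

theorem Exp.rename_add_two (t : Exp) (k : ℕ) :
    t.rename (· + (k + 1 + 1)) = (t.rename (· + (k + 1))).shift := by
  rw [Exp.shift, Exp.rename_rename]
  rfl

/-- `r` maps the variables of `G` to variables of `G'` of the same (renamed) type. -/
def RenOk (G' : Ctx) (r : ℕ → ℕ) (G : Ctx) : Prop :=
  ∀ ⦃i : ℕ⦄ ⦃t : Exp⦄, G[i]? = some t →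
    ∃ t', G'[r i]? = some t' ∧ t'.rename (· + (r i + 1)) = (t.rename (· + (i + 1))).rename r

theorem RenOk.up {G' G : Ctx} {r : ℕ → ℕ} (h : RenOk G' r G) (t : Exp) :
    RenOk (t.rename r :: G') (upRen r) (t :: G) := by
  intro i t₁ ht
  cases i with
  | zero =>
    cases ht
    exact ⟨_, rfl, (Exp.shift_rename t r).symm⟩
  | succ i =>
    obtain ⟨t', h₁, h₂⟩ := h ht
    refine ⟨t', h₁, ?_⟩
    rw [upRen_succ, Exp.rename_add_two, h₂, Exp.rename_add_two, Exp.shift_rename]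

theorem RenOk.shift (G : Ctx) (t : Exp) : RenOk (t :: G) (· + 1) G :=
  fun i t₁ ht => ⟨t₁, ht, t₁.rename_add_two i⟩

/-- Closedness of `S` enters because the rules quote types of global definitions verbatim, in any
local context. Renaming has to leave these fixed for the same rule to apply again. -/
theorem Judg.rename {S : GCtx} (hS : S.Closed) {G G' : Ctx} {e : Exp} {c : Cls}
    (h : Judg S G e c) {r : ℕ → ℕ} (hr : RenOk G' r G) :
    Judg S G' (e.rename r) (c.rename r) := by
  induction h generalizing r G' with
  | kSub _ hk ih => exact .kSub (ih hr) hk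
  | kUnit => exact .kUnit
  | kBool => exact .kBool
  | kOBool => exact .kOBool
  | kADT h => exact .kADT h
  | kOADT h _ ih =>
    have := ih hr
    rw [Cls.rename, hS.obliv_rename h] at this
    exact .kOADT h this
  | kPi _ _ ih₁ ih₂ => exact .kPi (ih₁ hr) (ih₂ (hr.up _))
  | kProd _ _ ih₁ ih₂ => exact .kProd (ih₁ hr) (ih₂ hr)
  | kOSum _ _ ih₁ ih₂ => exact .kOSum (ih₁ hr) (ih₂ hr)
  | kPsi h => exact .kPsi h
  | kLet _ _ ih₁ ih₂ => exact .kLet (ih₁ hr) (ih₂ (hr.up _))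
  | kIf _ _ _ ih₀ ih₁ ih₂ => exact .kIf (ih₀ hr) (ih₁ hr) (ih₂ hr)
  | kMatch h _ _ ih₀ ih =>
    refine .kMatch h (ih₀ hr) fun i => ?_
    have := ih i (hr.up _)
    rwa [hS.data_rename h] at this
  | tConv _ he _ ih₁ ih₂ => exact .tConv (ih₁ hr) (he.rename hS r) (ih₂ hr)
  | tUnit => exact .tUnit
  | tLit => exact .tLit
  | tVar h =>
    obtain ⟨t', h₁, h₂⟩ := hr h
    rw [Cls.rename, ← h₂]
    exact .tVar h₁
  | tFun h =>
    rw [Cls.rename, hS.fn_rename h]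
    exact .tFun h
  | tAbs _ _ ih₁ ih₂ => exact .tAbs (ih₁ (hr.up _)) (ih₂ hr)
  | tApp _ _ ih₁ ih₂ =>
    rw [Cls.rename, Exp.inst_rename]
    exact .tApp (ih₁ hr) (ih₂ hr)
  | tLet _ _ ih₁ ih₂ =>
    rw [Cls.rename, Exp.inst_rename]
    exact .tLet (ih₁ hr) (ih₂ (hr.up _))
  | tPair _ _ ih₁ ih₂ => exact .tPair (ih₁ hr) (ih₂ hr)
  | tProj _ ih =>
    rw [Cls.rename, cond_rename]
    exact .tProj (ih hr)
  | tIf _ _ _ _ ih₀ ih₁ ih₂ ih₃ =>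
    have h₁ := ih₁ hr
    have h₂ := ih₂ hr
    have h₃ := ih₃ hr
    simp only [Cls.rename, Exp.inst_rename] at h₁ h₂ h₃ ⊢
    exact .tIf (ih₀ hr) h₁ h₂ h₃
  | tCtor h _ ih =>
    have := ih hr
    rw [Cls.rename, hS.data_rename h] at this
    exact .tCtor h this
  | tMatch h _ _ _ ih₀ ih₁ ih₂ =>
    have h₁ := fun i => ih₁ i (hr.up _)
    have h₂ := ih₂ hr
    simp only [Cls.rename, Exp.inst_rename, Exp.instCtor_rename, hS.data_rename h] at h₁ h₂ ⊢
    exact .tMatch h (ih₀ hr) h₁ h₂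
  | tPsiPair h _ _ ih₁ ih₂ =>
    have := ih₁ hr
    rw [Cls.rename, hS.obliv_rename h] at this
    exact .tPsiPair h this (ih₂ hr)
  | tPsiProj₁ h _ ih =>
    rw [Cls.rename, hS.obliv_rename h]
    exact .tPsiProj₁ h (ih hr)
  | tPsiProj₂ h _ ih => exact .tPsiProj₂ h (ih hr)
  | tMux _ _ _ _ ih₀ ih ih₁ ih₂ => exact .tMux (ih₀ hr) (ih hr) (ih₁ hr) (ih₂ hr)
  | tOInj _ _ ih₁ ih₂ =>
    have := ih₁ hr
    rw [Cls.rename, cond_rename] at this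
    exact .tOInj this (ih₂ hr)
  | tOMatch _ _ _ _ ih₀ ih ih₁ ih₂ =>
    have h₁ := ih₁ (hr.up _)
    have h₂ := ih₂ (hr.up _)
    simp only [Cls.rename, Exp.shift_rename] at h₁ h₂
    exact .tOMatch (ih₀ hr) (ih hr) h₁ h₂
  | tSec _ ih => exact .tSec (ih hr)
  | tBoxLit => exact .tBoxLit
  | tBoxInj h =>
    rw [Cls.rename, OTy.toExp_rename]
    exact .tBoxInj h

theorem Judg.shift {S : GCtx} (hS : S.Closed) {G : Ctx} {e : Exp} {c : Cls}
    (h : Judg S G e c) (t : Exp) : Judg S (t :: G) e.shift (c.rename (· + 1)) :=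
  h.rename hS (.shift G t)

/-- `s` maps the variables of `G` to expressions of the substituted types in `G'`. -/
def SubstOk (S : GCtx) (G' : Ctx) (s : ℕ → Exp) (G : Ctx) : Prop :=
  ∀ ⦃i : ℕ⦄ ⦃t : Exp⦄, G[i]? = some t → HasType S G' (s i) ((t.rename (· + (i + 1))).subst s)

theorem SubstOk.up {S : GCtx} (hS : S.Closed) {G' G : Ctx} {s : ℕ → Exp}
    (h : SubstOk S G' s G) (t : Exp) : SubstOk S (t.subst s :: G') (up s) (t :: G) := by
  intro i t₁ ht
  cases i with
  | zero =>
    cases ht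
    have := Exp.shift_subst t s
    rw [Exp.shift] at this
    rw [this]
    exact .tVar rfl
  | succ i =>
    rw [Exp.rename_add_two, Exp.shift_subst]
    exact (h ht).shift hS _

theorem Judg.subst {S : GCtx} (hS : S.Closed) {G G' : Ctx} {e : Exp} {c : Cls}
    (h : Judg S G e c) {s : ℕ → Exp} (hs : SubstOk S G' s G) :
    Judg S G' (e.subst s) (c.subst s) := by
  induction h generalizing s G' with
  | kSub _ hk ih => exact .kSub (ih hs) hk
  | kUnit => exact .kUnit
  | kBool => exact .kBool
  | kOBool => exact .kOBool
  | kADT h => exact .kADT h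
  | kOADT h _ ih =>
    have := ih hs
    rw [Cls.subst, (hS.obliv h s).1] at this
    exact .kOADT h this
  | kPi _ _ ih₁ ih₂ => exact .kPi (ih₁ hs) (ih₂ (hs.up hS _))
  | kProd _ _ ih₁ ih₂ => exact .kProd (ih₁ hs) (ih₂ hs)
  | kOSum _ _ ih₁ ih₂ => exact .kOSum (ih₁ hs) (ih₂ hs)
  | kPsi h => exact .kPsi h
  | kLet _ _ ih₁ ih₂ => exact .kLet (ih₁ hs) (ih₂ (hs.up hS _))
  | kIf _ _ _ ih₀ ih₁ ih₂ => exact .kIf (ih₀ hs) (ih₁ hs) (ih₂ hs)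
  | kMatch h _ _ ih₀ ih =>
    refine .kMatch h (ih₀ hs) fun i => ?_
    have := ih i (hs.up hS _)
    rwa [hS.data h] at this
  | tConv _ he _ ih₁ ih₂ => exact .tConv (ih₁ hs) (he.subst hS s) (ih₂ hs)
  | tUnit => exact .tUnit
  | tLit => exact .tLit
  | tVar h => exact hs h
  | tFun h =>
    rw [Cls.subst, (hS.fn h s).1]
    exact .tFun h
  | tAbs _ _ ih₁ ih₂ => exact .tAbs (ih₁ (hs.up hS _)) (ih₂ hs)
  | tApp _ _ ih₁ ih₂ =>
    rw [Cls.subst, Exp.inst_subst]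
    exact .tApp (ih₁ hs) (ih₂ hs)
  | tLet _ _ ih₁ ih₂ =>
    rw [Cls.subst, Exp.inst_subst]
    exact .tLet (ih₁ hs) (ih₂ (hs.up hS _))
  | tPair _ _ ih₁ ih₂ => exact .tPair (ih₁ hs) (ih₂ hs)
  | tProj _ ih =>
    rw [Cls.subst, cond_subst]
    exact .tProj (ih hs)
  | tIf _ _ _ _ ih₀ ih₁ ih₂ ih₃ =>
    have h₁ := ih₁ hs
    have h₂ := ih₂ hs
    have h₃ := ih₃ hs
    simp only [Cls.subst, Exp.inst_subst] at h₁ h₂ h₃ ⊢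
    exact .tIf (ih₀ hs) h₁ h₂ h₃
  | tCtor h _ ih =>
    have := ih hs
    rw [Cls.subst, hS.data h] at this
    exact .tCtor h this
  | tMatch h _ _ _ ih₀ ih₁ ih₂ =>
    have h₁ := fun i => ih₁ i (hs.up hS _)
    have h₂ := ih₂ hs
    simp only [Cls.subst, Exp.inst_subst, Exp.instCtor_subst, hS.data h] at h₁ h₂ ⊢
    exact .tMatch h (ih₀ hs) h₁ h₂
  | tPsiPair h _ _ ih₁ ih₂ =>
    have := ih₁ hs
    rw [Cls.subst, (hS.obliv h s).1] at this
    exact .tPsiPair h this (ih₂ hs)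
  | tPsiProj₁ h _ ih =>
    rw [Cls.subst, (hS.obliv h s).1]
    exact .tPsiProj₁ h (ih hs)
  | tPsiProj₂ h _ ih => exact .tPsiProj₂ h (ih hs)
  | tMux _ _ _ _ ih₀ ih ih₁ ih₂ => exact .tMux (ih₀ hs) (ih hs) (ih₁ hs) (ih₂ hs)
  | tOInj _ _ ih₁ ih₂ =>
    have := ih₁ hs
    rw [Cls.subst, cond_subst] at this
    exact .tOInj this (ih₂ hs)
  | tOMatch _ _ _ _ ih₀ ih ih₁ ih₂ =>
    have h₁ := ih₁ (hs.up hS _)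
    have h₂ := ih₂ (hs.up hS _)
    simp only [Cls.subst, Exp.shift_subst] at h₁ h₂
    exact .tOMatch (ih₀ hs) (ih hs) h₁ h₂
  | tSec _ ih => exact .tSec (ih hs)
  | tBoxLit => exact .tBoxLit
  | tBoxInj h =>
    rw [Cls.subst, OTy.toExp_subst]
    exact .tBoxInj h

theorem SubstOk.scons {S : GCtx} {G : Ctx} {a t : Exp} (h : HasType S G a t) :
    SubstOk S G (scons a .var) (t :: G) := by
  intro i t₁ ht
  cases i with
  | zero =>
    cases ht
    have := t.shift_inst a
    rw [Exp.shift, Exp.inst] at this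
    rwa [this]
  | succ i =>
    have := (t₁.rename (· + (i + 1))).shift_inst a
    rw [Exp.inst] at this
    rw [Exp.rename_add_two, this]
    exact .tVar ht

theorem Judg.inst_ty {S : GCtx} (hS : S.Closed) {G : Ctx} {a e t t' : Exp}
    (h : HasType S (t :: G) e t') (ha : HasType S G a t) :
    HasType S G (e.inst a) (t'.inst a) :=
  h.subst hS (.scons ha)

theorem Judg.inst_kd {S : GCtx} (hS : S.Closed) {G : Ctx} {a e t : Exp} {k : Kind}
    (h : HasKind S (t :: G) e k) (ha : HasType S G a t) : HasKind S G (e.inst a) k :=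
  h.subst hS (.scons ha)

/-- The type of the innermost variable may be replaced by an equivalent one. -/
theorem Judg.conv_ctx {S : GCtx} (hS : S.Closed) {G : Ctx} {e t t' : Exp} {c : Cls} {k : Kind}
    (h : Judg S (t :: G) e c) (ht : TyEquiv S t' t) (hk : HasKind S G t k) :
    Judg S (t' :: G) e c := by
  have hc : c.subst .var = c := by cases c <;> simp [Cls.subst]
  rw [← e.subst_var, ← hc]
  -- The identity is a well-typed substitution between the two contexts; index `0` recovers its old
  -- type by conversion.
  refine h.subst hS fun i t₁ h₁ => ?_
  rw [Exp.subst_var]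
  cases i with
  | zero =>
    cases h₁
    exact .tConv (.tVar rfl) (ht.rename hS _) (hk.shift hS _)
  | succ i => exact .tVar h₁

theorem Exp.rename_id (e : Exp) : e.rename id = e := by
  rw [Exp.rename_eq_subst]
  exact e.subst_var

theorem RenOk.id_nil (G : Ctx) : RenOk G id [] := fun i t h => by simp at h

theorem RenOk.id_single (G : Ctx) (t : Exp) : RenOk (t :: G) id [t] := by
  intro i t₁ h
  cases i with
  | zero =>
    cases h
    exact ⟨_, rfl, (Exp.rename_id _).symm⟩
  | succ i => simp at h

theorem Judg.weaken_nil {S : GCtx} (hS : S.Closed) {e : Exp} {k : Kind}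
    (h : HasKind S [] e k) (G : Ctx) : HasKind S G e k := by
  have := h.rename hS (.id_nil G)
  rwa [Exp.rename_id] at this

theorem Judg.weaken_single {S : GCtx} (hS : S.Closed) {e t : Exp} {k : Kind}
    (h : HasKind S [t] e k) (G : Ctx) : HasKind S (t :: G) e k := by
  have := h.rename hS (.id_single G t)
  rwa [Exp.rename_id] at this

/-! ## Inversion of judgments -/

/-- What a judgment says about the parts of its subject. -/
def Inv (S : GCtx) (G : Ctx) : Exp → Cls → Prop
  | .prod t₁ t₂, .kd k => HasKind S G t₁ k ∧ HasKind S G t₂ k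
  | .osum t₁ t₂, .kd _ => HasKind S G t₁ .obl ∧ HasKind S G t₂ .obl
  -- This clause and the next three exclude the kind `.obl`. They keep public and mixed types out of
  -- `mux`.
  | .pi t₁ t₂, .kd k => k = .mix ∧ ∃ k₁ k₂, HasKind S G t₁ k₁ ∧ HasKind S (t₁ :: G) t₂ k₂
  | .psi _, .kd k => k = .mix
  | .boolT, .kd k => k = .pub ∨ k = .mix
  | .adt _, .kd k => k = .pub ∨ k = .mix
  | .unit, .ty t => TyEquiv S .unitT t
  | .lit _, .ty t => TyEquiv S .boolT t
  | .boxLit _, .ty t => TyEquiv S .oboolT t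
  | .boxInj b w u, .ty t => OValTy (.boxInj b w u) w ∧ TyEquiv S w.toExp t
  | .lam t₁ e, .ty t => ∃ t₂ k, HasType S (t₁ :: G) e t₂ ∧ HasKind S G t₁ k ∧
      TyEquiv S (.pi t₁ t₂) t
  | .pair e₁ e₂, .ty t => ∃ t₁ t₂, HasType S G e₁ t₁ ∧ HasType S G e₂ t₂ ∧
      TyEquiv S (.prod t₁ t₂) t
  | .psiPair e₁ e₂, .ty t => ∃ T t₁ t₁', S T = some (.obliv t₁ t₁') ∧ HasType S G e₁ t₁ ∧
      HasType S G e₂ (.oapp T e₁) ∧ TyEquiv S (.psi T) t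
  | .ctor c e, .ty t => ∃ T n, ∃ C : Fin n ↪ CName, ∃ ts i, S T = some (.data n C ts) ∧
      c = C i ∧ HasType S G e (ts i) ∧ TyEquiv S (.adt T) t
  | .boxInj _ _ _, .kd _ => False
  -- No kinding rule introduces `mux`, so the clause need not distinguish the two classes.
  | .mux _ e₁ e₂, _ => ∃ t, HasKind S G t .obl ∧ HasType S G e₁ t ∧ HasType S G e₂ t
  | _, _ => True

theorem Inv.kSub {S : GCtx} {G : Ctx} {e : Exp} {k k' : Kind} (h : Inv S G e (.kd k))
    (hk : k.Le k') : Inv S G e (.kd k') := by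
  cases e <;> try trivial
  case prod => exact ⟨.kSub h.1 hk, .kSub h.2 hk⟩
  all_goals
    simp only [Inv] at h ⊢
    cases hk <;> simp_all

theorem Inv.tConv {S : GCtx} {G : Ctx} {e t t' : Exp} (h : Inv S G e (.ty t))
    (he : TyEquiv S t t') : Inv S G e (.ty t') := by
  cases e <;> try trivial
  case unit | lit | boxLit => exact TyEquiv.trans h he
  case boxInj => exact ⟨h.1, h.2.trans he⟩
  case lam =>
    obtain ⟨_, _, h₁, h₂, h₃⟩ := h
    exact ⟨_, _, h₁, h₂, h₃.trans he⟩
  case pair =>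
    obtain ⟨_, _, h₁, h₂, h₃⟩ := h
    exact ⟨_, _, h₁, h₂, h₃.trans he⟩
  case psiPair =>
    obtain ⟨_, _, _, h₀, h₁, h₂, h₃⟩ := h
    exact ⟨_, _, _, h₀, h₁, h₂, h₃.trans he⟩
  case ctor =>
    obtain ⟨_, _, _, _, _, h₀, h₁, h₂, h₃⟩ := h
    exact ⟨_, _, _, _, _, h₀, h₁, h₂, h₃.trans he⟩

/-- A derivation may end in any number of uses of `tConv` or `kSub`. The clauses of `Inv` are stable
under both, so they can be read off the last syntax-directed rule. -/
theorem Judg.inv {S : GCtx} {G : Ctx} {e : Exp} {c : Cls} (h : Judg S G e c) :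
    Inv S G e c := by
  induction h with
  | kSub _ hk ih => exact ih.kSub hk
  | tConv _ he _ ih _ => exact ih.tConv he
  | kBool | kADT => simp [Inv]
  | kPsi => rfl
  | kPi h₁ h₂ => exact ⟨rfl, _, _, h₁, h₂⟩
  | kProd h₁ h₂ | kOSum h₁ h₂ => exact ⟨h₁, h₂⟩
  | tUnit | tLit | tBoxLit => exact TyEquiv.refl _
  | tBoxInj h => exact ⟨h, .refl _⟩
  | tAbs h₁ h₂ => exact ⟨_, _, h₁, h₂, .refl _⟩
  | tPair h₁ h₂ => exact ⟨_, _, h₁, h₂, .refl _⟩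
  | tPsiPair h h₁ h₂ => exact ⟨_, _, _, h, h₁, h₂, .refl _⟩
  | tCtor h h₁ => exact ⟨_, _, _, _, _, h, rfl, h₁, .refl _⟩
  | tMux _ h h₁ h₂ => exact ⟨_, h, h₁, h₂⟩
  | _ => trivial

/-! ## Regularity -/

/-- Well-formed contexts. -/
inductive WfCtx (S : GCtx) : Ctx → Prop
  | nil : WfCtx S []
  | cons {G : Ctx} {t : Exp} {k : Kind} : HasKind S G t k → WfCtx S G → WfCtx S (t :: G)

/-- Having some kind. -/
def WellKinded (S : GCtx) (G : Ctx) (t : Exp) : Prop := ∃ k, HasKind S G t k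

theorem WfCtx.lookup {S : GCtx} (hS : S.Closed) {G : Ctx} (h : WfCtx S G) {i : ℕ} {t : Exp}
    (ht : G[i]? = some t) : WellKinded S G (t.rename (· + (i + 1))) := by
  induction h generalizing i with
  | nil => simp at ht
  | cons hk _ ih =>
    cases i with
    | zero =>
      cases ht
      exact ⟨_, hk.shift hS _⟩
    | succ i =>
      obtain ⟨k, h⟩ := ih ht
      rw [Exp.rename_add_two]
      exact ⟨k, h.shift hS _⟩

theorem hasKind_toExp {S : GCtx} {G : Ctx} (w : OTy) : HasKind S G w.toExp .obl := by
  induction w with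
  | unit => exact .kSub .kUnit (.any_le _)
  | obool => exact .kOBool
  | prod _ _ h₁ h₂ => exact .kProd h₁ h₂
  | osum _ _ h₁ h₂ => exact .kOSum h₁ h₂

theorem GCtx.Ok.data_kind {S : GCtx} (hS : S.Ok) {T : Name} {n : ℕ}
    {C : Fin n ↪ CName} {ts : Fin n → Exp} (h : S T = some (.data n C ts)) (i : Fin n)
    (G : Ctx) : HasKind S G (ts i) .pub := by
  cases hS _ _ h with
  | data h => exact (h i).weaken_nil hS.closed G

theorem GCtx.Ok.obliv_kind {S : GCtx} (hS : S.Ok) {T : Name} {t t' : Exp}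
    (h : S T = some (.obliv t t')) (G : Ctx) :
    HasKind S G t .pub ∧ HasKind S (t :: G) t' .obl := by
  cases hS _ _ h with
  | obliv h₁ h₂ => exact ⟨h₁.weaken_nil hS.closed G, h₂.weaken_single hS.closed G⟩

/-- The class stays a variable so that induction on the joint family applies; the kinding cases are
void. Application and `tProj` obtain the kind of their result by inverting the kind of the function
or product type. Many of the remaining rules carry the required kind as a premise. -/
theorem Judg.regular_aux {S : GCtx} (hS : S.Ok) {G : Ctx} {e : Exp} {c : Cls}
    (h : Judg S G e c) (hG : WfCtx S G) : ∀ t, c = .ty t → WellKinded S G t := by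
  induction h with
  | kSub | kUnit | kBool | kOBool | kADT | kOADT | kPi | kProd | kOSum | kPsi | kLet | kIf
  | kMatch => rintro _ ⟨⟩
  | tConv _ _ h => rintro _ ⟨⟩; exact ⟨_, h⟩
  | tUnit => rintro _ ⟨⟩; exact ⟨_, .kUnit⟩
  | tLit => rintro _ ⟨⟩; exact ⟨_, .kBool⟩
  | tVar h => rintro _ ⟨⟩; exact hG.lookup hS.closed h
  | tFun h =>
    rintro _ ⟨⟩
    cases hS _ _ h with
    | fn h => exact ⟨_, h.weaken_nil hS.closed _⟩
  | tAbs _ h ih =>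
    rintro _ ⟨⟩
    obtain ⟨_, h'⟩ := ih (.cons h hG) _ rfl
    exact ⟨_, .kPi h h'⟩
  | tApp _ h ih =>
    rintro _ ⟨⟩
    obtain ⟨_, h'⟩ := ih hG _ rfl
    obtain ⟨_, _, _, _, h'⟩ := h'.inv
    exact ⟨_, h'.inst_kd hS.closed h⟩
  | tLet h _ ih₁ ih₂ =>
    rintro _ ⟨⟩
    obtain ⟨_, h₁⟩ := ih₁ hG _ rfl
    obtain ⟨_, h₂⟩ := ih₂ (.cons h₁ hG) _ rfl
    exact ⟨_, h₂.inst_kd hS.closed h⟩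
  | tPair _ _ ih₁ ih₂ =>
    rintro _ ⟨⟩
    obtain ⟨_, h₁⟩ := ih₁ hG _ rfl
    obtain ⟨_, h₂⟩ := ih₂ hG _ rfl
    -- A product needs one kind for both components; the top kind always works.
    exact ⟨_, .kProd (.kSub h₁ (.le_mix _)) (.kSub h₂ (.le_mix _))⟩
  | @tProj _ b _ _ _ _ ih =>
    rintro _ ⟨⟩
    obtain ⟨k, h⟩ := ih hG _ rfl
    cases b
    · exact ⟨k, h.inv.2⟩
    · exact ⟨k, h.inv.1⟩
  | tIf _ _ _ h => rintro _ ⟨⟩; exact ⟨_, h⟩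
  | tCtor h => rintro _ ⟨⟩; exact ⟨_, .kADT h⟩
  | tMatch _ _ _ h => rintro _ ⟨⟩; exact ⟨_, h⟩
  | tPsiPair h => rintro _ ⟨⟩; exact ⟨_, .kPsi h⟩
  | tPsiProj₁ h => rintro _ ⟨⟩; exact ⟨_, (hS.obliv_kind h _).1⟩
  | tPsiProj₂ h h' => rintro _ ⟨⟩; exact ⟨_, .kOADT h (.tPsiProj₁ h h')⟩
  | tMux _ h => rintro _ ⟨⟩; exact ⟨_, h⟩
  | tOInj _ h => rintro _ ⟨⟩; exact ⟨_, h⟩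
  | tOMatch _ h => rintro _ ⟨⟩; exact ⟨_, h⟩
  | tSec => rintro _ ⟨⟩; exact ⟨_, .kOBool⟩
  | tBoxLit => rintro _ ⟨⟩; exact ⟨_, .kOBool⟩
  | tBoxInj => rintro _ ⟨⟩; exact ⟨_, hasKind_toExp _⟩

/-- In a well-formed context, types of expressions are well-kinded. -/
theorem Judg.regular {S : GCtx} (hS : S.Ok) {G : Ctx} {e t : Exp} (h : HasType S G e t)
    (hG : WfCtx S G) : WellKinded S G t :=
  h.regular_aux hS hG t rfl

theorem WellKinded.conv {S : GCtx} {G : Ctx} {e t t' : Exp} (h : WellKinded S G t')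
    (he : HasType S G e t) (ht : TyEquiv S t t') : HasType S G e t' := by
  obtain ⟨k, h⟩ := h
  exact .tConv he ht h

/-! ## Preservation under parallel reduction -/

/-- One projection operator serves both sorts of pairs. This excludes a redex of one sort typed by
the rule for the other. -/
theorem TyEquiv.not_psi_prod {S : GCtx} (hS : S.Closed) {T : Name} {a b : Exp} :
    ¬ TyEquiv S (.psi T) (.prod a b) := by
  intro h
  obtain ⟨_, _, e, _⟩ := (h.symm.pareds hS (normal_psi T)).prod_inv
  cases e

theorem TyEquiv.not_prod_psi {S : GCtx} (hS : S.Closed) {T : Name} {a b : Exp} :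
    ¬ TyEquiv S (.prod a b) (.psi T) :=
  fun h => not_psi_prod hS h.symm

theorem OValTy.hasType {S : GCtx} {G : Ctx} {u : OVal} {w : OTy} (h : OValTy u w) :
    HasType S G u.toExp w.toExp := by
  induction h with
  | unit => exact .tUnit
  | obool => exact .tBoxLit
  | prod _ _ h₁ h₂ => exact .tPair h₁ h₂
  | osum h _ => exact .tBoxInj (.osum h)

/-- Typing determines types only up to equivalence, while a boxed injection demands synthesis on the
nose. The gap closes because oblivious type values are normal, so equivalence between them is
equality. -/
theorem OValTy.of_hasType {S : GCtx} (hS : S.Closed) {G : Ctx} {u : OVal} {w : OTy} {t : Exp}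
    (h : HasType S G u.toExp t) (ht : TyEquiv S t w.toExp) : OValTy u w := by
  induction u generalizing w t with
  | unit =>
    have h := TyEquiv.eq hS (normal_toExp .unit) (normal_toExp w) (TyEquiv.trans h.inv ht)
    rw [← OTy.toExp_injective h]
    exact .unit
  | boxLit =>
    have h := TyEquiv.eq hS (normal_toExp .obool) (normal_toExp w) (TyEquiv.trans h.inv ht)
    rw [← OTy.toExp_injective h]
    exact .obool _
  | pair _ _ ih₁ ih₂ =>
    obtain ⟨_, _, h₁, h₂, he⟩ := h.inv
    have he := he.trans ht
    obtain ⟨_, _, e, _⟩ := (he.pareds hS (normal_toExp w)).prod_inv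
    cases w <;> cases e
    obtain ⟨e₁, e₂⟩ := he.prod_inv hS
    exact .prod (ih₁ h₁ e₁) (ih₂ h₂ e₂)
  | boxInj =>
    obtain ⟨h₁, he⟩ := h.inv
    have h := TyEquiv.eq hS (normal_toExp _) (normal_toExp w) (he.trans ht)
    rwa [← OTy.toExp_injective h]

/-- Parallel reduction preserves typing and kinding in well-formed contexts. -/
theorem Judg.pared {S : GCtx} (hS : S.Ok) {G : Ctx} {e : Exp} {c : Cls} (h : Judg S G e c)
    (hG : WfCtx S G) {e' : Exp} (hp : Pared S e e') : Judg S G e' c := by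
  have hC := hS.closed
  induction h generalizing e' with
  | kSub _ hk ih => exact .kSub (ih hG hp) hk
  | kUnit => cases hp; exact .kUnit
  | kBool => cases hp; exact .kBool
  | kOBool => cases hp; exact .kOBool
  | kADT h => cases hp; exact .kADT h
  | kOADT h _ ih =>
    obtain ⟨_, rfl, h'⟩ | ⟨_, _, _, rfl, hT, h'⟩ := hp.oapp_inv
    · exact .kOADT h (ih hG h')
    · cases h.symm.trans hT
      exact (hS.obliv_kind h _).2.inst_kd hC (ih hG h')
  | kPi h₁ _ ih₁ ih₂ =>
    obtain ⟨_, _, rfl, hp₁, hp₂⟩ := hp.pi_inv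
    -- The domain has reduced as well, so the codomain is moved to the context with the new domain.
    exact .kPi (ih₁ hG hp₁) ((ih₂ (.cons h₁ hG) hp₂).conv_ctx hC hp₁.tyEquiv.symm h₁)
  | kProd _ _ ih₁ ih₂ =>
    obtain ⟨_, _, rfl, hp₁, hp₂⟩ := hp.prod_inv
    exact .kProd (ih₁ hG hp₁) (ih₂ hG hp₂)
  | kOSum _ _ ih₁ ih₂ =>
    obtain ⟨_, _, rfl, hp₁, hp₂⟩ := hp.osum_inv
    exact .kOSum (ih₁ hG hp₁) (ih₂ hG hp₂)
  | kPsi h => cases hp; exact .kPsi h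
  | kLet h _ ih₁ ih₂ =>
    obtain ⟨_, _, hx, hp₁, hp₂⟩ := hp.letE_inv
    obtain ⟨_, hk⟩ := h.regular hS hG
    have h₁ := ih₁ hG hp₁
    have h₂ := ih₂ (.cons hk hG) hp₂
    obtain rfl | rfl := hx
    · exact .kLet h₁ h₂
    · exact h₂.inst_kd hC h₁
  | kIf _ _ _ ih₀ ih₁ ih₂ =>
    obtain ⟨_, _, _, rfl | ⟨b, rfl, rfl⟩, hp₀, hp₁, hp₂⟩ := hp.ite_inv
    · exact .kIf (ih₀ hG hp₀) (ih₁ hG hp₁) (ih₂ hG hp₂)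
    · cases b
      · exact ih₂ hG hp₂
      · exact ih₁ hG hp₁
  | kMatch h h₀ _ ih₀ ih =>
    obtain ⟨_, hx, hps⟩ := hp.cases_inv
    have hs := fun i => ih i (.cons (hS.data_kind h i _) hG) (hps i)
    obtain ⟨_, rfl, hp₀⟩ | ⟨i, _, _, rfl, hp₀, rfl⟩ := hx
    · exact .kMatch h (ih₀ hG hp₀) hs
    -- The induction hypothesis concerns the whole scrutinee. It is applied to the congruence
    -- reduct, and inversion then types the reduced payload. The same device handles the other
    -- contractions of eliminators.
    · obtain ⟨_, _, _, _, _, hT, hc, ha, he⟩ := (ih₀ hG (.ctor hp₀)).inv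
      cases he.eq hC (normal_adt _) (normal_adt _)
      cases h.symm.trans hT
      cases Function.Embedding.injective _ hc
      exact (hs i).inst_kd hC ha
  | tConv _ he hk ih => exact .tConv (ih hG hp) he hk
  | tUnit => cases hp; exact .tUnit
  | tLit => cases hp; exact .tLit
  | tVar h => cases hp; exact .tVar h
  | @tFun G _ _ _ h =>
    cases hp with
    | refl => exact .tFun h
    | fn h' =>
      cases h.symm.trans h'
      cases hS _ _ h with
      | fn _ h =>
        have := h.rename hC (.id_nil G)
        rwa [Cls.rename, Exp.rename_id, Exp.rename_id] at this
  | tAbs h₁ h₂ ih₁ ih₂ =>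
    obtain ⟨_, _, rfl, hp₂, hp₁⟩ := hp.lam_inv
    refine ((Judg.tAbs h₁ h₂).regular hS hG).conv
      (.tAbs ((ih₁ (.cons h₂ hG) hp₁).conv_ctx hC hp₂.tyEquiv.symm h₂) (ih₂ hG hp₂)) ?_
    exact .pi hp₂.tyEquiv.symm (.refl _)
  | tApp h₁ h₂ ih₁ ih₂ =>
    have hk := (Judg.tApp h₁ h₂).regular hS hG
    obtain ⟨_, _, rfl, hp₁, hp₂⟩ | ⟨_, _, _, _, rfl, rfl, hp₁, hp₂⟩ := hp.app_inv
    · exact hk.conv (.tApp (ih₁ hG hp₁) (ih₂ hG hp₂)) (.inst hC (.refl _) hp₂.tyEquiv.symm)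
    · obtain ⟨_, _, hb, hk', he⟩ := (ih₁ hG (.lam (.refl _) hp₁)).inv
      obtain ⟨he₁, he₂⟩ := he.pi_inv hC
      -- The annotated domain and the domain of the function type agree only up to equivalence, by
      -- injectivity of `pi`.
      have ha : HasType S _ _ _ := .tConv (ih₂ hG hp₂) he₁.symm hk'
      exact hk.conv (hb.inst_ty hC ha) (.inst hC he₂ hp₂.tyEquiv.symm)
  | tLet h₁ h₂ ih₁ ih₂ =>
    have hk := (Judg.tLet h₁ h₂).regular hS hG
    obtain ⟨_, _, hx, hp₁, hp₂⟩ := hp.letE_inv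
    obtain ⟨_, hk'⟩ := h₁.regular hS hG
    have h₁' := ih₁ hG hp₁
    have h₂' := ih₂ (.cons hk' hG) hp₂
    refine hk.conv ?_ (.inst hC (.refl _) hp₁.tyEquiv.symm)
    obtain rfl | rfl := hx
    · exact .tLet h₁' h₂'
    · exact h₂'.inst_ty hC h₁'
  | tPair _ _ ih₁ ih₂ =>
    obtain ⟨_, _, rfl, hp₁, hp₂⟩ := hp.pair_inv
    exact .tPair (ih₁ hG hp₁) (ih₂ hG hp₂)
  | @tProj _ b _ _ _ h ih =>
    have hk := (Judg.tProj (b := b) h).regular hS hG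
    obtain ⟨_, rfl, h'⟩ | ⟨_, _, _, _, rfl | rfl, rfl, hp₁, hp₂⟩ := hp.proj_inv
    · exact .tProj (ih hG h')
    · obtain ⟨_, _, h₁, h₂, he⟩ := (ih hG (.pair hp₁ hp₂)).inv
      obtain ⟨he₁, he₂⟩ := he.prod_inv hC
      cases b
      · exact hk.conv h₂ he₂
      · exact hk.conv h₁ he₁
    · obtain ⟨_, _, _, _, _, _, he⟩ := h.inv
      exact (TyEquiv.not_psi_prod hC he).elim
  | @tIf _ _ _ _ t _ h₀ _ _ hk ih₀ ih₁ ih₂ ihk =>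
    obtain ⟨_, _, _, rfl | ⟨b, rfl, rfl⟩, hp₀, hp₁, hp₂⟩ := hp.ite_inv
    -- The result type mentions the scrutinee and reduces with it. The hypothesis for its kinding
    -- premise, used along this reduction, supplies the kind that `tIf` asks for.
    · have hpt := Pared.inst hC (.refl t) hp₀
      exact .tConv (.tIf (ih₀ hG hp₀) (ih₁ hG hp₁) (ih₂ hG hp₂) (ihk hG hpt))
        hpt.tyEquiv.symm hk
    · cases b
      · exact ih₂ hG hp₂
      · exact ih₁ hG hp₁
  | tCtor h _ ih =>
    obtain ⟨_, rfl, h'⟩ := hp.ctor_inv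
    exact .tCtor h (ih hG h')
  | @tMatch _ _ _ _ _ _ t _ _ h h₀ _ hk ih₀ ih ihk =>
    obtain ⟨_, hx, hps⟩ := hp.cases_inv
    have hs := fun i => ih i (.cons (hS.data_kind h i _) hG) (hps i)
    obtain ⟨_, rfl, hp₀⟩ | ⟨i, _, _, rfl, hp₀, rfl⟩ := hx
    · have hpt := Pared.inst hC (.refl t) hp₀
      exact .tConv (.tMatch h (ih₀ hG hp₀) hs (ihk hG hpt)) hpt.tyEquiv.symm hk
    · obtain ⟨_, _, _, _, _, hT, hc, ha, he⟩ := (ih₀ hG (.ctor hp₀)).inv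
      cases he.eq hC (normal_adt _) (normal_adt _)
      cases h.symm.trans hT
      cases Function.Embedding.injective _ hc
      have := (hs i).inst_ty hC ha
      rw [Exp.instCtor_inst] at this
      exact .tConv this (.inst hC (.refl _) hp₀.ctor.tyEquiv.symm) hk
  | tPsiPair h h₁ h₂ ih₁ ih₂ =>
    obtain ⟨_, _, rfl, hp₁, hp₂⟩ := hp.psiPair_inv
    have h₁' := ih₁ hG hp₁
    -- The type of the second component contains the first component, which has reduced.
    exact .tPsiPair h h₁' (.tConv (ih₂ hG hp₂) hp₁.oapp.tyEquiv (.kOADT h h₁'))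
  | tPsiProj₁ h h₁ ih =>
    obtain ⟨_, rfl, h'⟩ | ⟨_, _, _, _, rfl | rfl, rfl, hp₁, hp₂⟩ := hp.proj_inv
    · exact .tPsiProj₁ h (ih hG h')
    · obtain ⟨_, _, _, _, he⟩ := h₁.inv
      exact (TyEquiv.not_prod_psi hC he).elim
    · obtain ⟨_, _, _, hT, h₁, h₂, he⟩ := (ih hG (.psiPair hp₁ hp₂)).inv
      cases he.eq hC (normal_psi _) (normal_psi _)
      cases h.symm.trans hT
      exact h₁
  | tPsiProj₂ h h₁ ih =>
    have hk := (Judg.tPsiProj₂ h h₁).regular hS hG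
    obtain ⟨_, rfl, h'⟩ | ⟨_, _, _, _, rfl | rfl, rfl, hp₁, hp₂⟩ := hp.proj_inv
    · exact hk.conv (.tPsiProj₂ h (ih hG h')) h'.proj.oapp.tyEquiv.symm
    · obtain ⟨_, _, _, _, he⟩ := h₁.inv
      exact (TyEquiv.not_prod_psi hC he).elim
    · obtain ⟨_, _, _, hT, _, h₂, he⟩ := (ih hG (.psiPair hp₁ hp₂)).inv
      cases he.eq hC (normal_psi _) (normal_psi _)
      -- The expected type contains the first projection of the pair; contracting that projection
      -- gives the type at hand.
      exact hk.conv h₂ (Pared.oapp (.projPsiPair (b := true) hp₁ hp₂)).tyEquiv.symm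
  | tMux _ hk _ _ ih₀ _ ih₁ ih₂ =>
    obtain ⟨_, _, _, rfl | ⟨b, rfl, rfl⟩, hp₀, hp₁, hp₂⟩ := hp.mux_inv
    · exact .tMux (ih₀ hG hp₀) hk (ih₁ hG hp₁) (ih₂ hG hp₂)
    · cases b
      · exact ih₂ hG hp₂
      · exact ih₁ hG hp₁
  | @tOInj _ b _ _ _ h hk ih ihk =>
    obtain ⟨_, _, rfl, hp₁, hp₂⟩ | ⟨w, _, e, rfl, rfl⟩ := hp.oinj_inv
    · have hk' := ihk hG hp₁
      have h' := ih hG hp₂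
      have het := hp₁.tyEquiv.symm
      obtain ⟨_, _, rfl, hq₁, hq₂⟩ := hp₁.osum_inv
      refine .tConv (.tOInj ?_ hk') het hk
      cases b
      · exact .tConv h' hq₂.tyEquiv hk'.inv.2
      · exact .tConv h' hq₁.tyEquiv hk'.inv.1
    · cases w <;> cases e
      rename_i w₁ w₂
      -- The annotation is already a type value, so the payload type is one too.
      have := OValTy.of_hasType (w := cond b w₁ w₂) hC h (by cases b <;> exact .refl _)
      exact .tBoxInj (.osum this)
  | tOMatch h₀ hk h₁ h₂ ih₀ _ ih₁ ih₂ =>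
    obtain ⟨_, hks⟩ := h₀.regular hS hG
    obtain ⟨hk₁, hk₂⟩ := hks.inv
    obtain ⟨_, _, _, hx, hp₀, hp₁, hp₂⟩ := hp.omatch_inv
    have h₁' := ih₁ (.cons hk₁ hG) hp₁
    have h₂' := ih₂ (.cons hk₂ hG) hp₂
    obtain rfl | ⟨b, _, _, u, _, _, rfl, hu₁, hu₂, rfl⟩ := hx
    · exact .tOMatch (ih₀ hG hp₀) hk h₁' h₂'
    · obtain ⟨ho, he⟩ := h₀.inv
      obtain ⟨he₁, he₂⟩ := TyEquiv.osum_inv hC he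
      -- Stated for every inhabitant of the summand, hence for the payload and the guess alike. The
      -- result type of a branch is shifted, so it does not depend on which one is substituted.
      have hi₁ : ∀ {u}, OValTy u _ → _ := fun hu =>
        h₁'.inst_ty hC (.tConv (OValTy.hasType hu) he₁ hk₁)
      have hi₂ : ∀ {u}, OValTy u _ → _ := fun hu =>
        h₂'.inst_ty hC (.tConv (OValTy.hasType hu) he₂ hk₂)
      simp only [Exp.shift_inst] at hi₁ hi₂
      cases ho with
      | osum hu =>
        cases b
        · exact .tMux .tBoxLit hk (hi₁ hu₁) (hi₂ hu)
        · exact .tMux .tBoxLit hk (hi₁ hu) (hi₂ hu₂)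
  | tSec _ ih =>
    obtain ⟨_, rfl, h'⟩ | ⟨_, rfl, rfl⟩ := hp.sec_inv
    · exact .tSec (ih hG h')
    · exact .tBoxLit
  | tBoxLit => cases hp; exact .tBoxLit
  | tBoxInj h => cases hp; exact .tBoxInj h

theorem Judg.pareds {S : GCtx} (hS : S.Ok) {G : Ctx} {e : Exp} {c : Cls} (h : Judg S G e c)
    (hG : WfCtx S G) {e' : Exp} (hp : Pareds S e e') : Judg S G e' c := by
  induction hp with
  | refl => exact h
  | tail _ hp ih => exact ih.pared hS hG hp

/-! ### Small steps as parallel reductions. -/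

theorem Step.pared {S : GCtx} {e e' : Exp} (h : Step S e e') : Pared S e e' := by
  induction h with
  | cProd₁ _ ih => exact .prod ih (.refl _)
  | cProd₂ _ ih => exact .prod (.refl _) ih
  | cOSum₁ _ ih => exact .osum ih (.refl _)
  | cOSum₂ _ ih => exact .osum (.refl _) ih
  | cLet _ ih => exact .letE ih (.refl _)
  | cApp₂ _ ih => exact .app (.refl _) ih
  | cApp₁ _ _ ih => exact .app ih (.refl _)
  | cCtor _ ih => exact .ctor ih
  | cOApp _ ih => exact .oapp ih
  | cIte _ ih => exact .ite ih (.refl _) (.refl _)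
  | cMux₀ _ ih => exact .mux ih (.refl _) (.refl _)
  | cMux₁ _ _ ih => exact .mux (.refl _) ih (.refl _)
  | cMux₂ _ _ _ ih => exact .mux (.refl _) (.refl _) ih
  | cPair₁ _ ih => exact .pair ih (.refl _)
  | cPair₂ _ _ ih => exact .pair (.refl _) ih
  | cPsiPair₁ _ ih => exact .psiPair ih (.refl _)
  | cPsiPair₂ _ _ ih => exact .psiPair (.refl _) ih
  | cProj _ ih => exact .proj ih
  | cOInj₁ _ ih => exact .oinj ih (.refl _)
  | cOInj₂ _ ih => exact .oinj (.refl _) ih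
  | cOMatch _ ih => exact .omatch ih (.refl _) (.refl _)
  | cCases _ ih => exact .cases ih fun _ => .refl _
  | cSec _ ih => exact .sec ih
  | fn h => exact .fn h
  | oadt h _ => exact .oadt h (.refl _)
  | app => exact .beta (.refl _) (.refl _)
  | letE => exact .letBeta (.refl _) (.refl _)
  | ite => exact .iteLit (.refl _) (.refl _)
  | mux => exact .muxBox (.refl _) (.refl _)
  | cases => exact .casesCtor (.refl _) fun _ => .refl _
  | proj => exact .projPair (.refl _) (.refl _)
  | psiProj => exact .projPsiPair (.refl _) (.refl _)
  | sec => exact .secLit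
  | oinj => exact .oinjBox
  | omatch h₁ h₂ => exact .omatchBox h₁ h₂ (.refl _) (.refl _)

/-! ## Values -/

/-- Being a value is a matter of shape, and a box is a value whatever it contains. -/
theorem Value.indist {v v' : Exp} (hv : Value v) (h : Indist v v') : Value v' := by
  induction hv generalizing v' <;> cases h <;> constructor <;> solve_by_elim

theorem Value.not_step {S : GCtx} {v x : Exp} (hv : Value v) : ¬ Step S v x := by
  intro h
  induction hv generalizing x <;> cases h <;> solve_by_elim

theorem OVal.value_toExp (u : OVal) : Value u.toExp := by
  induction u <;> constructor <;> assumption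

theorem OVal.indist_toExp {u : OVal} {e : Exp} (h : Indist u.toExp e) :
    ∃ u' : OVal, e = u'.toExp := by
  induction u generalizing e with
  | unit => cases h; exact ⟨.unit, rfl⟩
  | boxLit => cases h; exact ⟨.boxLit _, rfl⟩
  | pair _ _ ih₁ ih₂ =>
    cases h with
    | pair h₁ h₂ =>
      obtain ⟨_, rfl⟩ := ih₁ h₁
      obtain ⟨_, rfl⟩ := ih₂ h₂
      exact ⟨.pair _ _, rfl⟩
  | boxInj => cases h; exact ⟨.boxInj _ _ _, rfl⟩

/-- Oblivious type values contain no boxes. -/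
theorem OTy.indist_toExp {w : OTy} {e : Exp} (h : Indist w.toExp e) : e = w.toExp := by
  induction w generalizing e with
  | unit => cases h; rfl
  | obool => cases h; rfl
  | prod _ _ ih₁ ih₂ =>
    cases h with
    | prod h₁ h₂ => rw [ih₁ h₁, ih₂ h₂]; rfl
  | osum _ _ ih₁ ih₂ =>
    cases h with
    | osum h₁ h₂ => rw [ih₁ h₁, ih₂ h₂]; rfl

theorem OTy.not_step {S : GCtx} {w : OTy} {x : Exp} : ¬ Step S w.toExp x := by
  intro h
  induction w generalizing x with
  | unit => cases h
  | obool => cases h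
  | prod a b ih₁ ih₂ =>
    rw [OTy.toExp] at h
    -- `cProd₂` has some `w.toExp` as an index, which cannot be unified with `a.toExp`
    -- syntactically.
    generalize ha : a.toExp = a' at h
    cases h <;> simp_all
  | osum a b ih₁ ih₂ =>
    rw [OTy.toExp] at h
    generalize ha : a.toExp = a' at h
    cases h <;> simp_all

/-- Values of the same oblivious type are indistinguishable. -/
theorem Value.indist_of_hasKind {S : GCtx} (hS : S.Ok) {G : Ctx} (hG : WfCtx S G) {v v' t : Exp}
    (hv : Value v) (hv' : Value v') (ht : HasKind S G t .obl) (h : HasType S G v t)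
    (h' : HasType S G v' t) : Indist v v' := by
  have hC := hS.closed
  -- A type equivalent to a normal type reduces to it, and kinds are preserved on the way. The same
  -- argument serves `bool` and `psi`; for `pi` the reduct is some function type.
  have adt : ∀ {T t}, HasKind S G t .obl → ¬ TyEquiv S (.adt T) t := fun ht he => by
    cases (ht.pareds hS hG (he.symm.pareds hC (normal_adt _))).inv <;> contradiction
  have bool : ∀ {t}, HasKind S G t .obl → ¬ TyEquiv S .boolT t := fun ht he => by
    cases (ht.pareds hS hG (he.symm.pareds hC normal_boolT)).inv <;> contradiction
  have psi : ∀ {T t}, HasKind S G t .obl → ¬ TyEquiv S (.psi T) t := fun ht he => by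
    cases (ht.pareds hS hG (he.symm.pareds hC (normal_psi _))).inv
  have pi : ∀ {a b t}, HasKind S G t .obl → ¬ TyEquiv S (.pi a b) t := fun ht he => by
    obtain ⟨_, _, hp⟩ := he.symm.pareds_pi hC
    cases (ht.pareds hS hG hp).inv.1
  have prod : ∀ {w : OTy} {a b}, TyEquiv S (.prod a b) w.toExp → ∃ w₁ w₂, w = .prod w₁ w₂ :=
    fun {w _ _} he => by
      obtain ⟨_, _, e, _⟩ := (he.pareds hC (normal_toExp w)).prod_inv
      cases w <;> cases e
      exact ⟨_, _, rfl⟩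
  induction hv generalizing v' t with
  | unit =>
    have he : TyEquiv S OTy.unit.toExp t := h.inv
    cases hv' with
    | unit => exact .unit
    | boxLit =>
      have := TyEquiv.eq hC (normal_toExp .unit) (normal_toExp .obool) (he.trans (.symm h'.inv))
      cases this
    | boxInj =>
      obtain ⟨ho, he'⟩ := h'.inv
      have := TyEquiv.eq hC (normal_toExp .unit) (normal_toExp _) (he.trans he'.symm)
      -- This exposes the annotation as an oblivious sum, which is a normal type different from
      -- `unit`.
      cases ho
      cases this
    | lit => exact (bool ht h'.inv).elim
    | pair =>
      obtain ⟨_, _, _, _, he'⟩ := h'.inv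
      obtain ⟨_, _, e⟩ := prod (w := .unit) (he'.trans he.symm)
      cases e
    | psiPair =>
      obtain ⟨_, _, _, _, _, _, he'⟩ := h'.inv
      exact (psi ht he').elim
    | lam =>
      obtain ⟨_, _, _, _, he'⟩ := h'.inv
      exact (pi ht he').elim
    | ctor =>
      obtain ⟨_, _, _, _, _, _, _, _, he'⟩ := h'.inv
      exact (adt ht he').elim
  | boxLit =>
    have he : TyEquiv S OTy.obool.toExp t := h.inv
    cases hv' with
    | unit =>
      have := TyEquiv.eq hC (normal_toExp .obool) (normal_toExp .unit) (he.trans (.symm h'.inv))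
      cases this
    | boxLit => exact .boxLit _ _
    | boxInj =>
      obtain ⟨ho, he'⟩ := h'.inv
      have := TyEquiv.eq hC (normal_toExp .obool) (normal_toExp _) (he.trans he'.symm)
      cases ho
      cases this
    | lit => exact (bool ht h'.inv).elim
    | pair =>
      obtain ⟨_, _, _, _, he'⟩ := h'.inv
      obtain ⟨_, _, e⟩ := prod (w := .obool) (he'.trans he.symm)
      cases e
    | psiPair =>
      obtain ⟨_, _, _, _, _, _, he'⟩ := h'.inv
      exact (psi ht he').elim
    | lam =>
      obtain ⟨_, _, _, _, he'⟩ := h'.inv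
      exact (pi ht he').elim
    | ctor =>
      obtain ⟨_, _, _, _, _, _, _, _, he'⟩ := h'.inv
      exact (adt ht he').elim
  | boxInj =>
    obtain ⟨ho, he⟩ := h.inv
    cases hv' with
    | unit =>
      have := TyEquiv.eq hC (normal_toExp _) (normal_toExp .unit) (he.trans (.symm h'.inv))
      cases ho
      cases this
    | boxLit =>
      have := TyEquiv.eq hC (normal_toExp _) (normal_toExp .obool) (he.trans (.symm h'.inv))
      cases ho
      cases this
    | boxInj =>
      obtain ⟨_, he'⟩ := h'.inv
      have := TyEquiv.eq hC (normal_toExp _) (normal_toExp _) (he.trans he'.symm)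
      rw [OTy.toExp_injective this]
      exact .boxInj _ _ _ _ _
    | lit => exact (bool ht h'.inv).elim
    | pair =>
      obtain ⟨_, _, _, _, he'⟩ := h'.inv
      obtain ⟨_, _, rfl⟩ := prod (he'.trans he.symm)
      cases ho
    | psiPair =>
      obtain ⟨_, _, _, _, _, _, he'⟩ := h'.inv
      exact (psi ht he').elim
    | lam =>
      obtain ⟨_, _, _, _, he'⟩ := h'.inv
      exact (pi ht he').elim
    | ctor =>
      obtain ⟨_, _, _, _, _, _, _, _, he'⟩ := h'.inv
      exact (adt ht he').elim
  | lit => exact (bool ht h.inv).elim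
  | pair hv₁ hv₂ ih₁ ih₂ =>
    obtain ⟨_, _, h₁, h₂, he⟩ := h.inv
    cases hv' with
    | unit =>
      obtain ⟨_, _, e⟩ := prod (w := .unit) (he.trans (.symm h'.inv))
      cases e
    | boxLit =>
      obtain ⟨_, _, e⟩ := prod (w := .obool) (he.trans (.symm h'.inv))
      cases e
    | boxInj =>
      obtain ⟨ho, he'⟩ := h'.inv
      obtain ⟨_, _, rfl⟩ := prod (he.trans he'.symm)
      cases ho
    | lit => exact (bool ht h'.inv).elim
    | pair hv₁' hv₂' =>
      obtain ⟨_, _, h₁', h₂', he'⟩ := h'.inv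
      -- The common type is only equivalent to a product. Reducing it to an actual product keeps it
      -- oblivious, and kinding inversion makes both components oblivious, as the induction
      -- hypotheses require.
      obtain ⟨_, _, hp, he₁, he₂⟩ := he.symm.pareds_prod hC
      obtain ⟨hk₁, hk₂⟩ := (ht.pareds hS hG hp).inv
      obtain ⟨he₁', he₂'⟩ := (he'.trans hp.tyEquiv).prod_inv hC
      exact .pair (ih₁ hv₁' hk₁ (.tConv h₁ he₁ hk₁) (.tConv h₁' he₁' hk₁))
        (ih₂ hv₂' hk₂ (.tConv h₂ he₂ hk₂) (.tConv h₂' he₂' hk₂))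
    | psiPair =>
      obtain ⟨_, _, _, _, _, _, he'⟩ := h'.inv
      exact (psi ht he').elim
    | lam =>
      obtain ⟨_, _, _, _, he'⟩ := h'.inv
      exact (pi ht he').elim
    | ctor =>
      obtain ⟨_, _, _, _, _, _, _, _, he'⟩ := h'.inv
      exact (adt ht he').elim
  | psiPair =>
    obtain ⟨_, _, _, _, _, _, he⟩ := h.inv
    exact (psi ht he).elim
  | lam =>
    obtain ⟨_, _, _, _, he⟩ := h.inv
    exact (pi ht he).elim
  | ctor =>
    obtain ⟨_, _, _, _, _, _, _, _, he⟩ := h.inv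
    exact (adt ht he).elim

/-! ## Steps of indistinguishable expressions -/

/-- An expression indistinguishable from a reducible one is reducible. -/
theorem Step.exists_of_indist {S : GCtx} {e₁ e₁' e₂ : Exp} (h : Step S e₁ e₁')
    (hi : Indist e₁ e₂) : ∃ e₂', Step S e₂ e₂' := by
  induction h generalizing e₂ with
  | cProd₁ _ ih =>
    cases hi with
    | prod h _ =>
      obtain ⟨_, h⟩ := ih h
      exact ⟨_, .cProd₁ h⟩
  | cProd₂ _ ih =>
    cases hi with
    | prod h₁ h =>
      obtain ⟨_, h⟩ := ih h
      rw [OTy.indist_toExp h₁]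
      exact ⟨_, .cProd₂ h⟩
  | cOSum₁ _ ih =>
    cases hi with
    | osum h _ =>
      obtain ⟨_, h⟩ := ih h
      exact ⟨_, .cOSum₁ h⟩
  | cOSum₂ _ ih =>
    cases hi with
    | osum h₁ h =>
      obtain ⟨_, h⟩ := ih h
      rw [OTy.indist_toExp h₁]
      exact ⟨_, .cOSum₂ h⟩
  | cLet _ ih =>
    cases hi with
    | letE h _ =>
      obtain ⟨_, h⟩ := ih h
      exact ⟨_, .cLet h⟩
  | cApp₂ _ ih =>
    cases hi with
    | app _ h =>
      obtain ⟨_, h⟩ := ih h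
      exact ⟨_, .cApp₂ h⟩
  | cApp₁ hv₂ _ ih =>
    cases hi with
    | app h h₂ =>
      obtain ⟨_, h⟩ := ih h
      exact ⟨_, .cApp₁ (hv₂.indist h₂) h⟩
  | cCtor _ ih =>
    cases hi with
    | ctor _ h =>
      obtain ⟨_, h⟩ := ih h
      exact ⟨_, .cCtor h⟩
  | cOApp _ ih =>
    cases hi with
    | oapp _ h =>
      obtain ⟨_, h⟩ := ih h
      exact ⟨_, .cOApp h⟩
  | cIte _ ih =>
    cases hi with
    | ite h _ _ =>
      obtain ⟨_, h⟩ := ih h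
      exact ⟨_, .cIte h⟩
  | cMux₀ _ ih =>
    cases hi with
    | mux h _ _ =>
      obtain ⟨_, h⟩ := ih h
      exact ⟨_, .cMux₀ h⟩
  | cMux₁ hv₀ _ ih =>
    cases hi with
    | mux h₀ h _ =>
      obtain ⟨_, h⟩ := ih h
      exact ⟨_, .cMux₁ (hv₀.indist h₀) h⟩
  | cMux₂ hv₀ hv₁ _ ih =>
    cases hi with
    | mux h₀ h₁ h =>
      obtain ⟨_, h⟩ := ih h
      exact ⟨_, .cMux₂ (hv₀.indist h₀) (hv₁.indist h₁) h⟩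
  | cPair₁ _ ih =>
    cases hi with
    | pair h _ =>
      obtain ⟨_, h⟩ := ih h
      exact ⟨_, .cPair₁ h⟩
  | cPair₂ hv₁ _ ih =>
    cases hi with
    | pair h₁ h =>
      obtain ⟨_, h⟩ := ih h
      exact ⟨_, .cPair₂ (hv₁.indist h₁) h⟩
  | cPsiPair₁ _ ih =>
    cases hi with
    | psiPair h _ =>
      obtain ⟨_, h⟩ := ih h
      exact ⟨_, .cPsiPair₁ h⟩
  | cPsiPair₂ hv₁ _ ih =>
    cases hi with
    | psiPair h₁ h =>
      obtain ⟨_, h⟩ := ih h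
      exact ⟨_, .cPsiPair₂ (hv₁.indist h₁) h⟩
  | cProj _ ih =>
    cases hi with
    | proj _ h =>
      obtain ⟨_, h⟩ := ih h
      exact ⟨_, .cProj h⟩
  | cOInj₁ _ ih =>
    cases hi with
    | oinj _ h _ =>
      obtain ⟨_, h⟩ := ih h
      exact ⟨_, .cOInj₁ h⟩
  | cOInj₂ _ ih =>
    cases hi with
    | oinj _ h₁ h =>
      obtain ⟨_, h⟩ := ih h
      rw [OTy.indist_toExp h₁]
      exact ⟨_, .cOInj₂ h⟩
  | cOMatch _ ih =>
    cases hi with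
    | omatch h _ _ =>
      obtain ⟨_, h⟩ := ih h
      exact ⟨_, .cOMatch h⟩
  | cCases _ ih =>
    cases hi with
    | cases _ _ h _ =>
      obtain ⟨_, h⟩ := ih h
      exact ⟨_, .cCases h⟩
  | cSec _ ih =>
    cases hi with
    | sec h =>
      obtain ⟨_, h⟩ := ih h
      exact ⟨_, .cSec h⟩
  | fn h => cases hi; exact ⟨_, .fn h⟩
  | oadt hT hv =>
    cases hi with
    | oapp _ h => exact ⟨_, .oadt hT (hv.indist h)⟩
  | app hv =>
    cases hi with
    | app h₁ h₂ => cases h₁; exact ⟨_, .app (hv.indist h₂)⟩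
  | letE hv =>
    cases hi with
    | letE h₁ _ => exact ⟨_, .letE (hv.indist h₁)⟩
  | ite =>
    cases hi with
    | ite h _ _ => cases h; exact ⟨_, .ite⟩
  | mux hv₁ hv₂ =>
    cases hi with
    | mux h h₁ h₂ => cases h; exact ⟨_, .mux (hv₁.indist h₁) (hv₂.indist h₂)⟩
  | cases hv =>
    cases hi with
    | cases _ _ h _ =>
      cases h with
      | ctor _ h => exact ⟨_, .cases (hv.indist h)⟩
  | proj hv₁ hv₂ =>
    cases hi with
    | proj _ h =>
      cases h with
      | pair h₁ h₂ => exact ⟨_, .proj (hv₁.indist h₁) (hv₂.indist h₂)⟩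
  | psiProj hv₁ hv₂ =>
    cases hi with
    | proj _ h =>
      cases h with
      | psiPair h₁ h₂ => exact ⟨_, .psiProj (hv₁.indist h₁) (hv₂.indist h₂)⟩
  | sec =>
    cases hi with
    | sec h => cases h; exact ⟨_, .sec⟩
  | oinj =>
    cases hi with
    | oinj _ h₁ h₂ =>
      obtain ⟨_, rfl⟩ := OVal.indist_toExp h₂
      rw [OTy.indist_toExp h₁]
      exact ⟨_, .oinj⟩
  | @omatch _ w₁ w₂ =>
    cases hi with
    | omatch h _ _ =>
      cases h
      -- The match is never stuck for want of a guess, since every oblivious type value is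
      -- inhabited.
      obtain ⟨_, h₁⟩ := w₁.exists_val
      obtain ⟨_, h₂⟩ := w₂.exists_val
      exact ⟨_, .omatch h₁ h₂⟩

/-! ### One step from indistinguishable, well-formed subjects. -/

/-- Being the subject of some judgment in the empty context. -/
def Ok (S : GCtx) (e : Exp) : Prop := ∃ c, Judg S [] e c

/-- The property `P` for the direct subexpressions in which steps may be taken. -/
def StepPositions (P : Exp → Prop) : Exp → Prop
  | .prod a b | .osum a b | .app a b | .pair a b | .psiPair a b | .oinj _ a b => P a ∧ P b
  | .letE a _ | .ctor _ a | .oapp _ a | .ite a _ _ | .proj _ a | .omatch a _ _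
  | .cases _ _ a _ | .sec a => P a
  | .mux a b c => P a ∧ P b ∧ P c
  | _ => True

/-- Evaluation positions never lie under a binder, so their judgments live in the same context. -/
theorem Judg.stepPositions {S : GCtx} {G : Ctx} {e : Exp} {c : Cls} (h : Judg S G e c) :
    StepPositions (fun e => ∃ c, Judg S G e c) e := by
  induction h with
  | kSub _ _ ih => exact ih
  | tConv _ _ _ ih => exact ih
  | kOADT _ h | tProj h | tPsiProj₁ _ h | tPsiProj₂ _ h | tCtor _ h | tSec h | tLet h | kLet h
  | kIf h | tIf h | kMatch _ h | tMatch _ h | tOMatch h => exact ⟨_, h⟩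
  | kProd h₁ h₂ | kOSum h₁ h₂ | tApp h₁ h₂ | tPair h₁ h₂ | tPsiPair _ h₁ h₂ | tOInj h₂ h₁ =>
    exact ⟨⟨_, h₁⟩, ⟨_, h₂⟩⟩
  | tMux h₀ _ h₁ h₂ => exact ⟨⟨_, h₀⟩, ⟨_, h₁⟩, ⟨_, h₂⟩⟩
  | _ => trivial

theorem Ok.stepPositions {S : GCtx} {e : Exp} (h : Ok S e) : StepPositions (Ok S) e := by
  obtain ⟨_, h⟩ := h
  exact h.stepPositions

/-- If one side treats a position as a finished value, the other cannot step there. The clash lemmas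
discard the pairs of rules in which the two sides would act at different positions. -/
theorem Value.clash_left {S : GCtx} {v v' x : Exp} (hv : Value v) (h : Indist v v') :
    ¬ Step S v' x :=
  (hv.indist h).not_step

theorem Value.clash_right {S : GCtx} {v v' x : Exp} (hv : Value v') (h : Indist v v') :
    ¬ Step S v x :=
  (hv.indist h.symm).not_step

theorem OTy.clash_left {S : GCtx} {w : OTy} {t x : Exp} (h : Indist w.toExp t) :
    ¬ Step S t x := by
  rw [OTy.indist_toExp h]
  exact OTy.not_step

theorem OTy.clash_right {S : GCtx} {w : OTy} {t x : Exp} (h : Indist t w.toExp) :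
    ¬ Step S t x :=
  OTy.clash_left h.symm

/-- The scrutinee of a well-typed oblivious match on a boxed injection is well-typed. -/
theorem Ok.ovalTy {S : GCtx} {b : Bool} {w : OTy} {u : OVal} {e₁ e₂ : Exp}
    (h : Ok S (.omatch (.boxInj b w u) e₁ e₂)) : OValTy (.boxInj b w u) w := by
  obtain ⟨t | k, h⟩ := h.stepPositions
  · exact h.inv.1
  · exact h.inv.elim

/-- Steps of indistinguishable well-typed expressions have indistinguishable results. -/
theorem Step.indist {S : GCtx} (hS : S.Ok) {e₁ e₁' e₂ e₂' : Exp} (h₁ : Step S e₁ e₁')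
    (hi : Indist e₁ e₂) (h₂ : Step S e₂ e₂') (hw₁ : Ok S e₁) (hw₂ : Ok S e₂) :
    Indist e₁' e₂' := by
  induction h₁ generalizing e₂ e₂' with
  | fn hx =>
    cases hi
    cases h₂ with
    | fn hx' => cases hx.symm.trans hx'; exact .refl _
  | oadt hT hv =>
    cases hi with
    | oapp _ h =>
      cases h₂ with
      | cOApp h₂ => exact (hv.clash_left h h₂).elim
      | oadt hT' => cases hT.symm.trans hT'; exact .inst (.refl _) h
  | app hv =>
    cases hi with
    | app hl h =>
      cases hl with
      | lam _ hl =>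
        cases h₂ with
        | cApp₂ h₂ => exact (hv.clash_left h h₂).elim
        | cApp₁ _ h₂ => cases h₂
        | app => exact hl.inst h
  | letE hv =>
    cases hi with
    | letE h hl =>
      cases h₂ with
      | cLet h₂ => exact (hv.clash_left h h₂).elim
      | letE => exact hl.inst h
  | @ite b =>
    cases hi with
    | ite h ht hf =>
      cases h
      cases h₂ with
      | cIte h₂ => cases h₂
      | ite => cases b <;> assumption
  | @mux b _ _ hv₁ hv₂ =>
    cases hi with
    | mux h ht hf =>
      obtain ⟨_, b'⟩ := h
      cases h₂ with
      | cMux₀ h₂ => cases h₂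
      | cMux₁ _ h₂ => exact (hv₁.clash_left ht h₂).elim
      | cMux₂ _ _ h₂ => exact (hv₂.clash_left hf h₂).elim
      | mux =>
        obtain ⟨_, hw₁⟩ := hw₁
        obtain ⟨_, hk, ht₁, ht₂⟩ := hw₁.inv
        -- The two bits are unrelated, so the sides may select opposite arms. As values of one
        -- oblivious type the two arms on the left are indistinguishable, and this bridges the
        -- difference.
        have hvv := Value.indist_of_hasKind hS .nil hv₁ hv₂ hk ht₁ ht₂
        cases b <;> cases b'
        · exact hf
        · exact hvv.symm.trans ht
        · exact hvv.trans hf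
        · exact ht
  | cases hv =>
    cases hi with
    | cases _ _ h hs =>
      cases h with
      | ctor _ h =>
        -- The constructor label is an application of the embedding `C`. The redex rule yields only
        -- an equation between labels, which injectivity of `C` resolves below.
        generalize hc : Exp.ctor _ _ = c at h₂
        cases h₂ with
        | cCases h₂ =>
          subst hc
          cases h₂ with
          | cCtor h₂ => exact (hv.clash_left h h₂).elim
        | cases =>
          injection hc with hc hv
          cases Function.Embedding.injective _ hc
          subst hv
          exact (hs _).inst h
  | @proj b _ _ hv₁ hv₂ =>
    cases hi with
    | proj _ h =>
      cases h with
      | pair h h' =>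
        cases h₂ with
        | cProj h₂ => exact ((Value.pair hv₁ hv₂).clash_left (.pair h h') h₂).elim
        | proj => cases b <;> assumption
  | @psiProj b _ _ hv₁ hv₂ =>
    cases hi with
    | proj _ h =>
      cases h with
      | psiPair h h' =>
        cases h₂ with
        | cProj h₂ => exact ((Value.psiPair hv₁ hv₂).clash_left (.psiPair h h') h₂).elim
        | psiProj => cases b <;> assumption
  | sec =>
    cases hi with
    | sec h =>
      cases h
      cases h₂ with
      | cSec h₂ => cases h₂
      | sec => exact .refl _
  | @oinj b w u =>
    cases hi with
    | oinj _ h h' =>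
      cases h₂ with
      | cOInj₁ h₂ => exact (OTy.clash_left h h₂).elim
      | cOInj₂ h₂ => exact (u.value_toExp.clash_left h' h₂).elim
      | oinj =>
        rw [OTy.toExp_injective (OTy.indist_toExp h)]
        exact .boxInj _ _ _ _ _
  | @omatch b _ _ _ _ _ _ _ hu₁ hu₂ =>
    cases hi with
    | omatch h ht hf =>
      obtain _ | ⟨_, b'⟩ := h
      cases h₂ with
      | cOMatch h₂ => cases h₂
      | omatch hu₁' hu₂' =>
        cases hw₁.ovalTy with
        | osum hu =>
          cases hw₂.ovalTy with
          | osum hu' =>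
            -- In each branch, each side inserts either its payload or its guess, according to its
            -- tag. All of these inhabit the same summand, so every combination of tags is covered
            -- by `OValTy.indist`.
            refine .mux (.boxLit _ _) ?_ ?_ <;> cases b <;> cases b'
            · exact ht.inst (hu₁.indist hu₁')
            · exact ht.inst (hu₁.indist hu')
            · exact ht.inst (hu.indist hu₁')
            · exact ht.inst (hu.indist hu')
            · exact hf.inst (hu.indist hu')
            · exact hf.inst (hu.indist hu₂')
            · exact hf.inst (hu₂.indist hu')
            · exact hf.inst (hu₂.indist hu₂')
  | cProd₁ hs ih =>
    cases hi with
    | prod i₀ i₁ =>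
      obtain ⟨a₀, _⟩ := hw₁.stepPositions
      obtain ⟨b₀, _⟩ := hw₂.stepPositions
      cases h₂ with
      | cProd₁ h => exact .prod (ih i₀ h a₀ b₀) i₁
      | cProd₂ h => exact (OTy.clash_right i₀ hs).elim
  | cProd₂ hs ih =>
    cases hi with
    | prod i₀ i₁ =>
      obtain ⟨_, a₁⟩ := hw₁.stepPositions
      obtain ⟨_, b₁⟩ := hw₂.stepPositions
      cases h₂ with
      | cProd₁ h => exact (OTy.clash_left i₀ h).elim
      | cProd₂ h => exact .prod i₀ (ih i₁ h a₁ b₁)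
  | cOSum₁ hs ih =>
    cases hi with
    | osum i₀ i₁ =>
      obtain ⟨a₀, _⟩ := hw₁.stepPositions
      obtain ⟨b₀, _⟩ := hw₂.stepPositions
      cases h₂ with
      | cOSum₁ h => exact .osum (ih i₀ h a₀ b₀) i₁
      | cOSum₂ h => exact (OTy.clash_right i₀ hs).elim
  | cOSum₂ hs ih =>
    cases hi with
    | osum i₀ i₁ =>
      obtain ⟨_, a₁⟩ := hw₁.stepPositions
      obtain ⟨_, b₁⟩ := hw₂.stepPositions
      cases h₂ with
      | cOSum₁ h => exact (OTy.clash_left i₀ h).elim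
      | cOSum₂ h => exact .osum i₀ (ih i₁ h a₁ b₁)
  | cLet hs ih =>
    cases hi with
    | letE i₀ i₁ =>
      cases h₂ with
      | cLet h => exact .letE (ih i₀ h hw₁.stepPositions hw₂.stepPositions) i₁
      | letE hv => exact (Value.clash_right hv i₀ hs).elim
  | cApp₂ hs ih =>
    cases hi with
    | app i₀ i₁ =>
      obtain ⟨_, a₁⟩ := hw₁.stepPositions
      obtain ⟨_, b₁⟩ := hw₂.stepPositions
      cases h₂ with
      | cApp₂ h => exact .app i₀ (ih i₁ h a₁ b₁)
      | cApp₁ hv h => exact (hv.clash_right i₁ hs).elim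
      | app hv => exact (Value.clash_right hv i₁ hs).elim
  | cApp₁ hv₁ hs ih =>
    cases hi with
    | app i₀ i₁ =>
      obtain ⟨a₀, _⟩ := hw₁.stepPositions
      obtain ⟨b₀, _⟩ := hw₂.stepPositions
      cases h₂ with
      | cApp₂ h => exact (hv₁.clash_left i₁ h).elim
      | cApp₁ _ h => exact .app (ih i₀ h a₀ b₀) i₁
      | app hv => exact (Value.clash_right (Value.lam _ _) i₀ hs).elim
  | cCtor hs ih =>
    cases hi with
    | ctor _ i₀ =>
      cases h₂ with
      | cCtor h => exact .ctor _ (ih i₀ h hw₁.stepPositions hw₂.stepPositions)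
  | cOApp hs ih =>
    cases hi with
    | oapp _ i₀ =>
      cases h₂ with
      | cOApp h => exact .oapp _ (ih i₀ h hw₁.stepPositions hw₂.stepPositions)
      | oadt _ hv => exact (Value.clash_right hv i₀ hs).elim
  | cIte hs ih =>
    cases hi with
    | ite i₀ i₁ i₂ =>
      cases h₂ with
      | cIte h => exact .ite (ih i₀ h hw₁.stepPositions hw₂.stepPositions) i₁ i₂
      | ite => exact (Value.clash_right (Value.lit _) i₀ hs).elim
  | cMux₀ hs ih =>
    cases hi with
    | mux i₀ i₁ i₂ =>
      obtain ⟨a₀, _, _⟩ := hw₁.stepPositions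
      obtain ⟨b₀, _, _⟩ := hw₂.stepPositions
      cases h₂ with
      | cMux₀ h => exact .mux (ih i₀ h a₀ b₀) i₁ i₂
      | cMux₁ hv h => exact (hv.clash_right i₀ hs).elim
      | cMux₂ hv _ h => exact (hv.clash_right i₀ hs).elim
      | mux hv₁ hv₂ => exact (Value.clash_right (Value.boxLit _) i₀ hs).elim
  | cMux₁ hv₀ hs ih =>
    cases hi with
    | mux i₀ i₁ i₂ =>
      obtain ⟨_, a₁, _⟩ := hw₁.stepPositions
      obtain ⟨_, b₁, _⟩ := hw₂.stepPositions
      cases h₂ with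
      | cMux₀ h => exact (hv₀.clash_left i₀ h).elim
      | cMux₁ _ h => exact .mux i₀ (ih i₁ h a₁ b₁) i₂
      | cMux₂ _ hv h => exact (hv.clash_right i₁ hs).elim
      | mux hv₁ hv₂ => exact (Value.clash_right hv₁ i₁ hs).elim
  | cMux₂ hv₀ hv₁ hs ih =>
    cases hi with
    | mux i₀ i₁ i₂ =>
      obtain ⟨_, _, a₂⟩ := hw₁.stepPositions
      obtain ⟨_, _, b₂⟩ := hw₂.stepPositions
      cases h₂ with
      | cMux₀ h => exact (hv₀.clash_left i₀ h).elim
      | cMux₁ _ h => exact (hv₁.clash_left i₁ h).elim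
      | cMux₂ _ _ h => exact .mux i₀ i₁ (ih i₂ h a₂ b₂)
      | mux hv₁ hv₂ => exact (Value.clash_right hv₂ i₂ hs).elim
  | cPair₁ hs ih =>
    cases hi with
    | pair i₀ i₁ =>
      obtain ⟨a₀, _⟩ := hw₁.stepPositions
      obtain ⟨b₀, _⟩ := hw₂.stepPositions
      cases h₂ with
      | cPair₁ h => exact .pair (ih i₀ h a₀ b₀) i₁
      | cPair₂ hv h => exact (hv.clash_right i₀ hs).elim
  | cPair₂ hv₀ hs ih =>
    cases hi with
    | pair i₀ i₁ =>
      obtain ⟨_, a₁⟩ := hw₁.stepPositions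
      obtain ⟨_, b₁⟩ := hw₂.stepPositions
      cases h₂ with
      | cPair₁ h => exact (hv₀.clash_left i₀ h).elim
      | cPair₂ _ h => exact .pair i₀ (ih i₁ h a₁ b₁)
  | cPsiPair₁ hs ih =>
    cases hi with
    | psiPair i₀ i₁ =>
      obtain ⟨a₀, _⟩ := hw₁.stepPositions
      obtain ⟨b₀, _⟩ := hw₂.stepPositions
      cases h₂ with
      | cPsiPair₁ h => exact .psiPair (ih i₀ h a₀ b₀) i₁
      | cPsiPair₂ hv h => exact (hv.clash_right i₀ hs).elim
  | cPsiPair₂ hv₀ hs ih =>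
    cases hi with
    | psiPair i₀ i₁ =>
      obtain ⟨_, a₁⟩ := hw₁.stepPositions
      obtain ⟨_, b₁⟩ := hw₂.stepPositions
      cases h₂ with
      | cPsiPair₁ h => exact (hv₀.clash_left i₀ h).elim
      | cPsiPair₂ _ h => exact .psiPair i₀ (ih i₁ h a₁ b₁)
  | cProj hs ih =>
    cases hi with
    | proj _ i₀ =>
      cases h₂ with
      | cProj h => exact .proj _ (ih i₀ h hw₁.stepPositions hw₂.stepPositions)
      | proj hv₁ hv₂ => exact (Value.clash_right (hv₁.pair hv₂) i₀ hs).elim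
      | psiProj hv₁ hv₂ => exact (Value.clash_right (hv₁.psiPair hv₂) i₀ hs).elim
  | cOInj₁ hs ih =>
    cases hi with
    | oinj _ i₀ i₁ =>
      obtain ⟨a₀, _⟩ := hw₁.stepPositions
      obtain ⟨b₀, _⟩ := hw₂.stepPositions
      cases h₂ with
      | cOInj₁ h => exact .oinj _ (ih i₀ h a₀ b₀) i₁
      | cOInj₂ h => exact (OTy.clash_right i₀ hs).elim
      | oinj => exact (OTy.clash_right i₀ hs).elim
  | cOInj₂ hs ih =>
    cases hi with
    | oinj _ i₀ i₁ =>
      obtain ⟨_, a₁⟩ := hw₁.stepPositions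
      obtain ⟨_, b₁⟩ := hw₂.stepPositions
      cases h₂ with
      | cOInj₁ h => exact (OTy.clash_left i₀ h).elim
      | cOInj₂ h => exact .oinj _ i₀ (ih i₁ h a₁ b₁)
      | oinj => exact (Value.clash_right (OVal.value_toExp _) i₁ hs).elim
  | cOMatch hs ih =>
    cases hi with
    | omatch i₀ i₁ i₂ =>
      cases h₂ with
      | cOMatch h => exact .omatch (ih i₀ h hw₁.stepPositions hw₂.stepPositions) i₁ i₂
      | omatch => exact (Value.clash_right (Value.boxInj _ _ _) i₀ hs).elim
  | cCases hs ih =>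
    cases hi with
    | cases _ _ i₀ i₁ =>
      cases h₂ with
      | cCases h => exact .cases _ _ (ih i₀ h hw₁.stepPositions hw₂.stepPositions) i₁
      | cases hv => exact (Value.clash_right (hv.ctor _) i₀ hs).elim
  | cSec hs ih =>
    cases hi with
    | sec i₀ =>
      cases h₂ with
      | cSec h => exact .sec (ih i₀ h hw₁.stepPositions hw₂.stepPositions)
      | sec => exact (Value.clash_right (Value.lit _) i₀ hs).elim

/-! ### Iteration to `n` steps. -/

theorem Ok.step {S : GCtx} (hS : S.Ok) {e e' : Exp} (h : Ok S e) (hs : Step S e e') :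
    Ok S e' := by
  obtain ⟨c, h⟩ := h
  exact ⟨c, h.pared hS .nil hs.pared⟩

/-- Any step of the second expression can serve as the matching one: indistinguishability of the
results does not depend on the guesses, and preservation on both sides lets the induction go on. -/
theorem StepN.exists_of_indist {S : GCtx} (hS : S.Ok) {n : ℕ} {e₁ e₁' e₂ : Exp}
    (h : StepN S n e₁ e₁') (hi : Indist e₁ e₂) (hw₁ : Ok S e₁) (hw₂ : Ok S e₂) :
    ∃ e₂', StepN S n e₂ e₂' := by
  induction h generalizing e₂ with
  | zero => exact ⟨_, .zero _⟩
  | succ hs _ ih =>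
    obtain ⟨_, hs'⟩ := hs.exists_of_indist hi
    obtain ⟨_, h⟩ := ih (hs.indist hS hi hs' hw₁ hw₂) (hw₁.step hS hs) (hw₂.step hS hs')
    exact ⟨_, .succ hs' h⟩

theorem StepN.indist {S : GCtx} (hS : S.Ok) {n : ℕ} {e₁ e₁' e₂ e₂' : Exp}
    (h : StepN S n e₁ e₁') (hi : Indist e₁ e₂) (h' : StepN S n e₂ e₂') (hw₁ : Ok S e₁)
    (hw₂ : Ok S e₂) : Indist e₁' e₂' := by
  induction h generalizing e₂ with
  | zero => cases h'; exact hi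
  | succ hs _ ih =>
    cases h' with
    | succ hs' h' =>
      exact ih (hs.indist hS hi hs' hw₁ hw₂) h' (hw₁.step hS hs) (hw₂.step hS hs')

end OADT

theorem theorem1 (S : OADT.GCtx) (hS : S.Ok) (e₁ e₂ t₁ t₂ : OADT.Exp)
    (hind : OADT.Indist e₁ e₂)
    (h₁ : OADT.HasType S [] e₁ t₁) (h₂ : OADT.HasType S [] e₂ t₂) (n : ℕ) :
    ((∃ e₁', OADT.StepN S n e₁ e₁') ↔ ∃ e₂', OADT.StepN S n e₂ e₂') ∧
      ∀ e₁' e₂', OADT.StepN S n e₁ e₁' → OADT.StepN S n e₂ e₂' → OADT.Indist e₁' e₂' := by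
  -- Only the existence of some type is kept, so the two types need not be related.
  have hw₁ : OADT.Ok S e₁ := ⟨_, h₁⟩
  have hw₂ : OADT.Ok S e₂ := ⟨_, h₂⟩
  exact ⟨⟨fun ⟨_, h⟩ => h.exists_of_indist hS hind hw₁ hw₂,
      fun ⟨_, h⟩ => h.exists_of_indist hS hind.symm hw₂ hw₁⟩,
    fun _ _ h h' => h.indist hS hind h' hw₁ hw₂⟩
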